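/- **Setting.** Let $k$ be a commutative ring; dg-categories are over $k$, with differentials of degree $+1$. A degree $0$ morphism is *homotopy invertible* if it is closed and becomes an isomorphism in the homotopy category $H^0$. *The dg-category $\Delta_n(\mathcal B)$.* Let $\mathcal B$ be a dg-category. For families $(E_i)$, $(F_i)$, $0\le i\le n$, of objects, a cochain $\theta$ of degree $m$ from $E$ to $F$ is a family $\theta^{q,m-q}_{i_0\ldots i_q}\in\mathrm{Hom}^{m-q}_{\mathcal B}(E_{i_q},F_{i_0})$, for $q\ge 0$ and $0\le i_0\le\dots\le i_q\le n$. Put $$(D\theta)_{i_0\ldots i_q}=(-1)^q d(\theta_{i_0\ldots i_q})+\sum_{j=1}^{q-1}(-1)^j\theta_{i_0\ldots\widehat{i_j}\ldots i_q},\qquad (\theta\cdot\eta)_{i_0\ldots i_q}=\sum_{j=0}^{q}(-1)^{(a-j)(q-j)}\theta_{i_0\ldots i_j}\circ\eta_{i_j\ldots i_q}$$ for $\theta$ of degree $a$. An object of $\Delta_n(\mathcal B)$ is a family $E=(E_i)$ with a degree $1$ cochain $\phi$ from $E$ to $E$ with no components for $q=0$, such that $D\phi+\phi\cdot\phi=0$,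 all $\phi^{1,0}_{ij}$ $(i\le j)$ are homotopy invertible, and (N) $\phi^{1,0}_{ii}=\mathrm{id}$, and $\phi^{q,1-q}_{i_0\ldots i_q}=0$ if $q\ge2$ and an index is repeated. Morphisms from $(E,\phi)$ to $(F,\psi)$ of degree $m$ are the cochains of degree $m$, composed by $\cdot$, with differential $d\theta=D\theta+\psi\cdot\theta-(-1)^m\theta\cdot\phi$. Write $\Delta_n^{\mathrm{un}}(\mathcal B)$ for the variant in which (N) is not required. Both are contravariant in $[n]$ by restriction of indices, and functorial in $\mathcal B$. *Totalization.* For a cosimplicial dg-category $\mathcal B^\bullet$, $\mathrm{Tot}(\mathcal B^\bullet)$ is the equalizer of the two dg-functors $\prod_n\Delta_n(\mathcal B^n)\rightrightarrows\prod_{\sigma:[n]\to[m]}\Delta_n(\mathcal B^m)$ that are induced by $\Delta_n(\sigma_*):\Delta_n(\mathcal B^n)\to\Delta_n(\mathcal B^m)$ and by $\sigma^*:\Delta_m(\mathcal B^m)\to\Delta_n(\mathcal B^m)$. With $\Delta_n^{\mathrm{un}}$ in place of $\Delta_n$ one gets $\mathrm{Tot}^{\mathrm{un}}(\mathcal B^\bullet)$.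 *Rectification.* Let $\mathcal F$ be a dg pseudo-functor on the category $\mathcal S$ of schemes over a base scheme: dg-categories $\mathcal F(X)$, dg-functors $f^*$, and strict natural isomorphisms $\mathrm{id}_X^*\cong\mathrm{id}$ and $f^*g^*\cong(gf)^*$ that satisfy the usual unit and associativity conditions strictly. Its rectification $\widetilde{\mathcal F}:\mathcal S^{op}\to\mathrm{dgCat}$ is the strict functor $\widetilde{\mathcal F}(X)=\mathrm{Fun}_{\mathcal S}(\mathcal S/X,\mathcal F)$: an object $\xi$ consists of objects $\xi(h)\in\mathcal F(Y)$ for all $h:Y\to X$ and of compatible closed degree $0$ strict isomorphisms $\xi(hg)\cong g^*\xi(h)$; morphisms of degree $n$ are natural families of degree $n$ morphisms $\xi(h)\to\eta(h)$; and $f^*$ is composition with $\mathcal S/f$. *Group action.* Let $G$ be a group scheme acting from the right on a scheme $X$ (in $\mathcal S$), and let $[X/G]_\bullet$ be the simplicial scheme with $[X/G]_n=X\times G^n$, with face maps $\partial_0(x,g_1,\ldots,g_n)=(xg_1,g_2,\ldots,g_n)$, $\partial_i(x,g_1,\ldots,g_n)=(x,g_1,\ldots,g_ig_{i+1},\ldots,g_n)$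 for $0<i<n$, $\partial_n(x,g_1,\ldots,g_n)=(x,g_1,\ldots,g_{n-1})$, and degeneracies $s_i(x,g_1,\ldots,g_n)=(x,g_1,\ldots,g_i,e,g_{i+1},\ldots,g_n)$. For $p\le n$ let $\rho_{n,p},\tau_{n,p}:[X/G]_n\to[X/G]_p$ be the front and back face maps $$\rho_{n,p}(x,g_1,\ldots,g_n)=(x,g_1,\ldots,g_p),\qquad \tau_{n,p}(x,g_1,\ldots,g_n)=(xg_1\cdots g_{n-p},g_{n-p+1},\ldots,g_n).$$ **Proposition.** The dg-category $\mathrm{Tot}\,\widetilde{\mathcal F}([X/G]_\bullet)$ is isomorphic to the following one. *Objects:* pairs $(E,\phi)$ of an object $E$ of $\widetilde{\mathcal F}(X)$ and a collection $\phi^{n,1-n}\in\mathrm{Hom}^{1-n}_{\widetilde{\mathcal F}([X/G]_n)}(\tau_{n,0}^*E,\rho_{n,0}^*E)$, $n\ge1$, such that 1. for all $n\ge1$ $$(-1)^n d(\phi^{n,1-n})+\sum_{j=1}^{n-1}(-1)^j\partial_j^*(\phi^{n-1,2-n})+\sum_{j=1}^{n-1}(-1)^{(1-j)(n-j)}\rho_{n,j}^*(\phi^{j,1-j})\circ\tau_{n,n-j}^*(\phi^{n-j,1-n+j})=0;$$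 2. $\phi^{1,0}$ is homotopy invertible; 3. $s_0^*\phi^{1,0}=\mathrm{id}$, and $s_i^*\phi^{n,1-n}=0$ for all $n\ge2$ and $0\le i\le n-1$. *Morphisms* of degree $m$ from $(E,\phi)$ to $(F,\psi)$: collections $\theta^{n,m-n}\in\mathrm{Hom}^{m-n}_{\widetilde{\mathcal F}([X/G]_n)}(\tau_{n,0}^*E,\rho_{n,0}^*F)$, $n\ge0$, with differential $$(d\theta)^{n,m+1-n}=(-1)^n d\theta^{n,m-n}+\sum_{j=1}^{n-1}(-1)^j\partial_j^*\theta^{n-1,m+1-n}+\sum_{l=1}^{n}(-1)^{(1-l)(n-l)}\rho_{n,l}^*\psi^{l,1-l}\circ\tau_{n,n-l}^*\theta^{n-l,m-n+l}-(-1)^m\sum_{l=0}^{n-1}(-1)^{(m-l)(n-l)}\rho_{n,l}^*\theta^{l,m-l}\circ\tau_{n,n-l}^*\phi^{n-l,1-n+l}.$$ *Composition* of $\theta:(E',\phi')\to(E'',\phi'')$ of degree $p$ with $\eta:(E,\phi)\to(E',\phi')$ of degree $q$: $(\theta\eta)^{n,p+q-n}=\sum_{l=0}^n(-1)^{(p-l)(n-l)}\rho_{n,l}^*\theta^{l,p-l}\circ\tau_{n,n-l}^*\eta^{n-l,q-n+l}$;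 the identity has $\mathrm{id}_E$ in simplicial degree $0$ and $0$ elsewhere. The isomorphism sends an object of the totalization with components $(E^n,\phi_n)\in\Delta_n(\widetilde{\mathcal F}([X/G]_n))$ to $E=E^0_0$ and $\phi^{n,1-n}=(\phi_n)_{0\,1\ldots n}$, and a morphism with components $\theta_n$ to $\theta^{n,m-n}=(\theta_n)_{0\,1\ldots n}$; it is $k$-linear on morphisms. The same holds for $\mathrm{Tot}^{\mathrm{un}}\,\widetilde{\mathcal F}([X/G]_\bullet)$ with condition 3 omitted: its objects are exactly the pairs $(E,\phi)$ that satisfy 1 and 2. -/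

import Mathlib

open CategoryTheory

set_option linter.checkUnivs false

universe w v u v' u' v₁ u₁

/-- A differential graded category over a commutative ring `k`, with cohomological grading.
Degrees of differentials and of composites are tracked by equations between integers. -/
structure DGCat (k : Type w) [CommRing k] where
  Obj : Type u
  Hom : Obj → Obj → ℤ → Type v
  [addCommGroup : ∀ x y n, AddCommGroup (Hom x y n)]
  [module : ∀ x y n, Module k (Hom x y n)]
  d : ∀ {x y : Obj} {n m : ℤ}, n + 1 = m → (Hom x y n →ₗ[k] Hom x y m)
  /-- `comp h f g` is `f ∘ g`. -/
  comp : ∀ {x y z : Obj} {p q n : ℤ}, p + q = n → (Hom y z p →ₗ[k] Hom x y q →ₗ[k] Hom x z n)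
  id : ∀ x : Obj, Hom x x 0
  d_d : ∀ {x y : Obj} {n m l : ℤ} (h : n + 1 = m) (h' : m + 1 = l) (f : Hom x y n),
    d h' (d h f) = 0
  leibniz : ∀ {x y z : Obj} {p p' q q' n m : ℤ} (h : p + q = n) (hn : n + 1 = m)
    (hp : p + 1 = p') (hq : q + 1 = q') (f : Hom y z p) (g : Hom x y q),
    d hn (comp h f g) =
      comp (by omega) (d hp f) g + p.negOnePow • comp (by omega) f (d hq g)
  assoc : ∀ {x y z t : Obj} {p q r a b n : ℤ} (h₁ : p + q = a) (h₂ : a + r = n)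
    (h₃ : q + r = b) (h₄ : p + b = n) (f : Hom z t p) (g : Hom y z q) (e : Hom x y r),
    comp h₂ (comp h₁ f g) e = comp h₄ f (comp h₃ g e)
  id_comp : ∀ {x y : Obj} {n : ℤ} (h : 0 + n = n) (f : Hom x y n), comp h (id y) f = f
  comp_id : ∀ {x y : Obj} {n : ℤ} (h : n + 0 = n) (f : Hom x y n), comp h f (id x) = f

attribute [instance] DGCat.addCommGroup DGCat.module

namespace DGCat

variable {k : Type w} [CommRing k]

/-- Transport of morphisms along equalities of source, target and degree. -/
def castHom (C : DGCat.{w, v, u} k) {x x' y y' : C.Obj} {n n' : ℤ}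
    (hx : x = x') (hy : y = y') (hn : n = n') : C.Hom x y n →ₗ[k] C.Hom x' y' n' := by
  subst hx hy hn
  exact LinearMap.id

/-- A degree `0` morphism is invertible up to homotopy if it is closed and becomes an
isomorphism in the homotopy category `H⁰`. -/
def HomotopyInvertible (C : DGCat.{w, v, u} k) {x y : C.Obj} {n : ℤ} (hn : n = 0)
    (f : C.Hom x y n) : Prop :=
  C.d (m := 1) (by omega) f = 0 ∧ ∃ (g : C.Hom y x 0) (a : C.Hom x x (-1)) (b : C.Hom y y (-1)),
    C.d (m := 1) (by omega) g = 0 ∧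
    C.comp (by omega) g f - C.id x = C.d (by omega) a ∧
    C.comp (by omega) f g - C.id y = C.d (by omega) b

/-- A strict isomorphism: a closed degree `0` morphism with a two-sided inverse. -/
def IsStrictIso (C : DGCat.{w, v, u} k) {x y : C.Obj} (f : C.Hom x y 0) : Prop :=
  C.d (m := 1) (by omega) f = 0 ∧ ∃ g : C.Hom y x 0, C.d (m := 1) (by omega) g = 0 ∧
    C.comp (by omega) g f = C.id x ∧ C.comp (by omega) f g = C.id y

end DGCat

/-- A dg-functor. -/
structure DGFunctor {k : Type w} [CommRing k] (A : DGCat.{w, v, u} k)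
    (B : DGCat.{w, v', u'} k) where
  obj : A.Obj → B.Obj
  map : ∀ {x y : A.Obj} {n : ℤ}, A.Hom x y n →ₗ[k] B.Hom (obj x) (obj y) n
  map_d : ∀ {x y : A.Obj} {n m : ℤ} (h : n + 1 = m) (f : A.Hom x y n),
    map (A.d h f) = B.d h (map f)
  map_comp : ∀ {x y z : A.Obj} {p q n : ℤ} (h : p + q = n) (f : A.Hom y z p) (g : A.Hom x y q),
    map (A.comp h f g) = B.comp h (map f) (map g)
  map_id : ∀ x : A.Obj, map (A.id x) = B.id (obj x)

namespace DGCat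

variable {k : Type w} [CommRing k]

/-- The category of (small) dg-categories and dg-functors. -/
instance : Category (DGCat.{w, v, u} k) where
  Hom A B := DGFunctor A B
  id A :=
    { obj := fun x => x
      map := LinearMap.id
      map_d := fun _ _ => rfl
      map_comp := fun _ _ _ => rfl
      map_id := fun _ => rfl }
  comp F G :=
    { obj := fun x => G.obj (F.obj x)
      map := G.map.comp F.map
      map_d := fun h f => by simp [F.map_d, G.map_d]
      map_comp := fun h f g => by simp [F.map_comp, G.map_comp]
      map_id := fun x => by simp [F.map_id, G.map_id] }

/-- The product of a family of dg-categories. -/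
def pi {ι : Type} (C : ι → DGCat.{w, v, u} k) : DGCat.{w, v, u} k where
  Obj := ∀ i, (C i).Obj
  Hom x y n := ∀ i, (C i).Hom (x i) (y i) n
  d h := LinearMap.pi fun i => ((C i).d h).comp (LinearMap.proj i)
  comp h := LinearMap.mk₂ k (fun f g i => (C i).comp h (f i) (g i))
    (fun _ _ _ => by ext; simp) (fun _ _ _ => by ext; simp)
    (fun _ _ _ => by ext; simp) (fun _ _ _ => by ext; simp)
  id x i := (C i).id (x i)
  d_d h h' f := by ext i; exact (C i).d_d h h' (f i)
  leibniz h hn hp hq f g := by ext i; exact (C i).leibniz h hn hp hq (f i) (g i)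
  assoc h₁ h₂ h₃ h₄ f g e := by ext i; exact (C i).assoc h₁ h₂ h₃ h₄ (f i) (g i) (e i)
  id_comp h f := by ext i; exact (C i).id_comp h (f i)
  comp_id h f := by ext i; exact (C i).comp_id h (f i)

/-- The projections of a product of dg-categories. -/
def piProj {ι : Type} (C : ι → DGCat.{w, v, u} k) (i : ι) : pi C ⟶ C i where
  obj x := x i
  map :=
    { toFun := fun f => f i
      map_add' := fun _ _ => rfl
      map_smul' := fun _ _ => rfl }
  map_d _ _ := rfl
  map_comp _ _ _ := rfl
  map_id _ := rfl

/-- The dg-functor into a product with given components. -/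
def piLift {ι : Type} {A : DGCat.{w, v, u} k} {C : ι → DGCat.{w, v, u} k}
    (F : ∀ i, A ⟶ C i) : A ⟶ pi C where
  obj x i := (F i).obj x
  map := LinearMap.pi fun i => (F i).map
  map_d h f := funext fun i => (F i).map_d h f
  map_comp h f g := funext fun i => (F i).map_comp h f g
  map_id x := funext fun i => (F i).map_id x

section castHom

variable (C : DGCat.{w, v, u} k)

theorem castHom_d {x x' y y' : C.Obj} {n n' m m' : ℤ} (hx : x = x') (hy : y = y')
    (hn : n = n') (hm : m = m') (h : n + 1 = m) (f : C.Hom x y n) :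
    C.castHom hx hy hm (C.d h f) = C.d (by omega) (C.castHom hx hy hn f) := by
  subst hx hy hn hm; rfl

theorem castHom_comp {x x' y y' z z' : C.Obj} {p p' q q' n n' : ℤ} (hx : x = x') (hy : y = y')
    (hz : z = z') (hp : p = p') (hq : q = q') (hn : n = n') (h : p + q = n)
    (f : C.Hom y z p) (g : C.Hom x y q) :
    C.castHom hx hz hn (C.comp h f g) =
      C.comp (by omega) (C.castHom hy hz hp f) (C.castHom hx hy hq g) := by
  subst hx hy hz hp hq hn; rfl

theorem castHom_id {x x' : C.Obj} (hx : x = x') : C.castHom hx hx rfl (C.id x) = C.id x' := by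
  subst hx; rfl

end castHom

/-- The equalizer of two dg-functors: the objects on which they agree, and the morphisms
between those on which they agree. -/
def equalizer {A B : DGCat.{w, v, u} k} (F G : A ⟶ B) : DGCat.{w, v, u} k where
  Obj := {x : A.Obj // F.obj x = G.obj x}
  Hom x y n := LinearMap.eqLocus ((B.castHom x.2 y.2 (rfl : n = n)).comp F.map) G.map
  d {x y n m} h := (A.d h).restrict (by
    intro f hf
    have hf' : B.castHom x.2 y.2 rfl (F.map f) = G.map f := hf
    change B.castHom x.2 y.2 rfl (F.map (A.d h f)) = G.map (A.d h f)
    rw [F.map_d, G.map_d, B.castHom_d x.2 y.2 rfl rfl, hf'])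
  comp {x y z p q n} h := LinearMap.mk₂ k
    (fun f g => ⟨A.comp h f.1 g.1, by
      have hf : B.castHom y.2 z.2 rfl (F.map f.1) = G.map f.1 := f.2
      have hg : B.castHom x.2 y.2 rfl (F.map g.1) = G.map g.1 := g.2
      change B.castHom x.2 z.2 rfl (F.map (A.comp h f.1 g.1)) = G.map (A.comp h f.1 g.1)
      rw [F.map_comp, G.map_comp, B.castHom_comp x.2 y.2 z.2 rfl rfl rfl, hf, hg]⟩)
    (fun _ _ _ => by ext; simp) (fun _ _ _ => by ext; simp)
    (fun _ _ _ => by ext; simp) (fun _ _ _ => by ext; simp)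
  id x := ⟨A.id x.1, by
    change B.castHom x.2 x.2 rfl (F.map (A.id x.1)) = G.map (A.id x.1)
    rw [F.map_id, G.map_id, B.castHom_id]⟩
  d_d h h' f := Subtype.ext (A.d_d h h' f.1)
  leibniz h hn hp hq f g := Subtype.ext (A.leibniz h hn hp hq f.1 g.1)
  assoc h₁ h₂ h₃ h₄ f g e := Subtype.ext (A.assoc h₁ h₂ h₃ h₄ f.1 g.1 e.1)
  id_comp h f := Subtype.ext (A.id_comp h f.1)
  comp_id h f := Subtype.ext (A.comp_id h f.1)

end DGCat

namespace DGCat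

variable {k : Type w} [CommRing k]

section Cochains

variable {B : DGCat.{w, v, u} k} {N : ℕ}

/-- Degree `m` cochains from `E` to `F`: a family of morphisms
`θ_{i₀…i_q} ∈ Hom^{m-q}(E_{i_q}, F_{i₀})` indexed by all multi-indices
`0 ≤ i₀ ≤ … ≤ i_q ≤ N`, that is, all order preserving maps `[q] → [N]`. -/
abbrev Coch (B : DGCat.{w, v, u} k) {N : ℕ} (E F : Fin (N + 1) → B.Obj) (m : ℤ) : Type v :=
  ∀ (q : ℕ) (I : Fin (q + 1) →o Fin (N + 1)), B.Hom (E (I (Fin.last q))) (F (I 0)) (m - q)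

namespace Coch

/-- `s` and `t` are the smallest and the largest element of `A`. -/
def Ends {q : ℕ} (A : Finset (Fin (q + 1))) (s t : Fin (q + 1)) : Prop :=
  s ∈ A ∧ t ∈ A ∧ ∀ x ∈ A, s ≤ x ∧ x ≤ t

theorem Ends.card {q : ℕ} {A : Finset (Fin (q + 1))} {s t : Fin (q + 1)} (h : Ends A s t) :
    A.card = A.card - 1 + 1 := by
  have := Finset.card_pos.2 ⟨s, h.1⟩
  omega

theorem Ends.emb_zero {q : ℕ} {A : Finset (Fin (q + 1))} {s t : Fin (q + 1)} (h : Ends A s t) :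
    A.orderEmbOfFin h.card 0 = s := by
  rw [show (0 : Fin (A.card - 1 + 1)) = ⟨0, by omega⟩ from rfl, Finset.orderEmbOfFin_zero]
  exact le_antisymm (Finset.min'_le _ _ h.1) ((h.2.2 _ (Finset.min'_mem _ _)).1)

theorem Ends.emb_last {q : ℕ} {A : Finset (Fin (q + 1))} {s t : Fin (q + 1)} (h : Ends A s t) :
    A.orderEmbOfFin h.card (Fin.last _) = t := by
  rw [show Fin.last (A.card - 1) = ⟨A.card - 1 + 1 - 1, by omega⟩ from rfl,
    Finset.orderEmbOfFin_last _ (by omega)]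
  exact le_antisymm ((h.2.2 _ (Finset.max'_mem _ _)).2) (Finset.le_max' _ _ h.2.1)

open Classical in
/-- The component of degree `r` of the cochain `θ` at the multi-index which is obtained from
`I = (i₀, …, i_q)` by keeping the entries `i_a` at the places `a ∈ A` only, where `s` is the
smallest and `t` is the largest element of `A`. (The value is `0` if `s` and `t` are not these
elements, or if `r` is not the right degree.) -/
noncomputable def ev {E F : Fin (N + 1) → B.Obj} {m : ℤ} (θ : Coch B E F m) {q : ℕ}
    (I : Fin (q + 1) →o Fin (N + 1)) (A : Finset (Fin (q + 1))) (s t : Fin (q + 1)) (r : ℤ) :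
    B.Hom (E (I t)) (F (I s)) r :=
  if h : Ends A s t ∧ r + A.card = m + 1 then
    B.castHom (by exact congrArg (fun a => E (I a)) h.1.emb_last)
      (by exact congrArg (fun a => F (I a)) h.1.emb_zero) (by have := h.1.card; have := h.2; omega)
      (θ (A.card - 1) (I.comp (A.orderEmbOfFin h.1.card).toOrderHom))
  else 0

/-- The differential `(Dθ)_{i₀…i_q} = (-1)^q d(θ_{i₀…i_q}) + ∑_{0<j<q} (-1)^j θ_{i₀…î_j…i_q}`. -/
noncomputable def diff {E F : Fin (N + 1) → B.Obj} {m m' : ℤ} (h : m + 1 = m')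
    (θ : Coch B E F m) : Coch B E F m' :=
  fun q I => (q : ℤ).negOnePow • B.d (by omega) (θ q I) +
    ∑ j ∈ (Finset.univ.erase 0).erase (Fin.last q),
      ((j : ℕ) : ℤ).negOnePow • θ.ev I (Finset.univ.erase j) 0 (Fin.last q) (m' - q)

/-- The shuffled multiplication
`(θ · η)_{i₀…i_q} = ∑_j (-1)^{(a-j)(q-j)} θ_{i₀…i_j} ∘ η_{i_j…i_q}`, for `θ` of total degree `a`;
here `a - j` is the degree of `θ_{i₀…i_j}` in `B`. -/
noncomputable def mul {E F G : Fin (N + 1) → B.Obj} {a b m : ℤ} (h : a + b = m)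
    (θ : Coch B F G a) (η : Coch B E F b) : Coch B E G m :=
  fun q I => ∑ j : Fin (q + 1), ((a - (j : ℕ)) * ((q : ℤ) - (j : ℕ))).negOnePow •
    B.comp (by omega) (θ.ev I (Finset.Iic j) 0 j (a - (j : ℕ)))
      (η.ev I (Finset.Ici j) j (Fin.last q) (b - ((q : ℤ) - (j : ℕ))))

/-- The unit cochain: `id` in simplicial degree `0`, and `0` elsewhere. -/
def one (E : Fin (N + 1) → B.Obj) : Coch B E E 0
  | 0, I => B.castHom rfl rfl (by simp) (B.id (E (I 0)))
  | _ + 1, _ => 0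

/-! ### The laws of a dg-category -/

section Laws

variable {E F G H : Fin (N + 1) → B.Obj}

theorem cast_apply {m : ℤ} (θ : Coch B E F m) {q q' : ℕ} (hq : q = q')
    (I : Fin (q + 1) →o Fin (N + 1)) (I' : Fin (q' + 1) →o Fin (N + 1))
    (hI : ∀ i : Fin (q + 1), I i = I' (Fin.cast (by omega) i))
    {x : B.Obj} {y : B.Obj} {r : ℤ} (hx hy hr hx' hy' hr') :
    (B.castHom hx hy hr (θ q I) : B.Hom x y r) = B.castHom hx' hy' hr' (θ q' I') := by
  subst hq
  obtain rfl : I = I' := OrderHom.ext _ _ (funext fun i => hI i)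
  rfl

theorem ev_of {m : ℤ} (θ : Coch B E F m) {q l : ℕ} (I : Fin (q + 1) →o Fin (N + 1))
    (e : Fin (l + 1) ↪o Fin (q + 1)) (r : ℤ) (hr : r + l = m) {A s t}
    (hA : A = Finset.univ.map e.toEmbedding) (hs : s = e 0) (ht : t = e (Fin.last l)) :
    θ.ev I A s t r =
      B.castHom (by rw [ht]; rfl) (by rw [hs]; rfl) (by omega) (θ l (I.comp e.toOrderHom)) := by
  have hc : A.card = l + 1 := by simp [hA]
  have hE : Ends A s t := by
    subst hA hs ht
    refine ⟨by simp, by simp, ?_⟩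
    intro x hx
    obtain ⟨i, -, rfl⟩ := Finset.mem_map.1 hx
    exact ⟨e.monotone (Fin.zero_le _), e.monotone (Fin.le_last _)⟩
  rw [ev, dif_pos ⟨hE, by omega⟩]
  refine cast_apply θ (by omega : A.card - 1 = l) _ _ ?_ _ _ _ _ _ _
  intro i
  have := Finset.orderEmbOfFin_unique' (s := A) (k := l + 1) hc (f := e) (by
    intro x; simp [hA])
  change I _ = I (e _)
  rw [this]
  congr 1

theorem ev_univ {m : ℤ} (θ : Coch B E F m) {q : ℕ} (I : Fin (q + 1) →o Fin (N + 1)) :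
    θ.ev I Finset.univ 0 (Fin.last q) (m - q) = θ q I := by
  exact θ.ev_of (l := q) I (OrderIso.refl _).toOrderEmbedding (m - q) (by omega)
    (by ext; simp) rfl rfl

theorem ev_zero_of {m : ℤ} (θ : Coch B E F m) {q : ℕ} (I : Fin (q + 1) →o Fin (N + 1))
    {A s t r} (h : ¬ (Ends A s t ∧ r + A.card = m + 1)) : θ.ev I A s t r = 0 := dif_neg h

theorem ev_comp_emb {m : ℤ} (θ : Coch B E F m) {q l : ℕ} (I : Fin (q + 1) →o Fin (N + 1))
    (e : Fin (l + 1) ↪o Fin (q + 1)) (A : Finset (Fin (l + 1))) (s t : Fin (l + 1)) (r : ℤ) :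
    θ.ev (I.comp e.toOrderHom) A s t r = θ.ev I (A.map e.toEmbedding) (e s) (e t) r := by
  have key : Ends (A.map e.toEmbedding) (e s) (e t) ↔ Ends A s t := by
    simp [Ends]
  by_cases h : Ends A s t ∧ r + A.card = m + 1
  · have hc := h.1.card
    rw [θ.ev_of (l := A.card - 1) I ((A.orderEmbOfFin hc).trans e) r (by omega) (by
        ext x
        simp only [Finset.mem_map, Finset.mem_univ, true_and]
        constructor
        · rintro ⟨y, hy, rfl⟩
          have : y ∈ Set.range (A.orderEmbOfFin hc) := by
            rw [Finset.range_orderEmbOfFin]; exact hy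
          obtain ⟨i, rfl⟩ := this
          exact ⟨i, rfl⟩
        · rintro ⟨i, rfl⟩
          exact ⟨_, Finset.orderEmbOfFin_mem A hc i, rfl⟩)
      (by simp [h.1.emb_zero]) (by simp [h.1.emb_last])]
    rw [ev, dif_pos h]
    rfl
  · have h' : θ.ev I (A.map e.toEmbedding) (e s) (e t) r = 0 :=
      ev_zero_of _ _ (by rwa [key, Finset.card_map])
    exact (ev_zero_of _ _ h).trans h'.symm

theorem Ends.exists_emb {q : ℕ} {A : Finset (Fin (q + 1))} {s t : Fin (q + 1)} (h : Ends A s t) :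
    ∃ (l : ℕ) (e : Fin (l + 1) ↪o Fin (q + 1)),
      A = Finset.univ.map e.toEmbedding ∧ s = e 0 ∧ t = e (Fin.last l) := by
  refine ⟨A.card - 1, A.orderEmbOfFin h.card, ?_, h.emb_zero.symm, h.emb_last.symm⟩
  apply Finset.coe_injective
  rw [Finset.coe_map, Finset.coe_univ, Set.image_univ]
  exact (Finset.range_orderEmbOfFin A h.card).symm

theorem comp_ev_congr {a b : ℤ} (θ : Coch B F G a) (η : Coch B E F b) {q : ℕ}
    (I : Fin (q + 1) →o Fin (N + 1)) {A₁ A₁' A₂ A₂' : Finset (Fin (q + 1))}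
    {s j t : Fin (q + 1)} {r₁ r₁' r₂ r₂' r : ℤ} (hA₁ : A₁ = A₁') (hA₂ : A₂ = A₂')
    (h₁ : r₁ = r₁') (h₂ : r₂ = r₂') (h : r₁ + r₂ = r) :
    B.comp h (θ.ev I A₁ s j r₁) (η.ev I A₂ j t r₂) =
      B.comp (by omega) (θ.ev I A₁' s j r₁') (η.ev I A₂' j t r₂') := by
  subst hA₁ hA₂ h₁ h₂; rfl

theorem ev_mul {a b m : ℤ} (h : a + b = m) (θ : Coch B F G a) (η : Coch B E F b) {q : ℕ}
    (I : Fin (q + 1) →o Fin (N + 1)) {A : Finset (Fin (q + 1))} {s t : Fin (q + 1)} {r : ℤ}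
    (hA : Ends A s t) (hr : r + A.card = m + 1) :
    (mul h θ η).ev I A s t r = ∑ j ∈ A,
      ((a + 1 - (A.filter (· ≤ j)).card) * ((A.filter (j ≤ ·)).card - 1)).negOnePow •
      B.comp (by omega) (θ.ev I (A.filter (· ≤ j)) s j (a + 1 - (A.filter (· ≤ j)).card))
        (η.ev I (A.filter (j ≤ ·)) j t (r - (a + 1 - (A.filter (· ≤ j)).card))) := by
  obtain ⟨l, e, rfl, rfl, rfl⟩ := hA.exists_emb
  simp only [Finset.card_map, Finset.card_univ, Fintype.card_fin, Nat.cast_add, Nat.cast_one] at hr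
  obtain rfl : r = m - l := by omega
  have h1 := (mul h θ η).ev_comp_emb I e Finset.univ 0 (Fin.last l) (m - l)
  rw [← h1]
  refine (ev_univ _ _).trans ?_
  rw [Finset.sum_map]
  refine Finset.sum_congr rfl fun i _ => ?_
  have e1 : (Finset.univ.map e.toEmbedding).filter (· ≤ e i) =
      (Finset.Iic i).map e.toEmbedding := by
    ext x; simp only [Finset.mem_filter, Finset.mem_map, Finset.mem_univ, true_and,
      Finset.mem_Iic]
    constructor
    · rintro ⟨⟨y, rfl⟩, hy⟩; exact ⟨y, by simpa using hy, rfl⟩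
    · rintro ⟨y, hy, rfl⟩; exact ⟨⟨y, rfl⟩, by simpa using hy⟩
  have e2 : (Finset.univ.map e.toEmbedding).filter (e i ≤ ·) =
      (Finset.Ici i).map e.toEmbedding := by
    ext x; simp only [Finset.mem_filter, Finset.mem_map, Finset.mem_univ, true_and,
      Finset.mem_Ici]
    constructor
    · rintro ⟨⟨y, rfl⟩, hy⟩; exact ⟨y, by simpa using hy, rfl⟩
    · rintro ⟨y, hy, rfl⟩; exact ⟨⟨y, rfl⟩, by simpa using hy⟩
  have c1 : (((Finset.univ.map e.toEmbedding).filter (· ≤ e i)).card : ℤ) = i + 1 := by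
    rw [e1, Finset.card_map, Fin.card_Iic]; push_cast; rfl
  have c2 : (((Finset.univ.map e.toEmbedding).filter (e i ≤ ·)).card : ℤ) = l + 1 - i := by
    rw [e2, Finset.card_map, Fin.card_Ici]; have := i.2; omega
  refine congrArg₂ (· • ·) ?_ ?_
  · change _ = ((a + 1 - (((Finset.univ.map e.toEmbedding).filter (· ≤ e i)).card : ℤ)) *
      ((((Finset.univ.map e.toEmbedding).filter (e i ≤ ·)).card : ℤ) - 1)).negOnePow
    rw [c1, c2]; congr 1; ring
  · have t1 := θ.ev_comp_emb I e (Finset.Iic i) 0 i (a - i)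
    have t2 := η.ev_comp_emb I e (Finset.Ici i) i (Fin.last l) (b - (l - i))
    refine (congrArg₂ (fun x y => B.comp _ x y) t1 t2).trans ?_
    refine comp_ev_congr θ η I e1.symm e2.symm ?_ ?_ _
    · change _ = a + 1 - (((Finset.univ.map e.toEmbedding).filter (· ≤ e i)).card : ℤ)
      rw [c1]; ring
    · change _ = m - l - (a + 1 - (((Finset.univ.map e.toEmbedding).filter (· ≤ e i)).card : ℤ))
      rw [c1, ← h]; ring

theorem d_ev_congr {m : ℤ} (θ : Coch B E F m) {q : ℕ}
    (I : Fin (q + 1) →o Fin (N + 1)) {A : Finset (Fin (q + 1))}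
    {s t : Fin (q + 1)} {r r' r₁ : ℤ} (h : r = r') (h' : r + 1 = r₁) :
    B.d h' (θ.ev I A s t r) = B.d (by omega) (θ.ev I A s t r') := by
  subst h; rfl

theorem ev_diff {m m' : ℤ} (h : m + 1 = m') (θ : Coch B E F m) {q : ℕ}
    (I : Fin (q + 1) →o Fin (N + 1)) {A : Finset (Fin (q + 1))} {s t : Fin (q + 1)} {r : ℤ}
    (hA : Ends A s t) (hr : r + A.card = m' + 1) :
    (diff h θ).ev I A s t r =
      ((A.card : ℤ) - 1).negOnePow • B.d (by omega) (θ.ev I A s t (r - 1)) +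
      ∑ j ∈ (A.erase s).erase t, ((A.filter (· < j)).card : ℤ).negOnePow •
        θ.ev I (A.erase j) s t r := by
  obtain ⟨l, e, rfl, rfl, rfl⟩ := hA.exists_emb
  simp only [Finset.card_map, Finset.card_univ, Fintype.card_fin, Nat.cast_add, Nat.cast_one] at hr
  obtain rfl : r = m' - l := by omega
  have h1 := (diff h θ).ev_comp_emb I e Finset.univ 0 (Fin.last l) (m' - l)
  rw [← h1]
  refine (ev_univ _ _).trans ?_
  refine congrArg₂ (· + ·) ?_ ?_
  · refine congrArg₂ (· • ·) ?_ ?_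
    · simp
    · have t1 := θ.ev_comp_emb I e Finset.univ 0 (Fin.last l) (m - l)
      refine (congrArg (B.d _) ((ev_univ θ _).symm.trans t1)).trans ?_
      exact d_ev_congr θ I (by omega) _
  · have hset : ((Finset.univ.map e.toEmbedding).erase (e 0)).erase (e (Fin.last l)) =
        ((Finset.univ.erase 0).erase (Fin.last l)).map e.toEmbedding := by
      rw [Finset.map_erase, Finset.map_erase]; rfl
    rw [hset, Finset.sum_map]
    refine Finset.sum_congr rfl fun i _ => ?_
    refine congrArg₂ (· • ·) ?_ ?_
    · have : (Finset.univ.map e.toEmbedding).filter (· < e.toEmbedding i) =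
          (Finset.Iio i).map e.toEmbedding := by
        ext x; simp only [Finset.mem_filter, Finset.mem_map, Finset.mem_univ, true_and,
          Finset.mem_Iio]
        constructor
        · rintro ⟨⟨y, rfl⟩, hy⟩; exact ⟨y, by simpa using hy, rfl⟩
        · rintro ⟨y, hy, rfl⟩; exact ⟨⟨y, rfl⟩, by simpa using hy⟩
      rw [this, Finset.card_map, Fin.card_Iio]
    · have t1 := θ.ev_comp_emb I e (Finset.univ.erase i) 0 (Fin.last l) (m' - l)
      refine t1.trans ?_
      rw [Finset.map_erase]

theorem comp_negOnePow_left {x y z : B.Obj} {p p' n : ℤ} (h : p + p' = n) (c : ℤ)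
    (f : B.Hom y z p) (g : B.Hom x y p') :
    B.comp h (c.negOnePow • f) g = c.negOnePow • B.comp h f g := by
  simp [Units.smul_def]

theorem comp_negOnePow_right {x y z : B.Obj} {p p' n : ℤ} (h : p + p' = n) (c : ℤ)
    (f : B.Hom y z p) (g : B.Hom x y p') :
    B.comp h f (c.negOnePow • g) = c.negOnePow • B.comp h f g := by
  simp [Units.smul_def]

theorem d_negOnePow {x y : B.Obj} {p n : ℤ} (h : p + 1 = n) (c : ℤ)
    (f : B.Hom x y p) :
    B.d h (c.negOnePow • f) = c.negOnePow • B.d h f := by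
  simp [Units.smul_def]

theorem ends_Iic {q : ℕ} (j : Fin (q + 1)) : Ends (Finset.Iic j) 0 j :=
  ⟨by simp, by simp, fun x hx => ⟨Fin.zero_le _, by simpa using hx⟩⟩

theorem ends_Ici {q : ℕ} (j : Fin (q + 1)) : Ends (Finset.Ici j) j (Fin.last q) :=
  ⟨by simp, by simpa using Fin.le_last j, fun x hx => ⟨by simpa using hx, Fin.le_last _⟩⟩

theorem ev_mul_Iic {a b m : ℤ} (h : a + b = m) (θ : Coch B F G a) (η : Coch B E F b) {q : ℕ}
    (I : Fin (q + 1) →o Fin (N + 1)) (j : Fin (q + 1)) :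
    (mul h θ η).ev I (Finset.Iic j) 0 j (m - (j : ℕ)) = ∑ i ∈ Finset.Iic j,
      ((a - (i : ℕ)) * ((j : ℕ) - (i : ℕ))).negOnePow •
      B.comp (by omega) (θ.ev I (Finset.Iic i) 0 i (a - (i : ℕ)))
        (η.ev I (Finset.Icc i j) i j (b - ((j : ℕ) - (i : ℕ)))) := by
  rw [ev_mul h θ η I (ends_Iic j) (by rw [Fin.card_Iic]; push_cast; ring)]
  refine Finset.sum_congr rfl fun i hi => ?_
  have hij : i ≤ j := by simpa using hi
  have hij' : (i : ℕ) ≤ j := hij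
  have e1 : (Finset.Iic j).filter (· ≤ i) = Finset.Iic i := by
    ext x; simp only [Finset.mem_filter, Finset.mem_Iic]
    exact ⟨fun h => h.2, fun h => ⟨h.trans hij, h⟩⟩
  have e2 : (Finset.Iic j).filter (i ≤ ·) = Finset.Icc i j := by
    ext x; simp only [Finset.mem_filter, Finset.mem_Iic, Finset.mem_Icc]; tauto
  refine congrArg₂ (· • ·) ?_ (comp_ev_congr θ η I e1 e2 ?_ ?_ _)
  · rw [e1, e2, Fin.card_Iic, Fin.card_Icc]; congr 1; push_cast [Nat.cast_sub (by omega : (i : ℕ) ≤ (j : ℕ) + 1)]; ring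
  · rw [e1, Fin.card_Iic]; push_cast; ring
  · rw [e1, Fin.card_Iic]; push_cast; rw [← h]; ring

theorem ev_mul_Ici {a b m : ℤ} (h : a + b = m) (θ : Coch B F G a) (η : Coch B E F b) {q : ℕ}
    (I : Fin (q + 1) →o Fin (N + 1)) (i : Fin (q + 1)) :
    (mul h θ η).ev I (Finset.Ici i) i (Fin.last q) (m - ((q : ℤ) - (i : ℕ))) =
      ∑ j ∈ Finset.Ici i,
      ((a - ((j : ℕ) - (i : ℕ))) * ((q : ℤ) - (j : ℕ))).negOnePow •
      B.comp (by omega) (θ.ev I (Finset.Icc i j) i j (a - ((j : ℕ) - (i : ℕ))))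
        (η.ev I (Finset.Ici j) j (Fin.last q) (b - ((q : ℤ) - (j : ℕ)))) := by
  have hi := i.2
  rw [ev_mul h θ η I (ends_Ici i) (by rw [Fin.card_Ici]; omega)]
  refine Finset.sum_congr rfl fun j hj => ?_
  have hij : i ≤ j := by simpa using hj
  have hij' : (i : ℕ) ≤ j := hij
  have hj := j.2
  have e1 : (Finset.Ici i).filter (· ≤ j) = Finset.Icc i j := by
    ext x; simp only [Finset.mem_filter, Finset.mem_Ici, Finset.mem_Icc]
  have e2 : (Finset.Ici i).filter (j ≤ ·) = Finset.Ici j := by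
    ext x; simp only [Finset.mem_filter, Finset.mem_Ici]
    exact ⟨fun h => h.2, fun h => ⟨hij.trans h, h⟩⟩
  refine congrArg₂ (· • ·) ?_ (comp_ev_congr θ η I e1 e2 ?_ ?_ _)
  · rw [e1, e2, Fin.card_Ici, Fin.card_Icc]; congr 1
    push_cast [Nat.cast_sub (by omega : (i : ℕ) ≤ (j : ℕ) + 1),
      Nat.cast_sub (by omega : (j : ℕ) ≤ q + 1)]; ring
  · rw [e1, Fin.card_Icc]; push_cast [Nat.cast_sub (by omega : (i : ℕ) ≤ (j : ℕ) + 1)]; ring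
  · rw [e1, Fin.card_Icc]; push_cast [Nat.cast_sub (by omega : (i : ℕ) ≤ (j : ℕ) + 1)]
    rw [← h]; ring

theorem mul_assoc {a b c ab bc m : ℤ} (h₁ : a + b = ab) (h₂ : ab + c = m) (h₃ : b + c = bc)
    (h₄ : a + bc = m) (θ : Coch B G H a) (η : Coch B F G b) (ζ : Coch B E F c) :
    mul h₂ (mul h₁ θ η) ζ = mul h₄ θ (mul h₃ η ζ) := by
  funext q I
  have L : ∀ j : Fin (q + 1), ∀ hh, B.comp (n := m - q) hh
      ((mul h₁ θ η).ev I (Finset.Iic j) 0 j (ab - (j : ℕ)))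
      (ζ.ev I (Finset.Ici j) j (Fin.last q) (c - ((q : ℤ) - (j : ℕ)))) =
      ∑ i ∈ Finset.Iic j, ((a - (i : ℕ)) * ((j : ℕ) - (i : ℕ))).negOnePow •
        B.comp hh (B.comp (by omega) (θ.ev I (Finset.Iic i) 0 i (a - (i : ℕ)))
          (η.ev I (Finset.Icc i j) i j (b - ((j : ℕ) - (i : ℕ)))))
          (ζ.ev I (Finset.Ici j) j (Fin.last q) (c - ((q : ℤ) - (j : ℕ)))) := by
    intro j hh
    rw [ev_mul_Iic, map_sum, LinearMap.sum_apply]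
    exact Finset.sum_congr rfl fun i _ => comp_negOnePow_left _ _ _ _
  have R : ∀ i : Fin (q + 1), ∀ hh, B.comp (n := m - q) hh
      (θ.ev I (Finset.Iic i) 0 i (a - (i : ℕ)))
      ((mul h₃ η ζ).ev I (Finset.Ici i) i (Fin.last q) (bc - ((q : ℤ) - (i : ℕ)))) =
      ∑ j ∈ Finset.Ici i, ((b - ((j : ℕ) - (i : ℕ))) * ((q : ℤ) - (j : ℕ))).negOnePow •
        B.comp hh (θ.ev I (Finset.Iic i) 0 i (a - (i : ℕ))) (B.comp (by omega)
          (η.ev I (Finset.Icc i j) i j (b - ((j : ℕ) - (i : ℕ))))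
          (ζ.ev I (Finset.Ici j) j (Fin.last q) (c - ((q : ℤ) - (j : ℕ))))) := by
    intro j hh
    rw [ev_mul_Ici, map_sum]
    exact Finset.sum_congr rfl fun i _ => comp_negOnePow_right _ _ _ _
  change ∑ j : Fin (q + 1), _ = ∑ i : Fin (q + 1), _
  simp only [L, R, Finset.smul_sum, smul_smul, ← Int.negOnePow_add]
  rw [Finset.sum_comm' (t' := Finset.univ) (s' := fun i => Finset.Ici i) (by simp)]
  refine Finset.sum_congr rfl fun i _ => Finset.sum_congr rfl fun j _ => ?_
  refine congrArg₂ (· • ·) ?_ (B.assoc _ _ _ _ _ _ _)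
  congr 1
  rw [← h₁]; ring

theorem ends_erase {q : ℕ} {i : Fin (q + 1)} (h0 : i ≠ 0) (hl : i ≠ Fin.last q) :
    Ends (Finset.univ.erase i) 0 (Fin.last q) :=
  ⟨by simpa using h0.symm, by simpa using hl.symm, fun x _ => ⟨Fin.zero_le _, Fin.le_last _⟩⟩

theorem ev_mul_erase {a b m r : ℤ} (h : a + b = m) (θ : Coch B F G a) (η : Coch B E F b) {q : ℕ}
    (I : Fin (q + 1) →o Fin (N + 1)) {i : Fin (q + 1)} (h0 : i ≠ 0) (hl : i ≠ Fin.last q)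
    (hr : r + q = m + 1) :
    (mul h θ η).ev I (Finset.univ.erase i) 0 (Fin.last q) r =
      (∑ j ∈ Finset.Ioi i, ((a + 1 - (j : ℕ)) * ((q : ℤ) - (j : ℕ))).negOnePow •
        B.comp (by omega) (θ.ev I ((Finset.Iic j).erase i) 0 j (a + 1 - (j : ℕ)))
          (η.ev I (Finset.Ici j) j (Fin.last q) (b - ((q : ℤ) - (j : ℕ))))) +
      ∑ j ∈ Finset.Iio i, ((a - (j : ℕ)) * ((q : ℤ) - (j : ℕ) - 1)).negOnePow •
        B.comp (by omega) (θ.ev I (Finset.Iic j) 0 j (a - (j : ℕ)))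
          (η.ev I ((Finset.Ici j).erase i) j (Fin.last q) (b + 1 - ((q : ℤ) - (j : ℕ)))) := by
  have hi := i.2
  rw [ev_mul h θ η I (ends_erase h0 hl) (by
    rw [Finset.card_erase_of_mem (Finset.mem_univ _), Finset.card_univ, Fintype.card_fin]; omega)]
  have hset : (Finset.univ.erase i) = (Finset.Ioi i).disjUnion (Finset.Iio i) (by
      rw [Finset.disjoint_left]; intro x hx hx'
      exact lt_asymm (Finset.mem_Ioi.1 hx) (Finset.mem_Iio.1 hx')) := by
    ext x
    simp only [Finset.mem_erase, Finset.mem_univ, and_true, Finset.mem_disjUnion, Finset.mem_Ioi,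
      Finset.mem_Iio]
    rw [ne_iff_lt_or_gt, or_comm]
  conv_lhs => rw [Finset.sum_congr hset (fun _ _ => rfl)]
  rw [Finset.sum_disjUnion]
  refine congrArg₂ (· + ·) (Finset.sum_congr rfl fun j hj => ?_)
    (Finset.sum_congr rfl fun j hj => ?_)
  · have hij : i < j := Finset.mem_Ioi.1 hj
    have hij' : (i : ℕ) < j := hij
    have hj2 := j.2
    have e1 : (Finset.univ.erase i).filter (· ≤ j) = (Finset.Iic j).erase i := by
      ext x; simp
    have e2 : (Finset.univ.erase i).filter (j ≤ ·) = Finset.Ici j := by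
      ext x; simp only [Finset.mem_filter, Finset.mem_erase, Finset.mem_univ, Finset.mem_Ici]
      exact ⟨fun h => h.2, fun h => ⟨⟨(hij.trans_le h).ne', trivial⟩, h⟩⟩
    have c1 : (((Finset.univ.erase i).filter (· ≤ j)).card : ℤ) = (j : ℕ) := by
      rw [e1, Finset.card_erase_of_mem (by simpa using hij.le), Fin.card_Iic]; simp
    have c2 : (((Finset.univ.erase i).filter (j ≤ ·)).card : ℤ) = q + 1 - (j : ℕ) := by
      rw [e2, Fin.card_Ici]; omega
    refine congrArg₂ (· • ·) ?_ (comp_ev_congr θ η I e1 e2 ?_ ?_ _)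
    · rw [c1, c2]; congr 1; ring
    · rw [c1]
    · rw [c1]; omega
  · have hij : j < i := Finset.mem_Iio.1 hj
    have hij' : (j : ℕ) < i := hij
    have e1 : (Finset.univ.erase i).filter (· ≤ j) = Finset.Iic j := by
      ext x; simp only [Finset.mem_filter, Finset.mem_erase, Finset.mem_univ, Finset.mem_Iic]
      exact ⟨fun h => h.2, fun h => ⟨⟨(h.trans_lt hij).ne, trivial⟩, h⟩⟩
    have e2 : (Finset.univ.erase i).filter (j ≤ ·) = (Finset.Ici j).erase i := by
      ext x; simp
    have c1 : (((Finset.univ.erase i).filter (· ≤ j)).card : ℤ) = (j : ℕ) + 1 := by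
      rw [e1, Fin.card_Iic]; simp
    have c2 : (((Finset.univ.erase i).filter (j ≤ ·)).card : ℤ) = q - (j : ℕ) := by
      rw [e2, Finset.card_erase_of_mem (by simpa using hij.le), Fin.card_Ici]; omega
    refine congrArg₂ (· • ·) ?_ (comp_ev_congr θ η I e1 e2 ?_ ?_ _)
    · rw [c1, c2]; congr 1; ring
    · rw [c1]; ring
    · rw [c1]; omega

theorem ev_diff_Iic {m m' : ℤ} (h : m + 1 = m') (θ : Coch B E F m) {q : ℕ}
    (I : Fin (q + 1) →o Fin (N + 1)) (j : Fin (q + 1)) {r : ℤ} (hr : r + (j : ℕ) = m') :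
    (diff h θ).ev I (Finset.Iic j) 0 j r =
      ((j : ℕ) : ℤ).negOnePow • B.d (by omega) (θ.ev I (Finset.Iic j) 0 j (m - (j : ℕ))) +
      ∑ i ∈ ((Finset.Iic j).erase 0).erase j, ((i : ℕ) : ℤ).negOnePow •
        θ.ev I ((Finset.Iic j).erase i) 0 j r := by
  rw [ev_diff h θ I (ends_Iic j) (by rw [Fin.card_Iic]; push_cast; omega)]
  refine congrArg₂ (· + ·) ?_ (Finset.sum_congr rfl fun i hi => ?_)
  · refine congrArg₂ (· • ·) (by rw [Fin.card_Iic]; simp) (d_ev_congr θ I (by omega) _)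
  · have hij : i ≤ j := by
      simp only [Finset.mem_erase, Finset.mem_Iic] at hi; exact hi.2.2
    have : (Finset.Iic j).filter (· < i) = Finset.Iio i := by
      ext x; simp only [Finset.mem_filter, Finset.mem_Iic, Finset.mem_Iio]
      exact ⟨fun h => h.2, fun h => ⟨h.le.trans hij, h⟩⟩
    rw [this, Fin.card_Iio]

theorem ev_diff_Ici {m m' : ℤ} (h : m + 1 = m') (θ : Coch B E F m) {q : ℕ}
    (I : Fin (q + 1) →o Fin (N + 1)) (j : Fin (q + 1)) {r : ℤ} (hr : r + (q - (j : ℕ)) = m') :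
    (diff h θ).ev I (Finset.Ici j) j (Fin.last q) r =
      ((q : ℤ) - (j : ℕ)).negOnePow •
        B.d (by omega) (θ.ev I (Finset.Ici j) j (Fin.last q) (m - ((q : ℤ) - (j : ℕ)))) +
      ∑ i ∈ ((Finset.Ici j).erase j).erase (Fin.last q), (((i : ℕ) : ℤ) - (j : ℕ)).negOnePow •
        θ.ev I ((Finset.Ici j).erase i) j (Fin.last q) r := by
  have hj := j.2
  rw [ev_diff h θ I (ends_Ici j) (by rw [Fin.card_Ici]; omega)]
  refine congrArg₂ (· + ·) ?_ (Finset.sum_congr rfl fun i hi => ?_)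
  · refine congrArg₂ (· • ·) ?_ (d_ev_congr θ I (by omega) _)
    rw [Fin.card_Ici]; congr 1; omega
  · have hij : j ≤ i := by
      simp only [Finset.mem_erase, Finset.mem_Ici] at hi; exact hi.2.2
    have hij' : (j : ℕ) ≤ i := hij
    have : (Finset.Ici j).filter (· < i) = Finset.Ico j i := by
      ext x; simp only [Finset.mem_filter, Finset.mem_Ici, Finset.mem_Ico]
    rw [this, Fin.card_Ico, Nat.cast_sub hij']

theorem diff_mul {a b m m' a' b' : ℤ} (h : a + b = m) (hm : m + 1 = m') (ha : a + 1 = a')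
    (hb : b + 1 = b') (θ : Coch B F G a) (η : Coch B E F b) :
    diff hm (mul h θ η) = mul (by omega) (diff ha θ) η +
      a.negOnePow • mul (by omega) θ (diff hb η) := by
  subst ha hb
  funext q I
  have R1 : ∀ (j : Fin (q + 1)) (hh), B.comp (n := m' - q) hh
      ((diff rfl θ).ev I (Finset.Iic j) 0 j (a + 1 - (j : ℕ)))
      (η.ev I (Finset.Ici j) j (Fin.last q) (b - ((q : ℤ) - (j : ℕ)))) =
      ((j : ℕ) : ℤ).negOnePow • B.comp hh
        (B.d (by omega) (θ.ev I (Finset.Iic j) 0 j (a - (j : ℕ))))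
        (η.ev I (Finset.Ici j) j (Fin.last q) (b - ((q : ℤ) - (j : ℕ)))) +
      ∑ i ∈ ((Finset.Iic j).erase 0).erase j, ((i : ℕ) : ℤ).negOnePow •
        B.comp hh (θ.ev I ((Finset.Iic j).erase i) 0 j (a + 1 - (j : ℕ)))
          (η.ev I (Finset.Ici j) j (Fin.last q) (b - ((q : ℤ) - (j : ℕ)))) := by
    intro j hh
    rw [ev_diff_Iic rfl θ I j (by omega), map_add, map_sum, LinearMap.add_apply,
      LinearMap.sum_apply, comp_negOnePow_left]
    congr 1
    exact Finset.sum_congr rfl fun i _ => comp_negOnePow_left _ _ _ _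
  have R2 : ∀ (j : Fin (q + 1)) (hh), B.comp (n := m' - q) hh
      (θ.ev I (Finset.Iic j) 0 j (a - (j : ℕ)))
      ((diff rfl η).ev I (Finset.Ici j) j (Fin.last q) (b + 1 - ((q : ℤ) - (j : ℕ)))) =
      ((q : ℤ) - (j : ℕ)).negOnePow • B.comp hh
        (θ.ev I (Finset.Iic j) 0 j (a - (j : ℕ)))
        (B.d (by omega) (η.ev I (Finset.Ici j) j (Fin.last q) (b - ((q : ℤ) - (j : ℕ))))) +
      ∑ i ∈ ((Finset.Ici j).erase j).erase (Fin.last q), (((i : ℕ) : ℤ) - (j : ℕ)).negOnePow •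
        B.comp hh (θ.ev I (Finset.Iic j) 0 j (a - (j : ℕ)))
          (η.ev I ((Finset.Ici j).erase i) j (Fin.last q) (b + 1 - ((q : ℤ) - (j : ℕ)))) := by
    intro j hh
    rw [ev_diff_Ici rfl η I j (by omega), map_add, map_sum, comp_negOnePow_right]
    congr 1
    exact Finset.sum_congr rfl fun i _ => comp_negOnePow_right _ _ _ _
  have hq1 : ∀ j : Fin (q + 1), b - ((q : ℤ) - (j : ℕ)) + 1 = b + 1 - ((q : ℤ) - (j : ℕ)) :=
    fun j => by ring
  have hq2 : ∀ j : Fin (q + 1), a - ((j : ℕ) : ℤ) + 1 = a + 1 - ((j : ℕ) : ℤ) :=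
    fun j => by ring
  have L1 : (q : ℤ).negOnePow • B.d (m := m' - q) (by omega) ((mul h θ η) q I) =
      (∑ j : Fin (q + 1), ((a + 1 - (j : ℕ)) * ((q : ℤ) - (j : ℕ))).negOnePow •
        ((j : ℕ) : ℤ).negOnePow • B.comp (by omega)
        (B.d (hq2 j) (θ.ev I (Finset.Iic j) 0 j (a - (j : ℕ))))
        (η.ev I (Finset.Ici j) j (Fin.last q) (b - ((q : ℤ) - (j : ℕ))))) +
      a.negOnePow • ∑ j : Fin (q + 1), ((a - (j : ℕ)) * ((q : ℤ) - (j : ℕ))).negOnePow •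
        ((q : ℤ) - (j : ℕ)).negOnePow • B.comp (by omega)
        (θ.ev I (Finset.Iic j) 0 j (a - (j : ℕ)))
        (B.d (hq1 j) (η.ev I (Finset.Ici j) j (Fin.last q) (b - ((q : ℤ) - (j : ℕ))))) := by
    rw [mul, map_sum, Finset.smul_sum, Finset.smul_sum, ← Finset.sum_add_distrib]
    refine Finset.sum_congr rfl fun j _ => ?_
    rw [d_negOnePow, B.leibniz _ _ (hq2 j) (hq1 j), smul_add, smul_add]
    simp only [smul_smul, ← Int.negOnePow_add]
    refine congrArg₂ (· + ·) (congrArg₂ (· • ·) ?_ rfl) (congrArg₂ (· • ·) ?_ rfl)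
    · congr 1; ring
    · congr 1; ring
  have L2 : ∑ i ∈ (Finset.univ.erase 0).erase (Fin.last q), ((i : ℕ) : ℤ).negOnePow •
        (mul h θ η).ev I (Finset.univ.erase i) 0 (Fin.last q) (m' - q) =
      (∑ j : Fin (q + 1), ((a + 1 - (j : ℕ)) * ((q : ℤ) - (j : ℕ))).negOnePow •
        ∑ i ∈ ((Finset.Iic j).erase 0).erase j, ((i : ℕ) : ℤ).negOnePow •
        B.comp (by omega) (θ.ev I ((Finset.Iic j).erase i) 0 j (a + 1 - (j : ℕ)))
          (η.ev I (Finset.Ici j) j (Fin.last q) (b - ((q : ℤ) - (j : ℕ))))) +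
      a.negOnePow • ∑ j : Fin (q + 1), ((a - (j : ℕ)) * ((q : ℤ) - (j : ℕ))).negOnePow •
        ∑ i ∈ ((Finset.Ici j).erase j).erase (Fin.last q), (((i : ℕ) : ℤ) - (j : ℕ)).negOnePow •
        B.comp (by omega) (θ.ev I (Finset.Iic j) 0 j (a - (j : ℕ)))
          (η.ev I ((Finset.Ici j).erase i) j (Fin.last q) (b + 1 - ((q : ℤ) - (j : ℕ)))) := by
    rw [Finset.sum_congr rfl fun i hi => by
      rw [ev_mul_erase h θ η I (by simp at hi; exact hi.2) (by simp at hi; exact hi.1)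
        (by omega : m' - q + q = m + 1)]]
    simp only [smul_add, Finset.sum_add_distrib, Finset.smul_sum, smul_smul, ← Int.negOnePow_add]
    refine congrArg₂ (· + ·) ?_ ?_
    · rw [Finset.sum_comm' (t' := Finset.univ)
        (s' := fun j => ((Finset.Iic j).erase 0).erase j) (by
          intro i j
          simp only [Finset.mem_erase, Finset.mem_univ, Finset.mem_Ioi, Finset.mem_Iic]
          constructor
          · rintro ⟨⟨-, h0, -⟩, hij⟩; exact ⟨⟨hij.ne, h0, hij.le⟩, trivial⟩
          · rintro ⟨⟨hne, h0, hij⟩, -⟩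
            have hlt := lt_of_le_of_ne hij hne
            exact ⟨⟨(hlt.trans_le (Fin.le_last j)).ne, h0, trivial⟩, hlt⟩)]
      refine Finset.sum_congr rfl fun j _ => Finset.sum_congr rfl fun i _ => ?_
      exact congrArg₂ (· • ·) (congrArg _ (add_comm _ _)) rfl
    · rw [Finset.sum_comm' (t' := Finset.univ)
        (s' := fun j => ((Finset.Ici j).erase j).erase (Fin.last q)) (by
          intro i j
          simp only [Finset.mem_erase, Finset.mem_univ, Finset.mem_Iio, Finset.mem_Ici]
          constructor
          · rintro ⟨⟨hl, -, -⟩, hij⟩; exact ⟨⟨hl, hij.ne', hij.le⟩, trivial⟩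
          · rintro ⟨⟨hl, hne, hij⟩, -⟩
            have hlt := lt_of_le_of_ne hij hne.symm
            exact ⟨⟨hl, (lt_of_le_of_lt (Fin.zero_le j) hlt).ne', trivial⟩, hlt⟩)]
      refine Finset.sum_congr rfl fun j _ => Finset.sum_congr rfl fun i _ => ?_
      refine congrArg₂ (· • ·) ?_ rfl
      rw [Int.negOnePow_eq_iff]
      exact ⟨(j : ℕ) - a, by ring⟩
  change _ = mul _ (diff rfl θ) η q I + a.negOnePow • mul _ θ (diff rfl η) q I
  refine (congrArg₂ (· + ·) L1 L2).trans ?_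
  simp only [mul, R1, R2, smul_add, Finset.sum_add_distrib]
  abel

theorem diff_diff {m m' m'' : ℤ} (h : m + 1 = m') (h' : m' + 1 = m'') (θ : Coch B E F m) :
    diff h' (diff h θ) = 0 := by
  funext q I
  have hq : m' - (q : ℤ) + 1 = m'' - q := by omega
  have hev : ∀ i ∈ (Finset.univ.erase 0).erase (Fin.last q),
      (diff h θ).ev I (Finset.univ.erase i) 0 (Fin.last q) (m'' - q) =
      ((q : ℤ) - 1).negOnePow •
        B.d hq (θ.ev I (Finset.univ.erase i) 0 (Fin.last q) (m' - q)) +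
      ∑ j ∈ ((Finset.univ.erase i).erase 0).erase (Fin.last q),
        (((Finset.univ.erase i).filter (· < j)).card : ℤ).negOnePow •
        θ.ev I ((Finset.univ.erase i).erase j) 0 (Fin.last q) (m'' - q) := by
    intro i hi
    simp only [Finset.mem_erase, Finset.mem_univ, and_true] at hi
    have hc : (Finset.univ.erase i).card = q := by
      rw [Finset.card_erase_of_mem (Finset.mem_univ _), Finset.card_univ, Fintype.card_fin]
      rfl
    rw [ev_diff h θ I (ends_erase hi.2 hi.1) (by rw [hc]; omega), hc]
    exact congrArg₂ (· + ·) (congrArg _ (d_ev_congr θ I (by omega) _)) rfl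
  change (q : ℤ).negOnePow • B.d hq ((diff h θ) q I) + ∑ j ∈ _, _ = 0
  rw [Finset.sum_congr rfl fun i hi => by rw [hev i hi]]
  simp only [smul_add, Finset.sum_add_distrib]
  have h1 : (q : ℤ).negOnePow • B.d hq ((diff h θ) q I) =
      ∑ i ∈ (Finset.univ.erase 0).erase (Fin.last q), (q : ℤ).negOnePow •
        ((i : ℕ) : ℤ).negOnePow •
          B.d hq (θ.ev I (Finset.univ.erase i) 0 (Fin.last q) (m' - q)) := by
    rw [diff, map_add, d_negOnePow, B.d_d, smul_zero, zero_add, map_sum, Finset.smul_sum]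
    exact Finset.sum_congr rfl fun i _ => by rw [d_negOnePow]
  have h2 : ∑ i ∈ (Finset.univ.erase 0).erase (Fin.last q), (q : ℤ).negOnePow •
        ((i : ℕ) : ℤ).negOnePow •
          B.d hq (θ.ev I (Finset.univ.erase i) 0 (Fin.last q) (m' - q)) +
      ∑ i ∈ (Finset.univ.erase 0).erase (Fin.last q), ((i : ℕ) : ℤ).negOnePow •
        ((q : ℤ) - 1).negOnePow •
          B.d hq (θ.ev I (Finset.univ.erase i) 0 (Fin.last q) (m' - q)) = 0 := by
    rw [← Finset.sum_add_distrib]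
    refine Finset.sum_eq_zero fun i _ => ?_
    simp only [smul_smul, ← Int.negOnePow_add]
    rw [show ((i : ℕ) : ℤ) + ((q : ℤ) - 1) = q + (i : ℕ) - 1 by ring, Int.negOnePow_sub,
      Int.negOnePow_one]
    simp [Units.smul_def]
  have h3 : ∑ i ∈ (Finset.univ.erase 0).erase (Fin.last q), ((i : ℕ) : ℤ).negOnePow •
      ∑ j ∈ ((Finset.univ.erase i).erase 0).erase (Fin.last q),
        (((Finset.univ.erase i).filter (· < j)).card : ℤ).negOnePow •
        θ.ev I ((Finset.univ.erase i).erase j) 0 (Fin.last q) (m'' - q) = 0 := by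
    simp only [Finset.smul_sum, smul_smul, ← Int.negOnePow_add]
    rw [Finset.sum_sigma']
    have hcard : ∀ i j : Fin (q + 1), i ≠ j →
        (((Finset.univ.erase i).filter (· < j)).card : ℤ) =
          if i < j then ((j : ℕ) : ℤ) - 1 else (j : ℕ) := by
      intro i j hij
      have : (Finset.univ.erase i).filter (· < j) = (Finset.Iio j).erase i := by
        ext x; simp
      rw [this]
      split_ifs with hlt
      · have hlt' : (i : ℕ) < j := hlt
        rw [Finset.card_erase_of_mem (by simpa using hlt), Fin.card_Iio]; omega
      · rw [Finset.erase_eq_of_notMem (by simpa using hlt), Fin.card_Iio]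
    refine Finset.sum_involution (fun x _ => ⟨x.2, x.1⟩) ?_ ?_ ?_ ?_
    · rintro ⟨i, j⟩ hx
      simp only [Finset.mem_sigma, Finset.mem_erase, Finset.mem_univ, and_true] at hx
      have hij : i ≠ j := hx.2.2.2.symm
      rw [hcard i j hij, hcard j i hij.symm, Finset.erase_right_comm (a := j)]
      rcases lt_or_gt_of_ne hij with hlt | hlt
      · rw [if_pos hlt, if_neg hlt.asymm,
          show ((i : ℕ) : ℤ) + ((j : ℕ) - 1) = (j : ℕ) + (i : ℕ) - 1 by ring, Int.negOnePow_sub,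
          Int.negOnePow_one]
        simp [Units.smul_def]
      · rw [if_pos hlt, if_neg hlt.asymm,
          show ((j : ℕ) : ℤ) + ((i : ℕ) - 1) = (i : ℕ) + (j : ℕ) - 1 by ring, Int.negOnePow_sub,
          Int.negOnePow_one]
        simp [Units.smul_def]
    · rintro ⟨i, j⟩ hx _ heq
      simp only [Finset.mem_sigma, Finset.mem_erase, Finset.mem_univ, and_true] at hx
      simp only [Sigma.mk.injEq] at heq
      exact hx.2.2.2 heq.1
    · rintro ⟨i, j⟩ hx
      simp only [Finset.mem_sigma, Finset.mem_erase, Finset.mem_univ, and_true] at hx ⊢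
      exact ⟨⟨hx.2.1, hx.2.2.1⟩, hx.1.1, hx.1.2, hx.2.2.2.symm⟩
    · rintro ⟨i, j⟩ _; rfl
  rw [h1, h3, add_zero, h2]

theorem one_apply_of_pos (E : Fin (N + 1) → B.Obj) {q : ℕ} (hq : q ≠ 0)
    (I : Fin (q + 1) →o Fin (N + 1)) : one E q I = 0 := by
  cases q with
  | zero => exact absurd rfl hq
  | succ q => rfl

theorem one_ev_of_card (E : Fin (N + 1) → B.Obj) {q : ℕ} (I : Fin (q + 1) →o Fin (N + 1))
    {A : Finset (Fin (q + 1))} (hA : A.card ≠ 1) (s t : Fin (q + 1)) (r : ℤ) :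
    (one E).ev I A s t r = 0 := by
  by_cases h : Ends A s t ∧ r + A.card = 0 + 1
  · rw [ev, dif_pos h, one_apply_of_pos E (by have := h.1.card; omega), map_zero]
  · exact ev_zero_of _ _ h

theorem one_ev_singleton (E : Fin (N + 1) → B.Obj) {q : ℕ} (I : Fin (q + 1) →o Fin (N + 1))
    (s : Fin (q + 1)) : (one E).ev I {s} s s 0 = B.id (E (I s)) := by
  have := (one E).ev_of (l := 0) I
    (OrderEmbedding.ofStrictMono (fun _ : Fin 1 => s) (by
      intro x y hxy
      exact absurd hxy (by
        rw [Fin.ext (by omega : (x : ℕ) = y)]; exact lt_irrefl _))) 0 (by simp)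
    (A := {s}) (s := s) (t := s) (by ext x; simp only [Finset.mem_singleton, Finset.mem_map, Finset.mem_univ, true_and]; exact ⟨fun h => ⟨0, h.symm⟩, fun ⟨_, h⟩ => h.symm⟩) rfl rfl
  exact this

theorem one_mul {m : ℤ} (h : 0 + m = m) (θ : Coch B E F m) : mul h (one F) θ = θ := by
  funext q I
  rw [mul, Finset.sum_eq_single 0]
  · rw [comp_ev_congr (one F) θ I (A₁' := {0}) (A₂' := Finset.univ) (r₁' := 0) (r₂' := m - q)
      (by ext x; simp) (by ext x; simp) (by simp) (by simp), one_ev_singleton, ev_univ,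
      B.id_comp]
    simp
  · intro j _ hj
    have h0 : (j : ℕ) ≠ 0 := fun h => hj (Fin.ext h)
    rw [one_ev_of_card F I (by rw [Fin.card_Iic]; omega),
      LinearMap.map_zero (B.comp _), LinearMap.zero_apply, smul_zero]
  · simp

theorem mul_one {m : ℤ} (h : m + 0 = m) (θ : Coch B E F m) : mul h θ (one E) = θ := by
  funext q I
  rw [mul, Finset.sum_eq_single (Fin.last q)]
  · rw [comp_ev_congr θ (one E) I (A₁' := Finset.univ) (A₂' := {Fin.last q}) (r₁' := m - q)
      (r₂' := 0) (by ext x; simp [Fin.le_last]) (by ext x; simp [Fin.last_le_iff]) (by simp)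
      (by simp), one_ev_singleton, ev_univ, B.comp_id]
    simp
  · intro j _ hj
    have h0 : (j : ℕ) ≠ q := fun h => hj (Fin.ext h)
    have h1 := j.2
    rw [one_ev_of_card E I (by rw [Fin.card_Ici]; omega),
      LinearMap.map_zero (B.comp _ _), smul_zero]
  · simp

theorem ev_add {m : ℤ} (θ θ' : Coch B E F m) {q : ℕ} (I : Fin (q + 1) →o Fin (N + 1))
    (A : Finset (Fin (q + 1))) (s t : Fin (q + 1)) (r : ℤ) :
    (θ + θ').ev I A s t r = θ.ev I A s t r + θ'.ev I A s t r := by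
  unfold ev
  split_ifs with h
  · exact map_add _ _ _
  · simp

theorem ev_smul {m : ℤ} (c : k) (θ : Coch B E F m) {q : ℕ} (I : Fin (q + 1) →o Fin (N + 1))
    (A : Finset (Fin (q + 1))) (s t : Fin (q + 1)) (r : ℤ) :
    (c • θ).ev I A s t r = c • θ.ev I A s t r := by
  unfold ev
  split_ifs with h
  · exact map_smul _ _ _
  · simp

end Laws

end Coch

/-- The dg-category of cochains: its objects are collections `E₀, …, E_N` of objects of `B`, its
morphisms are cochains with the differential `D` and the shuffled multiplication. -/
noncomputable def cochains (B : DGCat.{w, v, u} k) (N : ℕ) : DGCat.{w, v, u} k where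
  Obj := Fin (N + 1) → B.Obj
  Hom E F m := Coch B E F m
  d h :=
    { toFun := Coch.diff h
      map_add' := fun θ θ' => by
        funext q I
        change _ = Coch.diff h θ q I + Coch.diff h θ' q I
        simp only [Coch.diff, Pi.add_apply, map_add, smul_add, Coch.ev_add,
          Finset.sum_add_distrib]
        abel
      map_smul' := fun c θ => by
        funext q I
        change _ = c • Coch.diff h θ q I
        simp only [Coch.diff, Pi.smul_apply, map_smul, Coch.ev_smul, smul_add, Finset.smul_sum,
          smul_comm c] }
  comp h := LinearMap.mk₂ k (fun θ η => Coch.mul h θ η)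
    (fun θ θ' η => by
      funext q I
      change _ = Coch.mul h θ η q I + Coch.mul h θ' η q I
      simp only [Coch.mul, Coch.ev_add, map_add, LinearMap.add_apply, smul_add,
        Finset.sum_add_distrib])
    (fun c θ η => by
      funext q I
      change _ = c • Coch.mul h θ η q I
      simp only [Coch.mul, Coch.ev_smul, map_smul, LinearMap.smul_apply, Finset.smul_sum,
        smul_comm c])
    (fun θ η η' => by
      funext q I
      change _ = Coch.mul h θ η q I + Coch.mul h θ η' q I
      simp only [Coch.mul, Coch.ev_add, map_add, smul_add, Finset.sum_add_distrib])
    (fun c θ η => by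
      funext q I
      change _ = c • Coch.mul h θ η q I
      simp only [Coch.mul, Coch.ev_smul, map_smul, Finset.smul_sum, smul_comm c])
  id E := Coch.one E
  d_d h h' θ := Coch.diff_diff h h' θ
  leibniz h hn hp hq θ η := Coch.diff_mul h hn hp hq θ η
  assoc h₁ h₂ h₃ h₄ θ η ζ := Coch.mul_assoc h₁ h₂ h₃ h₄ θ η ζ
  id_comp h θ := Coch.one_mul h θ
  comp_id h θ := Coch.mul_one h θ

end Cochains

/-- Twisting a dg-category by Maurer-Cartan elements: for a family `φ o` of degree `1`
endomorphisms of objects `ob o` with `dφ + φφ = 0`, the dg-category with objects `o`, morphisms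
those of `C`, and differential `f ↦ df + φ f - (-1)^{deg f} f φ`. -/
def twist (C : DGCat.{w, v, u} k) {O : Type u'} (ob : O → C.Obj)
    (φ : ∀ o, C.Hom (ob o) (ob o) 1)
    (mc : ∀ o, C.d (m := 2) (by omega) (φ o) + C.comp (by omega) (φ o) (φ o) = 0) :
    DGCat.{w, v, u'} k where
  Obj := O
  Hom x y n := C.Hom (ob x) (ob y) n
  d {x y n m} h :=
    { toFun := fun f => C.d h f + C.comp (by omega) (φ y) f -
        n.negOnePow • C.comp (by omega) f (φ x)
      map_add' := fun f g => by simp only [map_add, LinearMap.add_apply, smul_add]; abel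
      map_smul' := fun c f => by
        simp only [map_smul, LinearMap.smul_apply, smul_sub, smul_add, RingHom.id_apply,
          smul_comm c] }
  comp h := C.comp h
  id x := C.id (ob x)
  d_d {x y n m l} h h' f := by
    subst h h'
    have e1 := mc x
    have e2 := mc y
    simp only [LinearMap.coe_mk, AddHom.coe_mk, map_add, map_sub, C.d_d,
      Coch.d_negOnePow, Coch.comp_negOnePow_left, Coch.comp_negOnePow_right]
    rw [C.leibniz (p' := 2) (q' := n + 1) (by omega : 1 + n = n + 1) (by omega) (by omega) rfl (φ y) f,
      C.leibniz (p' := n + 1) (q' := 2) (by omega : n + 1 = n + 1) (by omega) (by omega) (by omega) f (φ x),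
      C.assoc (b := n + 1) (by omega : 1 + n = n + 1) (by omega : n + 1 + 1 = n + 1 + 1) (by omega) (by omega)
        (φ y) f (φ x),
      ← C.assoc (a := 2) (by omega) (by omega : 2 + n = n + 1 + 1) (by omega : 1 + n = n + 1) (by omega)
        (φ y) (φ y) f,
      C.assoc (b := 2) (by omega : n + 1 = n + 1) (by omega : n + 1 + 1 = n + 1 + 1) (by omega)
        (by omega) f (φ x) (φ x)]
    have e1' := congrArg (C.comp (by omega : n + 2 = n + 1 + 1) f) e1
    have e2' := congrArg (fun a => C.comp (by omega : 2 + n = n + 1 + 1) a f) e2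
    simp only [map_add, LinearMap.add_apply, map_zero, LinearMap.zero_apply] at e1' e2'
    rw [eq_neg_of_add_eq_zero_left e1', eq_neg_of_add_eq_zero_left e2']
    have hs : n.negOnePow * n.negOnePow = 1 := by
      rw [← Int.negOnePow_add, Int.negOnePow_even _ ⟨n, rfl⟩]
    simp only [smul_add, smul_neg, smul_smul, Int.negOnePow_succ, Int.negOnePow_one,
      Units.neg_smul, neg_mul, hs, _root_.one_smul]
    abel
  leibniz {x y z p p' q q' n m} h hn hp hq f g := by
    subst h hn hp hq
    have l1 := C.leibniz rfl rfl rfl rfl f g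
    have l2 := C.assoc (a := p + 1) (b := q + 1) (by omega) (by omega : p + 1 + q = p + q + 1)
      (by omega) (by omega) f (φ y) g
    have l3 := C.assoc (a := p + 1) (b := p + q) (by omega) (by omega : p + 1 + q = p + q + 1)
      rfl (by omega) (φ z) f g
    have l4 := C.assoc (b := q + 1) rfl (by omega : p + q + 1 = p + q + 1) rfl (by omega)
      f g (φ x)
    simp only [LinearMap.coe_mk, AddHom.coe_mk, map_add, map_sub, LinearMap.add_apply,
      LinearMap.sub_apply, Coch.comp_negOnePow_left, Coch.comp_negOnePow_right, l1, l2, l3, l4,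
      smul_add, smul_sub, smul_smul, ← Int.negOnePow_add]
    abel
  assoc h₁ h₂ h₃ h₄ f g e := C.assoc h₁ h₂ h₃ h₄ f g e
  id_comp h f := C.id_comp h f
  comp_id h f := C.comp_id h f

end DGCat

/-- Two conventions for the degenerate components of the objects of `Δ_n(B)`: either
`φ_{ii} = id` and `φ_{i₀…i_q} = 0` for `q ≥ 2` and repeated indices, or no such conditions. -/
inductive DegeneracyConvention
  | normalized
  | unnormalized

namespace DGCat

variable {k : Type w} [CommRing k]

/-- The objects of the dg-category `Δ_N(B)`. The components `φ_{i₀…i_q}` are given for `q ≥ 1`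
only; this is expressed by putting the component for `q = 0` equal to `0`. -/
structure SimplexObj (c : DegeneracyConvention) (B : DGCat.{w, v, u} k) (N : ℕ) where
  E : Fin (N + 1) → B.Obj
  φ : Coch B E E 1
  φ_zero : ∀ I : Fin 1 →o Fin (N + 1), φ 0 I = 0
  maurerCartan : Coch.diff (m' := 2) (by omega) φ + Coch.mul (by omega) φ φ = 0
  invertible : ∀ I : Fin 2 →o Fin (N + 1), B.HomotopyInvertible (by simp) (φ 1 I)
  normalized : c = .normalized →
    (∀ (I : Fin 2 →o Fin (N + 1)) (h : I 0 = I (Fin.last 1)),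
      φ 1 I = B.castHom (congrArg E h) rfl (by simp) (B.id (E (I 0)))) ∧
    (∀ (q : ℕ) (I : Fin (q + 1) →o Fin (N + 1)), 2 ≤ q → ¬ Function.Injective I → φ q I = 0)

/-- The dg-category `Δ_N(B)`, with differential `dθ = Dθ + ψ·θ - (-1)^m θ·φ` on the morphisms of
degree `m` from `(E, φ)` to `(F, ψ)`. -/
noncomputable def simplex (c : DegeneracyConvention) (B : DGCat.{w, v, u} k) (N : ℕ) :
    DGCat.{w, v, max u v} k :=
  (cochains B N).twist (O := SimplexObj c B N) (fun x => x.E) (fun x => x.φ)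
    (fun x => x.maurerCartan)

section Functoriality

variable {c : DegeneracyConvention} {A B : DGCat.{w, v, u} k} {M N : ℕ}

/-- The restriction of cochains along an order preserving map `[M] → [N]`. -/
def Coch.restrict (σ : Fin (M + 1) →o Fin (N + 1)) {E F : Fin (N + 1) → B.Obj} {m : ℤ}
    (θ : Coch B E F m) : Coch B (fun i => E (σ i)) (fun i => F (σ i)) m :=
  fun q I => θ q (σ.comp I)

/-- The simplicial structure map `σ^*` on objects. -/
noncomputable def SimplexObj.restrict (σ : Fin (M + 1) →o Fin (N + 1))
    (x : (simplex c B N).Obj) : (simplex c B M).Obj :=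
  SimplexObj.mk (c := c) (B := B) (N := M)
    (E := fun i => x.E (σ i))
    (φ := x.φ.restrict σ)
    (φ_zero := fun I => x.φ_zero (σ.comp I))
    (maurerCartan := by
      funext q I
      exact congrFun (congrFun x.maurerCartan q) (σ.comp I))
    (invertible := fun I => x.invertible (σ.comp I))
    (normalized := fun hc =>
      ⟨fun I h => (x.normalized hc).1 (σ.comp I) (congrArg σ h),
        fun q I hq hI => (x.normalized hc).2 q (σ.comp I) hq
          (fun h => hI (Function.Injective.of_comp (f := σ) h))⟩)

/-- The simplicial structure map `σ^* : Δ_N(B) → Δ_M(B)` of an order preserving map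
`σ : [M] → [N]`. -/
noncomputable def simplexRestrict (c : DegeneracyConvention) (B : DGCat.{w, v, u} k)
    (σ : Fin (M + 1) →o Fin (N + 1)) : simplex c B N ⟶ simplex c B M where
  obj x := SimplexObj.restrict σ x
  map :=
    { toFun := fun θ => Coch.restrict σ θ
      map_add' := fun _ _ => rfl
      map_smul' := fun _ _ => rfl }
  map_d h θ := rfl
  map_comp h θ η := rfl
  map_id x := by
    funext q I
    cases q <;> rfl

/-- The image of a cochain under a dg-functor. -/
def Coch.map (F : A ⟶ B) {E E' : Fin (N + 1) → A.Obj} {m : ℤ}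
    (θ : Coch A E E' m) : Coch B (fun i => F.obj (E i)) (fun i => F.obj (E' i)) m :=
  fun q I => F.map (θ q I)

theorem map_castHom (F : A ⟶ B) {x x' y y' : A.Obj} {n n' : ℤ}
    (hx : x = x') (hy : y = y') (hn : n = n') (f : A.Hom x y n) :
    F.map (A.castHom hx hy hn f) =
      B.castHom (congrArg F.obj hx) (congrArg F.obj hy) hn (F.map f) := by
  subst hx hy hn; rfl

theorem map_negOnePow (F : A ⟶ B) {x y : A.Obj} {n : ℤ} (a : ℤ) (f : A.Hom x y n) :
    F.map (a.negOnePow • f) = a.negOnePow • F.map f := by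
  simp [Units.smul_def]

theorem HomotopyInvertible.map (F : A ⟶ B) {x y : A.Obj} {n : ℤ} {hn : n = 0}
    {f : A.Hom x y n} (hf : A.HomotopyInvertible hn f) : B.HomotopyInvertible hn (F.map f) := by
  obtain ⟨h, g, a, b, hg, ha, hb⟩ := hf
  refine ⟨?_, F.map g, F.map a, F.map b, ?_, ?_, ?_⟩
  · rw [← F.map_d, h, map_zero]
  · rw [← F.map_d, hg, map_zero]
  · rw [← F.map_d, ← ha, map_sub, F.map_comp, F.map_id]
  · rw [← F.map_d, ← hb, map_sub, F.map_comp, F.map_id]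

theorem Coch.ev_map (F : A ⟶ B) {E E' : Fin (N + 1) → A.Obj} {m : ℤ} (θ : Coch A E E' m) {q : ℕ}
    (I : Fin (q + 1) →o Fin (N + 1)) (S : Finset (Fin (q + 1))) (s t : Fin (q + 1)) (r : ℤ) :
    (Coch.map F θ).ev I S s t r = F.map (θ.ev I S s t r) := by
  unfold Coch.ev
  split_ifs with h
  · exact (map_castHom F _ _ _ _).symm
  · exact (map_zero _).symm

theorem Coch.map_diff (F : A ⟶ B) {E E' : Fin (N + 1) → A.Obj} {m m' : ℤ} (h : m + 1 = m')
    (θ : Coch A E E' m) : Coch.map F (Coch.diff h θ) = Coch.diff h (Coch.map F θ) := by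
  funext q I
  simp only [Coch.diff, Coch.ev_map, Coch.map, map_add, map_sum, map_negOnePow, F.map_d]

theorem Coch.map_mul (F : A ⟶ B) {E E' E'' : Fin (N + 1) → A.Obj} {a b m : ℤ} (h : a + b = m)
    (θ : Coch A E' E'' a) (η : Coch A E E' b) :
    Coch.map F (Coch.mul h θ η) = Coch.mul h (Coch.map F θ) (Coch.map F η) := by
  funext q I
  simp only [Coch.mul, Coch.ev_map, map_negOnePow, Coch.map, map_sum, F.map_comp]

/-- The dg-functor `Δ_N(A) → Δ_N(B)` induced by a dg-functor `A → B`, on objects. -/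
noncomputable def SimplexObj.map (F : A ⟶ B) (x : (simplex c A N).Obj) : (simplex c B N).Obj :=
  SimplexObj.mk (c := c) (B := B) (N := N)
    (E := fun i => F.obj (x.E i))
    (φ := Coch.map F x.φ)
    (φ_zero := fun I => (congrArg F.map (x.φ_zero I)).trans (map_zero _))
    (maurerCartan := by
      rw [← Coch.map_diff, ← Coch.map_mul]
      funext q I
      exact ((map_add F.map _ _).symm.trans
        (congrArg F.map (congrFun (congrFun x.maurerCartan q) I))).trans (map_zero _))
    (invertible := fun I => (x.invertible I).map F)
    (normalized := fun hc =>
      ⟨fun I h => (congrArg F.map ((x.normalized hc).1 I h)).trans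
          ((map_castHom F _ _ _ _).trans (congrArg _ (F.map_id _))),
        fun q I hq hI => (congrArg F.map ((x.normalized hc).2 q I hq hI)).trans (map_zero _)⟩)

/-- The dg-functor `Δ_N(A) → Δ_N(B)` induced by a dg-functor `A → B`. -/
noncomputable def simplexMap (c : DegeneracyConvention) (F : A ⟶ B) (N : ℕ) :
    simplex c A N ⟶ simplex c B N where
  obj x := SimplexObj.map F x
  map :=
    { toFun := fun θ => Coch.map F θ
      map_add' := fun θ θ' => by funext q I; exact map_add F.map _ _
      map_smul' := fun a θ => by funext q I; exact map_smul F.map _ _ }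
  map_d {x y n m} h θ := by
    have e1 := Coch.map_diff F h θ
    have e2 := Coch.map_mul F (by omega : 1 + n = m) y.φ θ
    have e3 := Coch.map_mul F (by omega : n + 1 = m) θ x.φ
    funext q I
    have e1' := congrFun (congrFun e1 q) I
    have e2' := congrFun (congrFun e2 q) I
    have e3' := congrFun (congrFun e3 q) I
    refine Eq.trans (map_sub F.map _ _) ?_
    refine congrArg₂ (· - ·) ((map_add F.map _ _).trans (congrArg₂ (· + ·) e1' e2')) ?_
    exact (map_negOnePow F n _).trans (congrArg _ e3')
  map_comp h θ η := Coch.map_mul F h θ η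
  map_id x := by
    funext q I
    cases q with
    | zero => exact (map_castHom F _ _ _ _).trans (congrArg _ (F.map_id _))
    | succ q => exact map_zero F.map

end Functoriality

open scoped Simplicial in
/-- The totalization of a cosimplicial dg-category `B^•`: the equalizer of
`∏_n Δ_n(B^n) ⇉ ∏_{σ : [n] → [m]} Δ_n(B^m)`, where one map is given by
`Δ_n(σ_*) : Δ_n(B^n) → Δ_n(B^m)` and the other by `σ^* : Δ_m(B^m) → Δ_n(B^m)`. -/
noncomputable def Tot (c : DegeneracyConvention) (B : CosimplicialObject (DGCat.{w, v, u} k)) :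
    DGCat.{w, v, max u v} k :=
  equalizer (A := pi fun n : ℕ => simplex c (B.obj ⦋n⦌) n)
    (B := pi fun σ : Σ n m : ℕ, (⦋n⦌ ⟶ ⦋m⦌ : Type) => simplex c (B.obj ⦋σ.2.1⦌) σ.1)
    (piLift fun σ => piProj _ σ.1 ≫ simplexMap c (B.map σ.2.2) σ.1)
    (piLift fun σ => piProj _ σ.2.1 ≫ simplexRestrict c (B.obj ⦋σ.2.1⦌) σ.2.2.toOrderHom)

end DGCat

/-- A dg pseudo-functor on a category `C`, with values in dg-categories. The isomorphism
`α f g h w : f^* g^* ≅ h^*` is indexed by all commutative triangles `w : f ≫ g = h`. -/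
structure DGPseudoFunctor (k : Type w) [CommRing k] (C : Type u₁) [Category.{v₁} C] where
  obj : C → DGCat.{w, v, u} k
  map : ∀ {X Y : C}, (X ⟶ Y) → (obj Y ⟶ obj X)
  ε : ∀ (X : C) (x : (obj X).Obj), (obj X).Hom ((map (𝟙 X)).obj x) x 0
  ε_iso : ∀ (X : C) (x : (obj X).Obj), (obj X).IsStrictIso (ε X x)
  ε_naturality : ∀ (X : C) {x y : (obj X).Obj} {n : ℤ} (a : (obj X).Hom x y n),
    (obj X).comp (by omega : n + 0 = n) a (ε X x) =
      (obj X).comp (by omega) (ε X y) ((map (𝟙 X)).map a)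
  α : ∀ {X Y Z : C} (f : X ⟶ Y) (g : Y ⟶ Z) (h : X ⟶ Z) (_ : f ≫ g = h) (z : (obj Z).Obj),
    (obj X).Hom ((map f).obj ((map g).obj z)) ((map h).obj z) 0
  α_iso : ∀ {X Y Z : C} (f : X ⟶ Y) (g : Y ⟶ Z) (h : X ⟶ Z) (w : f ≫ g = h) (z : (obj Z).Obj),
    (obj X).IsStrictIso (α f g h w z)
  α_naturality : ∀ {X Y Z : C} (f : X ⟶ Y) (g : Y ⟶ Z) (h : X ⟶ Z) (w : f ≫ g = h)
    {x y : (obj Z).Obj} {n : ℤ} (a : (obj Z).Hom x y n),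
    (obj X).comp (by omega : n + 0 = n) ((map h).map a) (α f g h w x) =
      (obj X).comp (by omega) (α f g h w y) ((map f).map ((map g).map a))
  α_id_left : ∀ {X Y : C} (f : X ⟶ Y) (y : (obj Y).Obj),
    α (𝟙 X) f f (Category.id_comp f) y = ε X ((map f).obj y)
  α_id_right : ∀ {X Y : C} (f : X ⟶ Y) (y : (obj Y).Obj),
    α f (𝟙 Y) f (Category.comp_id f) y = (map f).map (ε Y y)
  α_assoc : ∀ {X Y Z W : C} (f : X ⟶ Y) (g : Y ⟶ Z) (h : Z ⟶ W) (t : (obj W).Obj),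
    (obj X).comp (by omega : (0 : ℤ) + 0 = 0)
        (α (f ≫ g) h (f ≫ g ≫ h) (Category.assoc f g h) t)
        (α f g (f ≫ g) rfl ((map h).obj t)) =
      (obj X).comp (by omega) (α f (g ≫ h) (f ≫ g ≫ h) rfl t)
        ((map f).map (α g h (g ≫ h) rfl t))

namespace DGPseudoFunctor

variable {k : Type w} [CommRing k] {C : Type u₁} [Category.{v₁} C]
  (F : DGPseudoFunctor.{w, v, u, v₁, u₁} k C)

/-- The objects of `F̃(X)`: the functors `C/X → F` fibered over `C`. Such a functor sends
`h : Y ⟶ X` to an object of `F(Y)` and a morphism `g` from `h' : Z ⟶ X` to `h : Y ⟶ X` over `X`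
to a strict isomorphism from `ξ(h')` to `g^* ξ(h)`. -/
structure RectObj (X : C) where
  obj : ∀ {Y : C}, (Y ⟶ X) → (F.obj Y).Obj
  tr : ∀ {Z Y : C} (g : Z ⟶ Y) (h : Y ⟶ X) (h' : Z ⟶ X) (_ : g ≫ h = h'),
    (F.obj Z).Hom (obj h') ((F.map g).obj (obj h)) 0
  tr_iso : ∀ {Z Y : C} (g : Z ⟶ Y) (h : Y ⟶ X) (h' : Z ⟶ X) (w : g ≫ h = h'),
    (F.obj Z).IsStrictIso (tr g h h' w)
  tr_id : ∀ {Y : C} (h : Y ⟶ X),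
    (F.obj Y).comp (by omega) (F.ε Y (obj h)) (tr (𝟙 Y) h h (Category.id_comp h)) =
      (F.obj Y).id (obj h)
  tr_comp : ∀ {W Z Y : C} (g' : W ⟶ Z) (g : Z ⟶ Y) (h : Y ⟶ X) (h' : Z ⟶ X) (h'' : W ⟶ X)
    (w : g ≫ h = h') (w' : g' ≫ h' = h''),
    tr (g' ≫ g) h h'' (by rw [Category.assoc, w, w']) =
      (F.obj W).comp (by omega : (0 : ℤ) + 0 = 0) (F.α g' g (g' ≫ g) rfl (obj h))
        ((F.obj W).comp (by omega) ((F.map g').map (tr g h h' w)) (tr g' h' h'' w'))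

/-- The degree `n` morphisms of `F̃(X)`: natural transformations of degree `n`. -/
def RectHom {X : C} (ξ η : F.RectObj X) (n : ℤ) :
    Submodule k (∀ (Y : C) (h : Y ⟶ X), (F.obj Y).Hom (ξ.obj h) (η.obj h) n) where
  carrier := {T | ∀ {Z Y : C} (g : Z ⟶ Y) (h : Y ⟶ X) (h' : Z ⟶ X) (w : g ≫ h = h'),
    (F.obj Z).comp (by omega : 0 + n = n) (η.tr g h h' w) (T Z h') =
      (F.obj Z).comp (by omega) ((F.map g).map (T Y h)) (ξ.tr g h h' w)}
  add_mem' {S T} hS hT Z Y g h h' w := by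
    simp only [Pi.add_apply, map_add, LinearMap.add_apply, hS g h h' w, hT g h h' w]
  zero_mem' {Z Y} g h h' w := by simp
  smul_mem' a T hT Z Y g h h' w := by
    simp only [Pi.smul_apply, map_smul, LinearMap.smul_apply, hT g h h' w]

/-- The dg-category `F̃(X) = Fun_C(C/X, F)`. -/
def rect (X : C) : DGCat.{w, max u₁ v₁ v, max u₁ v₁ u v} k where
  Obj := F.RectObj X
  Hom ξ η n := F.RectHom ξ η n
  d {ξ η n m} e :=
    { toFun := fun T => ⟨fun Y h => (F.obj Y).d e (T.1 Y h), by
        intro Z Y g h h' w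
        have e1 := congrArg ((F.obj Z).d e) (T.2 g h h' w)
        rw [(F.obj Z).leibniz (p' := 1) (q' := m) _ _ (by omega) e,
          (F.obj Z).leibniz (p' := m) (q' := 1) _ _ e (by omega),
          (η.tr_iso g h h' w).1, (ξ.tr_iso g h h' w).1] at e1
        rw [(F.map g).map_d]
        simpa using e1⟩
      map_add' := fun S T => by ext; simp
      map_smul' := fun a T => by ext; simp }
  comp {ξ η ζ p q n} e := LinearMap.mk₂ k
    (fun S T => ⟨fun Y h => (F.obj Y).comp e (S.1 Y h) (T.1 Y h), by
      intro Z Y g h h' w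
      rw [(F.map g).map_comp,
        ← (F.obj Z).assoc (by omega : 0 + p = p) e _ _ (ζ.tr g h h' w), S.2 g h h' w,
        (F.obj Z).assoc (b := q) _ _ (by omega) e, T.2 g h h' w,
        ← (F.obj Z).assoc e (by omega) _ _]⟩)
    (fun _ _ _ => by ext; simp) (fun _ _ _ => by ext; simp)
    (fun _ _ _ => by ext; simp) (fun _ _ _ => by ext; simp)
  id ξ := ⟨fun Y h => (F.obj Y).id (ξ.obj h), by
    intro Z Y g h h' w
    rw [(F.map g).map_id, (F.obj Z).comp_id, (F.obj Z).id_comp]⟩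
  d_d e e' T := Subtype.ext (funext fun Y => funext fun h => (F.obj Y).d_d e e' (T.1 Y h))
  leibniz e e₁ e₂ e₃ S T := Subtype.ext (funext fun Y => funext fun h =>
    (F.obj Y).leibniz e e₁ e₂ e₃ (S.1 Y h) (T.1 Y h))
  assoc e₁ e₂ e₃ e₄ R S T := Subtype.ext (funext fun Y => funext fun h =>
    (F.obj Y).assoc e₁ e₂ e₃ e₄ (R.1 Y h) (S.1 Y h) (T.1 Y h))
  id_comp e T := Subtype.ext (funext fun Y => funext fun h => (F.obj Y).id_comp e (T.1 Y h))
  comp_id e T := Subtype.ext (funext fun Y => funext fun h => (F.obj Y).comp_id e (T.1 Y h))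

/-- The pull-back of an object of `F̃(X')` along a functor `C/X → C/X'` over `C`, that is, along
a natural map `p` from the arrows to `X` to the arrows to `X'`. -/
def pullObj {X X' : C} (p : ∀ Y : C, (Y ⟶ X) → (Y ⟶ X'))
    (hp : ∀ {Z Y : C} (g : Z ⟶ Y) (h : Y ⟶ X), g ≫ p Y h = p Z (g ≫ h))
    (ξ : (F.rect X').Obj) : (F.rect X).Obj :=
  RectObj.mk (F := F) (X := X)
    (obj := fun h => ξ.obj (p _ h))
    (tr := fun g h h' w => ξ.tr g (p _ h) (p _ h') (by rw [hp, w]))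
    (tr_iso := fun g h h' w => ξ.tr_iso g (p _ h) (p _ h') (by rw [hp, w]))
    (tr_id := fun h => ξ.tr_id (p _ h))
    (tr_comp := fun g' g h h' h'' w w' =>
      ξ.tr_comp g' g (p _ h) (p _ h') (p _ h'') (by rw [hp, w]) (by rw [hp, w']))

/-- The dg-functor `F̃(X') → F̃(X)` which is given by composition with a functor `C/X → C/X'`
over `C`. -/
def pullAlong {X X' : C} (p : ∀ Y : C, (Y ⟶ X) → (Y ⟶ X'))
    (hp : ∀ {Z Y : C} (g : Z ⟶ Y) (h : Y ⟶ X), g ≫ p Y h = p Z (g ≫ h)) :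
    F.rect X' ⟶ F.rect X where
  obj ξ := F.pullObj p hp ξ
  map :=
    { toFun := fun T => ⟨fun Y h => T.1 Y (p Y h), fun g h h' w =>
        T.2 g (p _ h) (p _ h') (by rw [hp, w])⟩
      map_add' := fun _ _ => rfl
      map_smul' := fun _ _ => rfl }
  map_d _ _ := rfl
  map_comp _ _ _ := rfl
  map_id _ := rfl

theorem pullAlong_congr {X X' : C} {p p' : ∀ Y : C, (Y ⟶ X) → (Y ⟶ X')} (h : p = p')
    (hp : ∀ {Z Y : C} (g : Z ⟶ Y) (h : Y ⟶ X), g ≫ p Y h = p Z (g ≫ h))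
    (hp' : ∀ {Z Y : C} (g : Z ⟶ Y) (h : Y ⟶ X), g ≫ p' Y h = p' Z (g ≫ h)) :
    F.pullAlong p hp = F.pullAlong p' hp' := by
  subst h; rfl

/-- The rectification of `F`, as a strict functor: `f : X ⟶ X'` acts by composition with
`C/X → C/X'`. -/
def rectification : Cᵒᵖ ⥤ DGCat.{w, max u₁ v₁ v, max u₁ v₁ u v} k where
  obj X := F.rect X.unop
  map f := F.pullAlong (fun _ h => h ≫ f.unop) (fun _ _ => (Category.assoc _ _ _).symm)
  map_id X := F.pullAlong_congr (p' := fun _ h => h)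
    (funext fun _ => funext fun h => Category.comp_id h) _ (fun _ _ => rfl)
  map_comp f g := F.pullAlong_congr (p' := fun _ h => (h ≫ g.unop) ≫ f.unop)
    (funext fun _ => funext fun h => (Category.assoc _ _ _).symm) _
    (fun _ _ => by simp only [Category.assoc])

end DGPseudoFunctor

open MonoidalCategory CartesianMonoidalCategory MonObj in
/-- A right action of a group object `G` on an object `X`. -/
structure RightAction {C : Type u₁} [Category.{v₁} C] [CartesianMonoidalCategory C]
    (X G : C) [GrpObj G] where
  act : X ⊗ G ⟶ X
  act_one : ∀ {T : C} (x : T ⟶ X), lift x (1 : T ⟶ G) ≫ act = x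
  act_mul : ∀ {T : C} (x : T ⟶ X) (g h : T ⟶ G),
    lift (lift x g ≫ act) h ≫ act = lift x (g * h) ≫ act

namespace RightAction

open MonoidalCategory CartesianMonoidalCategory MonObj

variable {C : Type u₁} [Category.{v₁} C] [CartesianMonoidalCategory C] {X G : C} [GrpObj G]

/-- The point `x · g`, for `T`-valued points `x` and `g`. -/
def smul (a : RightAction X G) {T : C} (x : T ⟶ X) (g : T ⟶ G) : T ⟶ X := lift x g ≫ a.act

/-- `[X/G]_n = X × G × … × G`. -/
def space (_ : RightAction X G) : ℕ → C
  | 0 => X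
  | n + 1 => space ‹_› n ⊗ G

/-- The coordinate `x` on `[X/G]_n`. -/
def pt (a : RightAction X G) : ∀ n : ℕ, a.space n ⟶ X
  | 0 => 𝟙 X
  | n + 1 => fst (a.space n) G ≫ a.pt n

/-- The coordinates `g_1, …, g_n` on `[X/G]_n`, with indices shifted to `0, …, n - 1`. -/
def gp (a : RightAction X G) : ∀ n : ℕ, Fin n → (a.space n ⟶ G)
  | 0 => Fin.elim0
  | n + 1 => Fin.snoc (α := fun _ => a.space (n + 1) ⟶ G)
      (fun i => fst (a.space n) G ≫ a.gp n i) (snd (a.space n) G)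

/-- The `T`-valued point of `[X/G]_n` with given coordinates `x, g_1, …, g_n`. -/
def tuple (a : RightAction X G) {T : C} (x : T ⟶ X) : ∀ {n : ℕ}, (Fin n → (T ⟶ G)) →
    (T ⟶ a.space n)
  | 0, _ => x
  | _ + 1, g => lift (a.tuple x (fun i => g i.castSucc)) (g (Fin.last _))

variable (a : RightAction X G)

theorem tuple_pt {T : C} (x : T ⟶ X) : ∀ {n : ℕ} (g : Fin n → (T ⟶ G)),
    a.tuple x g ≫ a.pt n = x
  | 0, _ => Category.comp_id _
  | n + 1, g => by
    change lift _ _ ≫ fst _ _ ≫ a.pt n = x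
    rw [lift_fst_assoc, tuple_pt]

theorem gp_last (n : ℕ) : a.gp (n + 1) (Fin.last n) = snd (a.space n) G :=
  Fin.snoc_last (α := fun _ => a.space (n + 1) ⟶ G) _ _

theorem gp_castSucc (n : ℕ) (i : Fin n) :
    a.gp (n + 1) i.castSucc = fst (a.space n) G ≫ a.gp n i :=
  Fin.snoc_castSucc (α := fun _ => a.space (n + 1) ⟶ G) _ _ _

theorem tuple_gp {T : C} (x : T ⟶ X) : ∀ {n : ℕ} (g : Fin n → (T ⟶ G)) (i : Fin n),
    a.tuple x g ≫ a.gp n i = g i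
  | 0, _, i => i.elim0
  | n + 1, g, i => by
    induction i using Fin.lastCases with
    | last =>
      refine (congrArg (a.tuple x g ≫ ·) (a.gp_last n)).trans ?_
      exact lift_snd _ _
    | cast i =>
      refine (congrArg (a.tuple x g ≫ ·) (a.gp_castSucc n i)).trans ?_
      refine (lift_fst_assoc _ _ _).trans ?_
      rw [tuple_gp]

theorem hom_ext {T : C} : ∀ {n : ℕ} {f f' : T ⟶ a.space n}, f ≫ a.pt n = f' ≫ a.pt n →
    (∀ i, f ≫ a.gp n i = f' ≫ a.gp n i) → f = f'
  | 0, f, f', h, _ => (Category.comp_id f).symm.trans (h.trans (Category.comp_id f'))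
  | n + 1, f, f', h, h' => by
    refine CartesianMonoidalCategory.hom_ext (X := a.space n) (Y := G) f f' ?_ ?_
    · refine hom_ext ?_ fun i => ?_
      · exact (Category.assoc _ _ _).trans (h.trans (Category.assoc _ _ _).symm)
      · have := h' i.castSucc
        rw [gp_castSucc] at this
        exact (Category.assoc _ _ _).trans (this.trans (Category.assoc _ _ _).symm)
    · have := h' (Fin.last n)
      rw [gp_last] at this
      exact this

theorem comp_tuple {S T : C} (f : S ⟶ T) (x : T ⟶ X) {n : ℕ} (g : Fin n → (T ⟶ G)) :
    f ≫ a.tuple x g = a.tuple (f ≫ x) (fun i => f ≫ g i) :=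
  a.hom_ext (by simp [tuple_pt]) (fun i => by simp [tuple_gp])

theorem comp_smul {S T : C} (f : S ⟶ T) (x : T ⟶ X) (g : T ⟶ G) :
    f ≫ a.smul x g = a.smul (f ≫ x) (f ≫ g) := by
  simp [smul, comp_lift_assoc]

theorem smul_smul {T : C} (x : T ⟶ X) (g h : T ⟶ G) :
    a.smul (a.smul x g) h = a.smul x (g * h) := a.act_mul x g h

theorem smul_one {T : C} (x : T ⟶ X) : a.smul x (1 : T ⟶ G) = x := a.act_one x

theorem comp_partialProd {S T : C} (f : S ⟶ T) {n : ℕ} (g : Fin n → (T ⟶ G)) (i : Fin (n + 1)) :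
    f ≫ Fin.partialProd g i = Fin.partialProd (fun j => f ≫ g j) i := by
  induction i using Fin.induction with
  | zero => simp [MonObj.comp_one]
  | succ i ih => rw [Fin.partialProd_succ, Fin.partialProd_succ, MonObj.comp_mul, ih]

/-- The structure map `[X/G]_m ⟶ [X/G]_n` of an order preserving map `σ : [n] → [m]`:
`(x, g_1, …, g_m) ↦ (x g_1 ⋯ g_{σ 0}, …, g_{σ(i-1)+1} ⋯ g_{σ(i)}, …)`. Here the product
`g_{p+1} ⋯ g_q` is written as `(g_1 ⋯ g_p)⁻¹ (g_1 ⋯ g_q)`. -/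
def structureMap {n m : ℕ} (σ : Fin (n + 1) →o Fin (m + 1)) : a.space m ⟶ a.space n :=
  a.tuple (a.smul (a.pt m) (Fin.partialProd (a.gp m) (σ 0))) fun i =>
    (Fin.partialProd (a.gp m) (σ i.castSucc))⁻¹ * Fin.partialProd (a.gp m) (σ i.succ)

theorem partialProd_structureMap {M : Type*} [Group M] {n m : ℕ} (g : Fin m → M)
    (σ : Fin (n + 1) → Fin (m + 1)) (i : Fin (n + 1)) :
    Fin.partialProd (fun i : Fin n =>
      (Fin.partialProd g (σ i.castSucc))⁻¹ * Fin.partialProd g (σ i.succ)) i =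
      (Fin.partialProd g (σ 0))⁻¹ * Fin.partialProd g (σ i) := by
  induction i using Fin.induction with
  | zero => simp
  | succ i ih => rw [Fin.partialProd_succ, ih]; group

theorem structureMap_id (n : ℕ) : a.structureMap (OrderHom.id : Fin (n + 1) →o _) = 𝟙 _ := by
  refine a.hom_ext ?_ fun i => ?_
  · rw [structureMap, tuple_pt, Category.id_comp]
    simp [smul_one]
  · rw [structureMap, tuple_gp, Category.id_comp]
    exact Fin.partialProd_right_inv _ _

theorem structureMap_comp {n m l : ℕ} (σ : Fin (n + 1) →o Fin (m + 1))
    (σ' : Fin (m + 1) →o Fin (l + 1)) :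
    a.structureMap (σ'.comp σ) = a.structureMap σ' ≫ a.structureMap σ := by
  conv_rhs => rw [structureMap.eq_def a σ, comp_tuple, comp_smul]
  simp only [MonObj.comp_mul, GrpObj.comp_inv, comp_partialProd]
  have h1 : a.structureMap σ' ≫ a.pt m = a.smul (a.pt l) (Fin.partialProd (a.gp l) (σ' 0)) :=
    a.tuple_pt _ _
  have h2 : (fun j => a.structureMap σ' ≫ a.gp m j) = fun i =>
      (Fin.partialProd (a.gp l) (σ' i.castSucc))⁻¹ * Fin.partialProd (a.gp l) (σ' i.succ) :=
    funext fun j => a.tuple_gp _ _ j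
  rw [h1, h2]
  simp only [partialProd_structureMap, smul_smul]
  simp [structureMap]

/-- The simplicial object `[X/G]_•`. -/
def simplicialSpace : SimplicialObject C where
  obj n := a.space n.unop.len
  map σ := a.structureMap σ.unop.toOrderHom
  map_id _ := a.structureMap_id _
  map_comp σ σ' := a.structureMap_comp σ'.unop.toOrderHom σ.unop.toOrderHom

/-- The inner face map `∂_{j+1}(x, g_1, …, g_{n+1}) = (x, g_1, …, g_{j+1} g_{j+2}, …, g_{n+1})`,
for `1 ≤ j + 1 ≤ n`. -/
def innerFace {n : ℕ} (j : Fin n) : a.space (n + 1) ⟶ a.space n :=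
  a.tuple (a.pt (n + 1)) (Fin.contractNth j.castSucc (· * ·) (a.gp (n + 1)))

/-- The degeneracy map `s_i(x, g_1, …, g_n) = (x, g_1, …, g_i, e, g_{i+1}, …, g_n)`. -/
def degeneracy {n : ℕ} (i : Fin (n + 1)) : a.space n ⟶ a.space (n + 1) :=
  a.tuple (a.pt n) (Fin.insertNth (α := fun _ => a.space n ⟶ G) i 1 (a.gp n))

/-- The front face map `ρ_{n,p}(x, g_1, …, g_n) = (x, g_1, …, g_p)`. -/
def front {n p : ℕ} (h : p ≤ n) : a.space n ⟶ a.space p :=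
  a.tuple (a.pt n) fun i => a.gp n (Fin.castLE h i)

/-- The back face map
`τ_{n,p}(x, g_1, …, g_n) = (x g_1 ⋯ g_{n-p}, g_{n-p+1}, …, g_n)`. -/
def back {n p : ℕ} (h : p ≤ n) : a.space n ⟶ a.space p :=
  a.tuple (a.smul (a.pt n) (Fin.partialProd (a.gp n) ⟨n - p, by omega⟩))
    fun i => a.gp n ⟨n - p + i, by omega⟩

/-- The vertex map `(x, g_1, …, g_n) ↦ x g_1 ⋯ g_p`. -/
def vertex {n p : ℕ} (h : p ≤ n) : a.space n ⟶ X :=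
  a.smul (a.pt n) (Fin.partialProd (a.gp n) ⟨p, by omega⟩)

theorem partialProd_castLE {M : Type*} [Monoid M] {n p : ℕ} (h : p ≤ n) (g : Fin n → M) :
    ∀ i : Fin (p + 1), Fin.partialProd (fun i => g (Fin.castLE h i)) i =
      Fin.partialProd g (Fin.castLE (by omega) i) := by
  intro i
  induction i using Fin.induction with
  | zero => simp
  | succ i ih =>
    rw [Fin.partialProd_succ, ih]
    exact (Fin.partialProd_succ g (Fin.castLE h i)).symm

theorem partialProd_shift {M : Type*} [Monoid M] {n p q : ℕ} (h : q + p ≤ n) (g : Fin n → M) :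
    ∀ i : Fin (p + 1), Fin.partialProd g ⟨q, by omega⟩ *
      Fin.partialProd (fun i : Fin p => g ⟨q + i, by omega⟩) i =
      Fin.partialProd g ⟨q + i, by omega⟩ := by
  intro i
  induction i using Fin.induction with
  | zero => simp
  | succ i ih =>
    rw [Fin.partialProd_succ, ← _root_.mul_assoc, ih]
    exact (Fin.partialProd_succ g ⟨q + i, by omega⟩).symm

/-- `ρ_{n,0} : [X/G]_n ⟶ [X/G]_0 = X`. -/
def frontZero (n : ℕ) : a.space n ⟶ X := a.front (Nat.zero_le n)

/-- `τ_{n,0} : [X/G]_n ⟶ [X/G]_0 = X`. -/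
def backZero (n : ℕ) : a.space n ⟶ X := a.back (Nat.zero_le n)

theorem frontZero_eq (n : ℕ) : a.frontZero n = a.pt n := rfl

theorem backZero_eq (n : ℕ) : a.backZero n = a.vertex le_rfl := rfl

theorem backZero_zero : a.backZero 0 = a.frontZero 0 := by
  rw [backZero_eq, vertex]
  exact (congrArg (a.smul (a.pt 0)) (Fin.partialProd_zero _)).trans (a.smul_one _)

theorem innerFace_front {n : ℕ} (j : Fin n) :
    a.innerFace j ≫ a.frontZero n = a.frontZero (n + 1) :=
  a.tuple_pt _ _

theorem innerFace_back {n : ℕ} (j : Fin n) :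
    a.innerFace j ≫ a.backZero n = a.backZero (n + 1) := by
  rw [backZero_eq, backZero_eq, vertex, vertex, comp_smul, comp_partialProd]
  have h2 : (fun i => a.innerFace j ≫ a.gp n i) =
      Fin.contractNth j.castSucc (· * ·) (a.gp (n + 1)) := funext fun i => a.tuple_gp _ _ i
  rw [h2, Fin.partialProd_contractNth, innerFace, tuple_pt]
  have : j.castSucc.succ.succAbove (Fin.last n) = Fin.last (n + 1) := by
    rw [Fin.succAbove_of_le_castSucc _ _ (by
      rw [Fin.le_def]; simp)]
    rfl
  exact congrArg _ (congrArg (Fin.partialProd (a.gp (n + 1))) this)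

theorem front_front {n p : ℕ} (h : p ≤ n) :
    a.front h ≫ a.frontZero p = a.frontZero n :=
  a.tuple_pt _ _

theorem front_back {n p : ℕ} (h : p ≤ n) :
    a.front h ≫ a.backZero p = a.vertex h := by
  rw [backZero_eq, vertex, vertex, comp_smul, comp_partialProd]
  have h2 : (fun i => a.front h ≫ a.gp p i) = fun i => a.gp n (Fin.castLE h i) :=
    funext fun i => a.tuple_gp _ _ i
  rw [h2, partialProd_castLE, front, tuple_pt]
  rfl

theorem back_front {n p q : ℕ} (h : p + q = n) :
    a.back (by omega : q ≤ n) ≫ a.frontZero q = a.vertex (by omega : p ≤ n) := by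
  refine (a.tuple_pt _ _).trans ?_
  subst h
  simp [vertex]

theorem back_back {n p : ℕ} (h : p ≤ n) :
    a.back h ≫ a.backZero p = a.backZero n := by
  rw [backZero_eq, backZero_eq, vertex, vertex, comp_smul, comp_partialProd]
  have h2 : (fun i => a.back h ≫ a.gp p i) = fun i : Fin p => a.gp n ⟨n - p + i, by omega⟩ :=
    funext fun i => a.tuple_gp _ _ i
  rw [h2, back, tuple_pt, smul_smul, partialProd_shift (by omega)]
  congr 2
  ext
  simp only
  omega

theorem degeneracy_front : a.degeneracy (n := 0) 0 ≫ a.frontZero 1 = 𝟙 X :=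
  a.tuple_pt _ _

theorem degeneracy_back : a.degeneracy (n := 0) 0 ≫ a.backZero 1 = 𝟙 X := by
  rw [backZero_eq, vertex, comp_smul, comp_partialProd, degeneracy, tuple_pt]
  have : (⟨1, by omega⟩ : Fin (1 + 1)) = Fin.succ 0 := rfl
  rw [this, Fin.partialProd_succ, tuple_gp]
  simp [smul_one]
  rfl

end RightAction

namespace DGPseudoFunctor

variable {k : Type w} [CommRing k] {C : Type u₁} [Category.{v₁} C]

section PullHom

variable (F : DGPseudoFunctor.{w, v, u, v₁, u₁} k C)

/-- The dg-functor `f^* : F̃(Y) → F̃(Z)` of a morphism `f : Z ⟶ Y`. -/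
def pull {Z Y : C} (f : Z ⟶ Y) : F.rect Y ⟶ F.rect Z := F.rectification.map f.op

theorem pull_pull_obj {Z Y X : C} (f : Z ⟶ Y) (s : Y ⟶ X) (s' : Z ⟶ X) (h : f ≫ s = s')
    (E : (F.rect X).Obj) : (F.pull f).obj ((F.pull s).obj E) = (F.pull s').obj E := by
  subst h
  exact (congrArg (fun H : F.rect X ⟶ F.rect Z => H.obj E)
    (F.rectification.map_comp s.op f.op)).symm

/-- The map `f^* : Hom(s^* E, t^* E') → Hom((s f)^* E, (t f)^* E')`, where `f^* s^* = (s f)^*`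
and `f^* t^* = (t f)^*` are used as strict equalities. -/
def pullHom {Z Y X : C} (f : Z ⟶ Y) {s t : Y ⟶ X} {s' t' : Z ⟶ X} (hs : f ≫ s = s')
    (ht : f ≫ t = t') {E E' : (F.rect X).Obj} {n : ℤ} :
    (F.rect Y).Hom ((F.pull s).obj E) ((F.pull t).obj E') n →ₗ[k]
      (F.rect Z).Hom ((F.pull s').obj E) ((F.pull t').obj E') n :=
  ((F.rect Z).castHom (F.pull_pull_obj f s s' hs E) (F.pull_pull_obj f t t' ht E') rfl).comp
    (F.pull f).map

end PullHom

section Equivariant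

variable [CartesianMonoidalCategory C] {X G : C} [GrpObj G]
  (F : DGPseudoFunctor.{w, v, u, v₁, u₁} k C) (a : RightAction X G)

/-- `Hom^r(τ_{n,0}^* E, ρ_{n,0}^* E')` in `F̃([X/G]_n)`. -/
abbrev EqvComponent (n : ℕ) (E E' : (F.rect X).Obj) (r : ℤ) : Type (max u₁ v₁ v) :=
  (F.rect (a.space n)).Hom ((F.pull (a.backZero n)).obj E) ((F.pull (a.frontZero n)).obj E') r

variable {F a}

/-- `∂_{j+1}^* θ` for `θ` on `[X/G]_n` and `1 ≤ j + 1 ≤ n`. -/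
def facePull {n : ℕ} (j : Fin n) {E E' : (F.rect X).Obj} {r : ℤ}
    (θ : EqvComponent F a n E E' r) : EqvComponent F a (n + 1) E E' r :=
  F.pullHom (a.innerFace j) (a.innerFace_back j) (a.innerFace_front j) θ

/-- `ρ_{n,p}^* θ ∘ τ_{n,q}^* η` for `θ` on `[X/G]_p` and `η` on `[X/G]_q`, where `n = p + q`. -/
def cupTerm {n p q : ℕ} (h : p + q = n) {E E' E'' : (F.rect X).Obj} {r s t : ℤ}
    (hr : r + s = t) (θ : EqvComponent F a p E' E'' r) (η : EqvComponent F a q E E' s) :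
    EqvComponent F a n E E'' t :=
  (F.rect (a.space n)).comp hr
    (F.pullHom (a.front (by omega : p ≤ n)) (a.front_back _) (a.front_front _) θ)
    (F.pullHom (a.back (by omega : q ≤ n)) (a.back_back _) (a.back_front h) η)

variable (F a)

/-- A `G`-equivariant twisted object: an object `E` of `F̃(X)` with
`φ^{n,1-n} ∈ Hom^{1-n}(τ_{n,0}^* E, ρ_{n,0}^* E)` for `n ≥ 1` which satisfy the Maurer-Cartan
equation (here in simplicial degree `n + 1`) and the non-degeneracy condition, and also, with the
normalized convention, `s_0^* φ^{1,0} = id` and `s_i^* φ^{n,1-n} = 0` for `n ≥ 2`. -/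
structure EqvObj (c : DegeneracyConvention) where
  E : (F.rect X).Obj
  φ : ∀ n : ℕ, 1 ≤ n → EqvComponent F a n E E (1 - n)
  maurerCartan : ∀ n : ℕ,
    ((n + 1 : ℕ) : ℤ).negOnePow •
        (F.rect (a.space (n + 1))).d (by push_cast; omega) (φ (n + 1) (by omega)) +
      ∑ j : Fin n, ((j + 1 : ℕ) : ℤ).negOnePow • facePull j (φ n (by have := j.2; omega)) +
      ∑ j : Fin n, ((1 - (j + 1 : ℕ)) * ((n + 1 : ℕ) - (j + 1 : ℕ)) : ℤ).negOnePow •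
        cupTerm (by have := j.2; omega) (by have := j.2; omega)
          (φ (j + 1) (by omega)) (φ (n - j) (by have := j.2; omega)) =
      (0 : EqvComponent F a (n + 1) E E (1 - n))
  nondegenerate : (F.rect (a.space 1)).HomotopyInvertible (by simp) (φ 1 le_rfl)
  normalized : c = .normalized →
    F.pullHom (a.degeneracy (n := 0) 0) a.degeneracy_back a.degeneracy_front (φ 1 le_rfl) =
      (F.rect X).castHom rfl rfl (by simp) ((F.rect X).id ((F.pull (𝟙 X)).obj E)) ∧
    ∀ (n : ℕ) (i : Fin (n + 2)),
      (F.pull (a.degeneracy i)).map (φ (n + 2) (by omega)) = 0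

variable {F a} {c : DegeneracyConvention}

/-- The degree `m` morphisms between `G`-equivariant twisted objects: collections
`θ^{n,m-n} ∈ Hom^{m-n}(τ_{n,0}^* E, ρ_{n,0}^* E')` for `n ≥ 0`. -/
abbrev EqvHom (x y : EqvObj F a c) (m : ℤ) : Type (max u₁ v₁ v) :=
  ∀ n : ℕ, EqvComponent F a n x.E y.E (m - n)

namespace EqvHom

/-- The sum `∑_{0<j<n} (-1)^j ∂_j^* θ^{n-1,m+1-n}`. -/
def faceSum {x y : EqvObj F a c} {m m' : ℤ} (h : m + 1 = m') (θ : EqvHom x y m) :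
    ∀ n : ℕ, EqvComponent F a n x.E y.E (m' - n)
  | 0 => 0
  | n + 1 => ∑ j : Fin n, ((j + 1 : ℕ) : ℤ).negOnePow •
      (F.rect (a.space (n + 1))).castHom rfl rfl (by push_cast; omega) (facePull j (θ n))

/-- The differential: `(dθ)^{n,m+1-n}` is
`(-1)^n d θ^{n,m-n} + ∑_{0<j<n} (-1)^j ∂_j^* θ^{n-1,m+1-n}
  + ∑_{1≤l≤n} (-1)^{(1-l)(n-l)} ρ_{n,l}^* ψ^{l,1-l} τ_{n,n-l}^* θ^{n-l,m-n+l}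
  - (-1)^m ∑_{0≤l<n} (-1)^{(m-l)(n-l)} ρ_{n,l}^* θ^{l,m-l} τ_{n,n-l}^* φ^{n-l,1-n+l}`
for `θ : (E, φ) → (E', ψ)` of degree `m`. -/
def d {x y : EqvObj F a c} {m m' : ℤ} (h : m + 1 = m') (θ : EqvHom x y m) : EqvHom x y m' :=
  fun n =>
    (n : ℤ).negOnePow • (F.rect (a.space n)).d (by omega) (θ n) + faceSum h θ n +
      ∑ l : Fin n, ((1 - (l + 1 : ℕ)) * (n - (l + 1 : ℕ)) : ℤ).negOnePow •
        cupTerm (by have := l.2; omega) (by have := l.2; omega)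
          (y.φ (l + 1) (by omega)) (θ (n - (l + 1))) -
      m.negOnePow • ∑ l : Fin n, ((m - (l : ℕ)) * (n - (l : ℕ)) : ℤ).negOnePow •
        cupTerm (by have := l.2; omega) (by have := l.2; omega)
          (θ l) (x.φ (n - l) (by have := l.2; omega))

/-- The composition, by the shuffled multiplication
`(θ · η)^n = ∑_{0≤l≤n} (-1)^{(p-l)(n-l)} ρ_{n,l}^* θ^{l,p-l} τ_{n,n-l}^* η^{n-l}`. -/
def comp {x y z : EqvObj F a c} {p q m : ℤ} (h : p + q = m) (θ : EqvHom y z p)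
    (η : EqvHom x y q) : EqvHom x z m :=
  fun n => ∑ l : Fin (n + 1), ((p - (l : ℕ)) * (n - (l : ℕ)) : ℤ).negOnePow •
    cupTerm (by have := l.2; omega) (by have := l.2; omega) (θ l) (η (n - l))

/-- The identity morphism; note that `τ_{0,0} = ρ_{0,0} = id_X`. -/
def id (x : EqvObj F a c) : EqvHom x x 0
  | 0 => (F.rect X).castHom rfl
      (congrArg (fun f => (F.pull f).obj x.E) a.backZero_zero) (by simp)
      ((F.rect X).id ((F.pull (a.backZero 0)).obj x.E))
  | _ + 1 => 0

end EqvHom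

end Equivariant

end DGPseudoFunctor

namespace DGCat

open scoped Simplicial

variable {k : Type w} [CommRing k] {c : DegeneracyConvention}
  {B : CosimplicialObject (DGCat.{w, v, u} k)}

/-- The component `(E^n, φ^n)` in `Δ_n(B^n)` of an object of the totalization. -/
def Tot.component (x : (Tot c B).Obj) (n : ℕ) : SimplexObj c (B.obj ⦋n⦌) n := x.1 n

/-- The component in `Δ_n(B^n)` of a morphism of the totalization. -/
def Tot.homComponent {x y : (Tot c B).Obj} {m : ℤ} (θ : (Tot c B).Hom x y m) (n : ℕ) :
    Coch (B.obj ⦋n⦌) (Tot.component x n).E (Tot.component y n).E m := θ.1 n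

end DGCat

/-- The cosimplicial dg-category `F̃([X/G]_•)`. -/
def RightAction.cosimplicial {k : Type w} [CommRing k] {C : Type u₁} [Category.{v₁} C]
    [CartesianMonoidalCategory C] {X G : C} [GrpObj G] (a : RightAction X G)
    (F : DGPseudoFunctor.{w, v, u, v₁, u₁} k C) :
    CosimplicialObject (DGCat.{w, max u₁ v₁ v, max u₁ v₁ u v} k) :=
  a.simplicialSpace.rightOp ⋙ F.rectification

/-! An object of the totalization has components $\phi_n$ with entries for every multi-index
$I:[q]\to[n]$. The equalizer condition for $I$, read at the identity multi-index of $[q]$, says that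
$(\phi_n)_I$ is the pull-back along the structure map $[X/G]_n\to[X/G]_q$ of the single entry
$(\phi_q)_{0\,1\ldots q}$. The same argument for $[0]\to[n]$, $0\mapsto i$, shows that $E^n_i$ is
the pull-back of $E=E^0_0$ along the vertex map $(x,g_1,\ldots,g_n)\mapsto xg_1\cdots g_i$.
Everything is therefore determined by $E$ and the entries at $0\,1\ldots n$. Conversely, any choice
of these entries extends to a compatible family by pull-back. Both directions use that the
rectification is strictly functorial, so the pull-backs compose as equalities and not just up to
isomorphism.

This bijection is `diag` and `extend`, inverse to each other by `diag_extend` and `extend_diag`. It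
is formulated for any family of objects that equals the vertex pull-backs, so that it applies both
to the objects of a given point of the totalization and to the ones built from an equivariant
object.

The formulas follow by evaluating $D$ and the product at $0\,1\ldots n$. The initial segment
$0\ldots l$ is the front face, the final segment $l\ldots n$ is the back face, and omitting an
interior vertex is an inner face (`diag_mul`, `diag_diff_succ`). The entries of $\phi$ in simplicial
degree $0$ vanish, which removes the end terms of the sums. In the other direction, the
Maurer-Cartan expression of a compatible family is compatible, so it vanishes as soon as its entries
at $0\,1\ldots n$ do (`isCompatible_eq_zero_iff`). Likewise all $\phi_{ij}$ are pull-backs of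
$\phi^{1,0}$ by dg-functors, which preserve homotopy invertibility.

For condition (N), a multi-index with a repetition factors through some degeneracy $[q]\to[q-1]$
(`OrderHom.eq_comp_predAbove`). The degenerate entries are then pull-backs of $s_i^*\phi$, so
condition 3 governs all of them. The unnormalized case is the same proof without this step. -/

/-! ### Faces, degeneracies and vertices of $[X/G]_\bullet$ as structure maps -/

namespace RightAction

open MonoidalCategory CartesianMonoidalCategory MonObj

variable {C : Type u₁} [Category.{v₁} C] [CartesianMonoidalCategory C] {X G : C} [GrpObj G]
  (a : RightAction X G)

/-- Group coordinates are quotients of consecutive partial products, so it is enough to compare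
partial products. For the coordinate formulas of the faces these telescope, while the single
coordinates would need case distinctions. -/
theorem eq_structureMap {n m : ℕ} (σ : Fin (n + 1) →o Fin (m + 1)) (f : a.space m ⟶ a.space n)
    (hpt : f ≫ a.pt n = a.smul (a.pt m) (Fin.partialProd (a.gp m) (σ 0)))
    (hgp : ∀ i, Fin.partialProd (fun j => f ≫ a.gp n j) i =
      (Fin.partialProd (a.gp m) (σ 0))⁻¹ * Fin.partialProd (a.gp m) (σ i)) :
    f = a.structureMap σ := by
  refine a.hom_ext ?_ fun i => ?_
  · rw [hpt, structureMap, tuple_pt]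
  · rw [structureMap, tuple_gp, ← Fin.partialProd_right_inv (fun j => f ≫ a.gp n j) i, hgp, hgp]
    group

/-- The vertex map of `[X/G]_n` with index `i`. -/
def vertexMap {n : ℕ} (i : Fin (n + 1)) : a.space n ⟶ X :=
  a.smul (a.pt n) (Fin.partialProd (a.gp n) i)

theorem frontZero_eq_vertexMap (n : ℕ) : a.frontZero n = a.vertexMap 0 := by
  rw [vertexMap, Fin.partialProd_zero, smul_one, frontZero_eq]

theorem vertexMap_zero (i : Fin 1) : a.vertexMap i = 𝟙 X := by
  obtain rfl := Subsingleton.elim i 0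
  rw [vertexMap, Fin.partialProd_zero, smul_one]
  rfl

/-- The partial products of the image point telescope: $xg_1\cdots g_{\sigma(0)}$ times $(g_1\cdots
g_{\sigma(0)})^{-1}g_1\cdots g_{\sigma(i)}$. This is what makes the vertex pull-backs of an object
compatible with all structure maps. -/
theorem structureMap_vertexMap {n m : ℕ} (σ : Fin (n + 1) →o Fin (m + 1)) (i : Fin (n + 1)) :
    a.structureMap σ ≫ a.vertexMap i = a.vertexMap (σ i) := by
  rw [vertexMap, vertexMap, comp_smul, comp_partialProd, structureMap, tuple_pt]
  simp only [tuple_gp]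
  rw [partialProd_structureMap, smul_smul, mul_inv_cancel_left]

/-- The vertex map is the structure map of `[0] → [n]`, `0 ↦ i`. -/
theorem structureMap_const {n : ℕ} (σ : Fin 1 →o Fin (n + 1)) :
    a.structureMap σ = a.vertexMap (σ 0) := rfl

theorem front_eq_structureMap {n p : ℕ} (h : p ≤ n) :
    a.front h = a.structureMap (Fin.castLEOrderEmb (Nat.succ_le_succ h)).toOrderHom := by
  refine a.eq_structureMap _ _ ?_ fun i => ?_
  · exact (a.tuple_pt _ _).trans (a.frontZero_eq_vertexMap n)
  · have h2 : (fun i => a.front h ≫ a.gp p i) = fun i => a.gp n (Fin.castLE h i) :=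
      funext fun i => a.tuple_gp _ _ i
    rw [h2, partialProd_castLE]
    -- The embedding fixes $0$, so the prefix $(g_1\cdots g_{\sigma(0)})^{-1}$ is trivial.
    refine (_root_.one_mul _).symm.trans (congrArg (· * _) ?_)
    exact (inv_one.symm.trans (congrArg _ (Fin.partialProd_zero (a.gp n)).symm))

/-- The order embedding `[p] → [n]`, `i ↦ n - p + i`. -/
def backEmb {n p : ℕ} (h : p ≤ n) : Fin (p + 1) ↪o Fin (n + 1) :=
  OrderEmbedding.ofStrictMono (fun i => ⟨n - p + i, by omega⟩) fun i j hij => by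
    have : (i : ℕ) < j := hij
    exact Nat.add_lt_add_left this _

theorem back_eq_structureMap {n p : ℕ} (h : p ≤ n) :
    a.back h = a.structureMap (backEmb h).toOrderHom := by
  refine a.eq_structureMap _ _ (a.tuple_pt _ _) fun i => ?_
  have h2 : (fun i => a.back h ≫ a.gp p i) = fun i : Fin p => a.gp n ⟨n - p + i, by omega⟩ :=
    funext fun i => a.tuple_gp _ _ i
  rw [h2, eq_inv_mul_iff_mul_eq]
  exact partialProd_shift (p := p) (q := n - p) (by omega) (a.gp n) i

theorem innerFace_eq_structureMap {n : ℕ} (j : Fin n) :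
    a.innerFace j = a.structureMap (Fin.succAboveOrderEmb j.castSucc.succ).toOrderHom := by
  refine a.eq_structureMap _ _ ?_ fun i => ?_
  · exact (a.tuple_pt _ _).trans (a.frontZero_eq_vertexMap (n + 1))
  · have h2 : (fun i => a.innerFace j ≫ a.gp n i) =
        Fin.contractNth j.castSucc (· * ·) (a.gp (n + 1)) := funext fun i => a.tuple_gp _ _ i
    rw [h2, Fin.partialProd_contractNth]
    refine (_root_.one_mul _).symm.trans (congrArg (· * _) ?_)
    exact (inv_one.symm.trans (congrArg _ (Fin.partialProd_zero (a.gp (n + 1))).symm))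

/-- The surjection `i.predAbove` takes the value $i$ at two consecutive places. The edge between
these gives a quotient of equal partial products, that is $1$; every other edge is carried to an
edge of $[n]$ and gives the corresponding entry of `g`. -/
theorem insertNth_one_eq {M : Type*} [Group M] {n : ℕ} (g : Fin n → M) (i k : Fin (n + 1)) :
    Fin.insertNth (α := fun _ => M) i 1 g k =
      (Fin.partialProd g (i.predAbove k.castSucc))⁻¹ *
        Fin.partialProd g (i.predAbove k.succ) := by
  induction k using Fin.succAboveCases i with
  | x => simp
  | p l =>
    rw [Fin.insertNth_apply_succAbove, ← Fin.partialProd_right_inv g l]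
    rcases lt_or_ge l.castSucc i with h | h
    · rw [Fin.succAbove_of_castSucc_lt _ _ h]
      congr 3
      · rw [Fin.predAbove_of_le_castSucc _ _ (by simpa [Fin.le_def] using h.le)]; rfl
      · rw [Fin.predAbove_of_le_castSucc _ _ (by simpa [Fin.le_def, Fin.lt_def] using h)]; rfl
    · rw [Fin.succAbove_of_le_castSucc _ _ h]
      congr 3
      · rw [Fin.predAbove_of_castSucc_lt _ _ (by
          simp [Fin.le_def, Fin.lt_def] at h ⊢; omega)]; rfl
      · rw [Fin.predAbove_of_castSucc_lt _ _ (by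
          simp [Fin.le_def, Fin.lt_def] at h ⊢; omega)]; rfl

theorem degeneracy_eq_structureMap {n : ℕ} (i : Fin (n + 1)) :
    a.degeneracy i = a.structureMap (Fin.predAboveOrderHom i) := by
  refine congrArg₂ (fun x g => a.tuple x g) ?_ (funext fun k => insertNth_one_eq (a.gp n) i k)
  refine (a.smul_one (a.pt n)).symm.trans (congrArg (a.smul _) ?_)
  rw [show Fin.predAboveOrderHom i 0 = 0 from Fin.predAbove_right_zero (i := i),
    Fin.partialProd_zero]

end RightAction

/-! ### Transport along equalities as heterogeneous equality -/

namespace DGCat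

variable {k : Type w} [CommRing k]

section castHom

variable (B : DGCat.{w, v, u} k)

theorem castHom_heq {x x' y y' : B.Obj} {n n' : ℤ} (hx : x = x') (hy : y = y') (hn : n = n')
    (f : B.Hom x y n) : HEq (B.castHom hx hy hn f) f := by
  subst hx hy hn; rfl

/-- Used to trade transports for heterogeneous equalities, which can be chained without keeping
track of the equalities of objects and degrees. -/
theorem castHom_eq_iff_heq {x x' y y' : B.Obj} {n n' : ℤ} (hx : x = x') (hy : y = y')
    (hn : n = n') (f : B.Hom x y n) (g : B.Hom x' y' n') :
    B.castHom hx hy hn f = g ↔ HEq f g := by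
  subst hx hy hn; exact heq_iff_eq.symm

theorem castHom_injective {x x' y y' : B.Obj} {n n' : ℤ} (hx : x = x') (hy : y = y')
    (hn : n = n') : Function.Injective (B.castHom hx hy hn) := by
  subst hx hy hn; exact fun _ _ h => h

theorem castHom_negOnePow {x x' y y' : B.Obj} {n n' : ℤ} (hx : x = x') (hy : y = y')
    (hn : n = n') (c : ℤ) (f : B.Hom x y n) :
    B.castHom hx hy hn (c.negOnePow • f) = c.negOnePow • B.castHom hx hy hn f := by
  subst hx hy hn; rfl

theorem HomotopyInvertible.castHom {x x' y y' : B.Obj} {n n' : ℤ} (hx : x = x') (hy : y = y')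
    (hn : n = n') {h : n = 0} {h' : n' = 0} {f : B.Hom x y n} (hf : B.HomotopyInvertible h f) :
    B.HomotopyInvertible h' (B.castHom hx hy hn f) := by
  subst hx hy hn; exact hf

end castHom

theorem map_heq {A B : DGCat.{w, v, u} k} (F : A ⟶ B) {x x' y y' : A.Obj} {n n' : ℤ}
    (hx : x = x') (hy : y = y') (hn : n = n') {f : A.Hom x y n} {g : A.Hom x' y' n'}
    (h : HEq f g) : HEq (F.map f) (F.map g) := by
  subst hx hy hn h; rfl

theorem map_heq_of_eq {A B : DGCat.{w, v, u} k} {F G : A ⟶ B} (h : F = G) {x y : A.Obj} {n : ℤ}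
    (f : A.Hom x y n) : HEq (F.map f) (G.map f) := by
  subst h; rfl

end DGCat

/-! ### Strict functoriality of pull-backs in the rectification -/

namespace DGPseudoFunctor

variable {k : Type w} [CommRing k] {C : Type u₁} [Category.{v₁} C]

section PullHom

variable (F : DGPseudoFunctor.{w, v, u, v₁, u₁} k C)

/-- An equality of dg-functors: this is the point of working with the rectification instead of the
pseudo-functor itself. -/
theorem pull_comp {Z Y X : C} (f : Z ⟶ Y) (g : Y ⟶ X) :
    F.pull (f ≫ g) = F.pull g ≫ F.pull f :=
  F.rectification.map_comp g.op f.op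

theorem pull_id (X : C) : F.pull (𝟙 X) = 𝟙 (F.rect X) :=
  F.rectification.map_id (Opposite.op X)

theorem pull_id_obj {X : C} (E : (F.rect X).Obj) : (F.pull (𝟙 X)).obj E = E :=
  congrArg (fun H : F.rect X ⟶ F.rect X => H.obj E) (F.pull_id X)

theorem pull_id_map_heq {X : C} {E E' : (F.rect X).Obj} {n : ℤ} (θ : (F.rect X).Hom E E' n) :
    HEq ((F.pull (𝟙 X)).map θ) θ :=
  DGCat.map_heq_of_eq (F.pull_id X) θ

variable {Z Y X : C} (f : Z ⟶ Y) {s t : Y ⟶ X} {s' t' : Z ⟶ X} (hs : f ≫ s = s')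
  (ht : f ≫ t = t') {E E' : (F.rect X).Obj} {n : ℤ}

theorem pullHom_heq (θ : (F.rect Y).Hom ((F.pull s).obj E) ((F.pull t).obj E') n) :
    HEq (F.pullHom f hs ht θ) ((F.pull f).map θ) :=
  DGCat.castHom_heq _ _ _ _ _

end PullHom

/-! ### Compatible families of cochains and their components at $0\,1\ldots n$ -/

section Equivariant

variable [CartesianMonoidalCategory C] {X G : C} [GrpObj G]
  {F : DGPseudoFunctor.{w, v, u, v₁, u₁} k C} {a : RightAction X G}

/-- The family `U` consists of the pull-backs of `E` along the vertex maps. -/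
def IsVertexFamily (E : (F.rect X).Obj) (U : ∀ n : ℕ, Fin (n + 1) → (F.rect (a.space n)).Obj) :
    Prop :=
  ∀ (n : ℕ) (i : Fin (n + 1)), U n i = (F.pull (a.vertexMap i)).obj E

section Families

variable {E E' E₂ : (F.rect X).Obj} {U V W : ∀ n : ℕ, Fin (n + 1) → (F.rect (a.space n)).Obj}

/-- The index is written through `OrderHom.id` because it is then literally the source of the
component at the identity multi-index. The last vertex map is $\tau_{n,0}$ by definition, whereas
for $\rho_{n,0}$ an empty product has to be cancelled. -/
theorem IsVertexFamily.back (hU : IsVertexFamily E U) (n : ℕ) :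
    U n (OrderHom.id (Fin.last n)) = (F.pull (a.backZero n)).obj E := hU n _

theorem IsVertexFamily.front (hU : IsVertexFamily E U) (n : ℕ) :
    U n (OrderHom.id 0) = (F.pull (a.frontZero n)).obj E := by
  rw [hU, a.frontZero_eq_vertexMap]
  rfl

theorem IsVertexFamily.pull_obj (hU : IsVertexFamily E U) {n l : ℕ}
    (I : Fin (l + 1) →o Fin (n + 1)) (i : Fin (l + 1)) :
    (F.pull (a.structureMap I)).obj (U l i) = U n (I i) := by
  rw [hU, hU]
  exact F.pull_pull_obj _ _ _ (a.structureMap_vertexMap I i) E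

variable (hU : IsVertexFamily E U) (hV : IsVertexFamily E' V) (hW : IsVertexFamily E₂ W)

/-- The components `θ_{0 1 … n}` of a family of cochains. -/
def diag {m : ℤ} (θ : ∀ n, DGCat.Coch (F.rect (a.space n)) (U n) (V n) m) (n : ℕ) :
    EqvComponent F a n E E' (m - n) :=
  (F.rect (a.space n)).castHom (hU.back n) (hV.front n) rfl (θ n n OrderHom.id)

/-- The family of cochains with given components `θ_{0 1 … n}`. -/
def extend {m : ℤ} (ζ : ∀ n, EqvComponent F a n E E' (m - n)) (n : ℕ) :
    DGCat.Coch (F.rect (a.space n)) (U n) (V n) m := fun q I =>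
  (F.rect (a.space n)).castHom
    ((congrArg _ (hU.back q).symm).trans (hU.pull_obj I _))
    ((congrArg _ (hV.front q).symm).trans (hV.pull_obj I _)) rfl
    ((F.pull (a.structureMap I)).map (ζ q))

/-- The compatibility of a family of cochains with the cosimplicial structure. -/
def IsCompatible {m : ℤ} (θ : ∀ n, DGCat.Coch (F.rect (a.space n)) (U n) (V n) m) : Prop :=
  ∀ (n q : ℕ) (I : Fin (q + 1) →o Fin (n + 1)),
    HEq (θ n q I) ((F.pull (a.structureMap I)).map (θ q q OrderHom.id))

variable {m m' : ℤ} {θ : ∀ n, DGCat.Coch (F.rect (a.space n)) (U n) (V n) m}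

/-- Compatibility is required only against components at identity multi-indices. Functoriality of
the structure maps, applied to `I.comp J`, upgrades it to arbitrary components. -/
theorem IsCompatible.comp (hU : IsVertexFamily E U) (hV : IsVertexFamily E' V)
    (hθ : IsCompatible θ) {n l q : ℕ} (I : Fin (l + 1) →o Fin (n + 1))
    (J : Fin (q + 1) →o Fin (l + 1)) :
    HEq ((F.pull (a.structureMap I)).map (θ l q J)) (θ n q (I.comp J)) := by
  refine HEq.trans ?_ (hθ n q (I.comp J)).symm
  refine HEq.trans ?_ (DGCat.map_heq_of_eq
    ((congrArg F.pull (a.structureMap_comp J I)).trans (F.pull_comp _ _)) _).symm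
  exact DGCat.map_heq _ (hU.pull_obj J _).symm (hV.pull_obj J _).symm rfl (hθ l q J)

theorem diag_heq (θ : ∀ n, DGCat.Coch (F.rect (a.space n)) (U n) (V n) m) (n : ℕ) :
    HEq (diag hU hV θ n) (θ n n OrderHom.id) := DGCat.castHom_heq _ _ _ _ _

theorem pull_map_diag_heq (hθ : IsCompatible θ) {n q : ℕ} (I : Fin (q + 1) →o Fin (n + 1)) :
    HEq ((F.pull (a.structureMap I)).map (diag hU hV θ q)) (θ n q I) :=
  (DGCat.map_heq _ (hU.back q).symm (hV.front q).symm rfl (diag_heq hU hV θ q)).trans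
    (hθ n q I).symm

theorem extend_heq (ζ : ∀ n, EqvComponent F a n E E' (m - n)) {n q : ℕ}
    (I : Fin (q + 1) →o Fin (n + 1)) :
    HEq (extend hU hV ζ n q I) ((F.pull (a.structureMap I)).map (ζ q)) :=
  DGCat.castHom_heq _ _ _ _ _

theorem extend_id_heq (ζ : ∀ n, EqvComponent F a n E E' (m - n)) (n : ℕ) :
    HEq (extend hU hV ζ n n OrderHom.id) (ζ n) :=
  (extend_heq hU hV ζ _).trans ((DGCat.map_heq_of_eq
    (congrArg F.pull (a.structureMap_id n)) (ζ n)).trans (F.pull_id_map_heq (ζ n)))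

theorem isCompatible_extend (ζ : ∀ n, EqvComponent F a n E E' (m - n)) :
    IsCompatible (extend (a := a) hU hV ζ) := fun _ q I =>
  (extend_heq hU hV ζ I).trans (DGCat.map_heq _ (hU.back q).symm (hV.front q).symm rfl
    (extend_id_heq hU hV ζ q).symm)

theorem diag_extend (ζ : ∀ n, EqvComponent F a n E E' (m - n)) :
    diag hU hV (extend hU hV ζ) = ζ :=
  funext fun n => eq_of_heq ((diag_heq hU hV _ n).trans (extend_id_heq hU hV ζ n))

/-- Compatibility along `I` is the very formula that defines `extend`, so a compatible family has no
freedom beyond its components at the identities. -/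
theorem extend_diag (hθ : IsCompatible θ) : extend hU hV (diag hU hV θ) = θ :=
  funext fun _ => funext fun _ => funext fun I => eq_of_heq
    ((extend_heq hU hV _ I).trans (pull_map_diag_heq hU hV hθ I))

/-- The component of a compatible family at a subset of `{0, …, n}` is a pull-back. -/
theorem castHom_ev_eq_pullHom (hθ : IsCompatible θ) {n l : ℕ} (e : Fin (l + 1) ↪o Fin (n + 1))
    {A : Finset (Fin (n + 1))} {i j : Fin (n + 1)} {r r' : ℤ}
    (hA : A = Finset.univ.map e.toEmbedding) (hi : i = e 0) (hj : j = e (Fin.last l))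
    (hr : r + l = m) {f : a.space n ⟶ a.space l} (hf : f = a.structureMap e.toOrderHom)
    {s t : a.space n ⟶ X} (hs : f ≫ a.backZero l = s) (ht : f ≫ a.frontZero l = t)
    (hx : U n (OrderHom.id j) = (F.pull s).obj E)
    (hy : V n (OrderHom.id i) = (F.pull t).obj E') (hr' : r = r') :
    (F.rect (a.space n)).castHom hx hy hr' ((θ n).ev OrderHom.id A i j r) =
      (F.rect (a.space n)).castHom rfl rfl (by omega)
        (F.pullHom f hs ht (diag hU hV θ l)) := by
  subst hf hr'
  rw [(θ n).ev_of OrderHom.id e r hr hA hi hj]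
  refine eq_of_heq ((DGCat.castHom_heq _ _ _ _ _).trans ((DGCat.castHom_heq _ _ _ _ _).trans ?_))
  refine HEq.trans ?_ ((DGCat.castHom_heq _ _ _ _ _).trans (F.pullHom_heq _ _ _ _)).symm
  exact (pull_map_diag_heq hU hV hθ e.toOrderHom).symm

/-- At the identity multi-index the factors of the $l$-th summand have index sets $\{0,\ldots,l\}$
and $\{l,\ldots,n\}$, the images of the front embedding of $[l]$ and the back embedding of $[n-l]$.
By compatibility they are pull-backs along $\rho_{n,l}$ and $\tau_{n,n-l}$; the signs already agree.
-/
theorem diag_mul {p q : ℤ} (h : p + q = m)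
    {θ : ∀ n, DGCat.Coch (F.rect (a.space n)) (V n) (W n) p}
    {η : ∀ n, DGCat.Coch (F.rect (a.space n)) (U n) (V n) q}
    (hθ : IsCompatible θ) (hη : IsCompatible η) (n : ℕ) :
    diag hU hW (fun n => DGCat.Coch.mul h (θ n) (η n)) n =
      ∑ l : Fin (n + 1), ((p - (l : ℕ)) * (n - (l : ℕ)) : ℤ).negOnePow •
        cupTerm (by have := l.2; omega) (by have := l.2; omega)
          (diag hV hW θ l) (diag hU hV η (n - l)) := by
  rw [diag, DGCat.Coch.mul, map_sum]
  refine Finset.sum_congr rfl fun l _ => ?_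
  have hl := l.2
  have hV' : V n (OrderHom.id l) = (F.pull (a.vertex (Nat.lt_succ_iff.1 l.2))).obj E' := hV n l
  rw [DGCat.castHom_negOnePow, cupTerm,
    DGCat.castHom_comp _ (hU.back n) hV' (hW.front n)
      rfl (by omega : _ = q - ((n - l : ℕ) : ℤ)) rfl]
  refine congrArg _ (congrArg₂ (fun x y => (F.rect (a.space n)).comp _ x y) ?_ ?_)
  · refine castHom_ev_eq_pullHom hV hW hθ
      (Fin.castLEOrderEmb (n := l + 1) (m := n + 1) (by omega)) ?_ rfl rfl (by omega)
      (a.front_eq_structureMap (by omega)) (a.front_back _) (a.front_front _) _ _ rfl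
    ext x
    simp only [Finset.mem_Iic, Finset.mem_map, Finset.mem_univ, true_and]
    exact ⟨fun h => ⟨⟨x, by have : (x : ℕ) ≤ l := h; omega⟩, rfl⟩, by
      rintro ⟨y, rfl⟩; exact Nat.lt_succ_iff.1 y.2⟩
  · refine castHom_ev_eq_pullHom hU hV hη
      -- This embedding starts at $n-(n-l)$, which is $l$; the goals left over are this arithmetic.
      (RightAction.backEmb (n := n) (p := n - l) (by omega)) ?_ ?_ ?_ (by omega)
      (a.back_eq_structureMap (by omega)) (a.back_back _) (a.back_front (by omega)) _ _ _
    · ext x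
      simp only [Finset.mem_Ici, Finset.mem_map, Finset.mem_univ, true_and]
      refine ⟨fun h => ⟨⟨x - l, by omega⟩, Fin.ext ?_⟩, ?_⟩
      · have : (l : ℕ) ≤ x := h
        change n - (n - l) + (x - l) = (x : ℕ)
        omega
      · rintro ⟨y, rfl⟩
        change (l : ℕ) ≤ n - (n - l) + y
        omega
    · refine Fin.ext ?_
      change (l : ℕ) = n - (n - l) + 0
      omega
    · refine Fin.ext ?_
      change n = n - (n - l) + (n - l)
      omega

/-- The multi-index $(0)$ has no interior place to omit, so only the internal differential survives.
-/
theorem diag_diff_zero (h : m + 1 = m') :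
    diag hU hV (fun n => DGCat.Coch.diff h (θ n)) 0 =
      (F.rect (a.space 0)).d (by omega) (diag hU hV θ 0) := by
  rw [diag, DGCat.Coch.diff, map_add, DGCat.castHom_negOnePow,
    DGCat.castHom_d _ _ _ rfl _, Finset.sum_eq_zero]
  · simp [diag]
  · intro j hj
    exact absurd (Subsingleton.elim (α := Fin 1) j 0)
      (Finset.ne_of_mem_erase (Finset.mem_of_mem_erase hj))

theorem diag_diff_succ (h : m + 1 = m') (hθ : IsCompatible θ) (n : ℕ) :
    diag hU hV (fun n => DGCat.Coch.diff h (θ n)) (n + 1) =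
      ((n + 1 : ℕ) : ℤ).negOnePow •
        (F.rect (a.space (n + 1))).d (by omega) (diag hU hV θ (n + 1)) +
      ∑ j : Fin n, ((j + 1 : ℕ) : ℤ).negOnePow •
        (F.rect (a.space (n + 1))).castHom rfl rfl (by push_cast; omega)
          (facePull j (diag hU hV θ n)) := by
  rw [diag, DGCat.Coch.diff, map_add, DGCat.castHom_negOnePow,
    DGCat.castHom_d _ _ _ rfl _, map_sum]
  refine congrArg₂ (· + ·) rfl ?_
  -- The interior places of $[n+1]$ are $j+1$ for $0\le j<n$, the shift by one that is built into
  -- `innerFace`.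
  have hset : ((Finset.univ.erase (0 : Fin (n + 2))).erase (Fin.last (n + 1))) =
      Finset.univ.map (Fin.castSuccEmb.trans (Fin.succEmb (n + 1))) := by
    ext x
    simp only [Finset.mem_erase, Finset.mem_univ, and_true, Finset.mem_map, true_and]
    constructor
    · rintro ⟨hl, h0⟩
      have h1 : (x : ℕ) ≠ n + 1 := fun h => hl (Fin.ext h)
      have h2 : (x : ℕ) ≠ 0 := fun h => h0 (Fin.ext h)
      have h3 := x.2
      exact ⟨⟨x - 1, by omega⟩, Fin.ext (show (x : ℕ) - 1 + 1 = x by omega)⟩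
    · rintro ⟨j, rfl⟩
      have := j.2
      exact ⟨fun h => absurd (congrArg Fin.val h) (show (j : ℕ) + 1 ≠ n + 1 by omega),
        Fin.succ_ne_zero _⟩
  rw [hset, Finset.sum_map]
  refine Finset.sum_congr rfl fun j _ => ?_
  rw [DGCat.castHom_negOnePow]
  refine congrArg _ ?_
  -- The coface that skips an interior vertex fixes the first one and preserves the last one, so the
  -- omitted component still runs between the pull-backs along $\tau_{n+1,0}$ and $\rho_{n+1,0}$.
  refine castHom_ev_eq_pullHom hU hV hθ (Fin.succAboveOrderEmb j.castSucc.succ) ?_ ?_ ?_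
    (by push_cast; omega) (a.innerFace_eq_structureMap j) _ _ _ _ rfl
  · ext x
    simp only [Finset.mem_erase, Finset.mem_univ, and_true, Finset.mem_map, true_and]
    exact Fin.exists_succAbove_eq_iff.symm
  · exact (Fin.succ_succAbove_zero j.castSucc).symm
  · refine Eq.symm (Fin.succAbove_of_le_castSucc _ _ ?_)
    have := j.2
    simp [Fin.le_def]

end Families

end Equivariant

end DGPseudoFunctor

/-! ### Heterogeneous equality in equalizers, products and cochain spaces -/

namespace DGCat

variable {k : Type w} [CommRing k]

theorem id_heq {B : DGCat.{w, v, u} k} {x y : B.Obj} (h : x = y) : HEq (B.id x) (B.id y) := by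
  subst h; rfl

theorem eq_zero_of_heq {B : DGCat.{w, v, u} k} {x x' y y' : B.Obj} {n n' : ℤ} (hx : x = x')
    (hy : y = y') (hn : n = n') {f : B.Hom x y n} {g : B.Hom x' y' n'} (h : HEq f g)
    (hg : g = 0) : f = 0 := by
  subst hx hy hn h; exact hg

/-- Removes the transport from the definition of the equalizer, so that a morphism of the
totalization becomes a family with heterogeneous equalities, one for each $\sigma$. -/
theorem equalizer_mem_iff_heq {A B : DGCat.{w, v, u} k} {F G : A ⟶ B}
    (x y : (equalizer F G).Obj) {n : ℤ} (f : A.Hom x.1 y.1 n) :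
    f ∈ LinearMap.eqLocus ((B.castHom x.2 y.2 (rfl : n = n)).comp F.map) G.map ↔
      HEq (F.map f) (G.map f) :=
  B.castHom_eq_iff_heq x.2 y.2 rfl _ _

theorem pi_heq_iff {ι : Type} {A : ι → DGCat.{w, v, u} k} {x x' y y' : (pi A).Obj} {n : ℤ}
    (hx : x = x') (hy : y = y') {f : (pi A).Hom x y n} {g : (pi A).Hom x' y' n} :
    HEq f g ↔ ∀ i, HEq (f i) (g i) := by
  subst hx hy
  exact ⟨fun h i => heq_of_eq (congrFun (eq_of_heq h) i),
    fun h => heq_of_eq (funext fun i => eq_of_heq (h i))⟩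

section Cochains

variable {B : DGCat.{w, v, u} k} {N : ℕ}

theorem Coch.heq_iff {E E' V V' : Fin (N + 1) → B.Obj} {m : ℤ} (hE : E = E') (hV : V = V')
    {θ : Coch B E V m} {θ' : Coch B E' V' m} :
    HEq θ θ' ↔ ∀ (q : ℕ) (I : Fin (q + 1) →o Fin (N + 1)), HEq (θ q I) (θ' q I) := by
  subst hE hV
  exact ⟨fun h q I => heq_of_eq (congrFun (congrFun (eq_of_heq h) q) I),
    fun h => heq_of_eq (funext fun q => funext fun I => eq_of_heq (h q I))⟩

theorem Coch.diff_heq {E E' V V' : Fin (N + 1) → B.Obj} {m m' : ℤ} (hE : E = E') (hV : V = V')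
    (h : m + 1 = m') {θ : Coch B E V m} {θ' : Coch B E' V' m} (hθ : HEq θ θ') :
    HEq (Coch.diff h θ) (Coch.diff h θ') := by
  subst hE hV hθ; rfl

theorem Coch.mul_heq {E E' V V' W W' : Fin (N + 1) → B.Obj} {p q m : ℤ} (hE : E = E')
    (hV : V = V') (hW : W = W') (h : p + q = m) {θ : Coch B V W p} {θ' : Coch B V' W' p}
    {η : Coch B E V q} {η' : Coch B E' V' q} (hθ : HEq θ θ') (hη : HEq η η') :
    HEq (Coch.mul h θ η) (Coch.mul h θ' η') := by
  subst hE hV hW hθ hη; rfl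

theorem SimplexObj.ext_of_heq {c : DegeneracyConvention} {x y : SimplexObj c B N}
    (hE : x.E = y.E) (hφ : HEq x.φ y.φ) : x = y := by
  cases x; cases y; cases hE; cases hφ; rfl

theorem SimplexObj.φ_heq {c : DegeneracyConvention} {x y : SimplexObj c B N} (h : x = y)
    {q : ℕ} (I : Fin (q + 1) →o Fin (N + 1)) : HEq (x.φ q I) (y.φ q I) := by
  subst h; rfl

end Cochains

end DGCat

/-! ### Degenerate multi-indices -/

/-- A monotone map that increases strictly at each step is injective, so a repetition must already
occur at adjacent places. -/
theorem OrderHom.exists_castSucc_eq_succ {q n : ℕ} (I : Fin (q + 1) →o Fin n)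
    (hI : ¬ Function.Injective I) : ∃ i : Fin q, I i.castSucc = I i.succ := by
  by_contra! h
  exact hI (Fin.strictMono_iff_lt_succ.2 fun i =>
    lt_of_le_of_ne (I.monotone i.castSucc_lt_succ.le) (h i)).injective

/-- The composite of `i.predAbove` with the coface that skips `i.castSucc` moves only `i.castSucc`,
which goes to `i.succ`, and `I` agrees at these two places. -/
theorem OrderHom.eq_comp_predAbove {q n : ℕ} (I : Fin (q + 2) →o Fin n) {i : Fin (q + 1)}
    (hi : I i.castSucc = I i.succ) :
    I = (I.comp (Fin.succAboveOrderEmb i.castSucc).toOrderHom).comp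
      (Fin.predAboveOrderHom i) := by
  refine OrderHom.ext _ _ (funext fun k => ?_)
  change I k = I (i.castSucc.succAbove (i.predAbove k))
  by_cases hk : k = i.castSucc
  · rw [hk, Fin.predAbove_castSucc_self, Fin.succAbove_castSucc_self, hi]
  · rw [Fin.succAbove_predAbove hk]

namespace DGPseudoFunctor

variable {k : Type w} [CommRing k] {C : Type u₁} [Category.{v₁} C]
  [CartesianMonoidalCategory C] {X G : C} [GrpObj G]
  {F : DGPseudoFunctor.{w, v, u, v₁, u₁} k C} {a : RightAction X G}

theorem pull_structureMap_eq_of_eq_comp_predAbove {q n : ℕ} {I : Fin (q + 2) →o Fin (n + 1)}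
    {J : Fin (q + 1) →o Fin (n + 1)} {i : Fin (q + 1)}
    (h : I = J.comp (Fin.predAboveOrderHom i)) :
    F.pull (a.structureMap I) = F.pull (a.degeneracy i) ≫ F.pull (a.structureMap J) := by
  rw [← F.pull_comp, a.degeneracy_eq_structureMap, ← a.structureMap_comp, h]

/-- Reduces a component at a multi-index with a repetition to $s_i^*$ of the component on
$[X/G]_{q+1}$, which is where condition 3 applies. -/
theorem pull_map_heq_of_eq_comp_predAbove {q n : ℕ} {I : Fin (q + 2) →o Fin (n + 1)}
    {J : Fin (q + 1) →o Fin (n + 1)} {i : Fin (q + 1)} (h : I = J.comp (Fin.predAboveOrderHom i))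
    {E E' : (F.rect (a.space (q + 1))).Obj} {r : ℤ} (θ : (F.rect (a.space (q + 1))).Hom E E' r) :
    HEq ((F.pull (a.structureMap I)).map θ)
      ((F.pull (a.structureMap J)).map ((F.pull (a.degeneracy i)).map θ)) :=
  DGCat.map_heq_of_eq (pull_structureMap_eq_of_eq_comp_predAbove h) θ

/-! ### Cup terms -/

section Cup

variable {E E' E'' : (F.rect X).Obj}

theorem castHom_cupTerm {n p q : ℕ} (h : p + q = n) {r s t t' : ℤ} (hr : r + s = t) (ht : t = t')
    (θ : EqvComponent F a p E' E'' r) (η : EqvComponent F a q E E' s) :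
    (F.rect (a.space n)).castHom rfl rfl ht (cupTerm h hr θ η) =
      cupTerm h (hr.trans ht) θ η := by
  subst ht; rfl

/-- Simplicial degrees such as $n+1-(j+1)$ and $n-j$ agree by arithmetic, but the type of a
component depends on its degree. Passing whole families, with internal degrees given as functions,
lets degree, type and component be substituted together. -/
theorem cupTerm_congr {n p q p' q' : ℕ} (hp : p = p') (hq : q = q') (h : p + q = n)
    {f g : ℕ → ℤ} {t : ℤ} (hr : f p + g q = t) (θ : ∀ n, EqvComponent F a n E' E'' (f n))
    (η : ∀ n, EqvComponent F a n E E' (g n)) :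
    cupTerm h hr (θ p) (η q) =
      cupTerm (by omega) (by rw [← hp, ← hq, hr]) (θ p') (η q') := by
  subst hp hq; rfl

theorem cupTerm_zero_left {n p q : ℕ} (h : p + q = n) {r s t : ℤ} (hr : r + s = t)
    (η : EqvComponent F a q E E' s) :
    cupTerm h hr (0 : EqvComponent F a p E' E'' r) η = 0 := by
  simp [cupTerm]

theorem cupTerm_zero_right {n p q : ℕ} (h : p + q = n) {r s t : ℤ} (hr : r + s = t)
    (θ : EqvComponent F a p E' E'' r) :
    cupTerm h hr θ (0 : EqvComponent F a q E E' s) = 0 := by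
  simp [cupTerm]

end Cup

/-! ### Operations on compatible families and the Maurer-Cartan equation -/

section Families

variable {E E' E'' : (F.rect X).Obj} {U V W : ∀ n : ℕ, Fin (n + 1) → (F.rect (a.space n)).Obj}
  {m m' : ℤ}

/-- Matches compatibility with the equalizer condition. The right-hand side is also convenient for
operations: dg-functors commute with $D$ and the product, and so does restriction of indices, by
definition. One direction is `IsCompatible.comp`, the other evaluates at the identity multi-index.
-/
theorem isCompatible_iff_map_heq (hU : IsVertexFamily E U) (hV : IsVertexFamily E' V)
    {θ : ∀ n, DGCat.Coch (F.rect (a.space n)) (U n) (V n) m} :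
    IsCompatible θ ↔ ∀ {n l : ℕ} (I : Fin (l + 1) →o Fin (n + 1)),
      HEq ((θ l).map (F.pull (a.structureMap I))) ((θ n).restrict I) := by
  refine ⟨fun hθ n l I => ?_, fun h n q I => ?_⟩
  · exact (DGCat.Coch.heq_iff (funext (hU.pull_obj I)) (funext (hV.pull_obj I))).2
      fun q J => hθ.comp hU hV I J
  · exact ((DGCat.Coch.heq_iff (funext (hU.pull_obj I)) (funext (hV.pull_obj I))).1 (h I)
      q OrderHom.id).symm

theorem IsCompatible.diff (hU : IsVertexFamily E U) (hV : IsVertexFamily E' V) (h : m + 1 = m')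
    {θ : ∀ n, DGCat.Coch (F.rect (a.space n)) (U n) (V n) m} (hθ : IsCompatible θ) :
    IsCompatible fun n => DGCat.Coch.diff h (θ n) := by
  refine (isCompatible_iff_map_heq hU hV).2 fun {n l} I => ?_
  rw [DGCat.Coch.map_diff]
  exact DGCat.Coch.diff_heq (funext (hU.pull_obj I)) (funext (hV.pull_obj I)) h
    ((isCompatible_iff_map_heq hU hV).1 hθ I)

theorem IsCompatible.mul (hU : IsVertexFamily E U) (hV : IsVertexFamily E' V)
    (hW : IsVertexFamily E'' W) {p q : ℤ} (h : p + q = m)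
    {θ : ∀ n, DGCat.Coch (F.rect (a.space n)) (V n) (W n) p}
    {η : ∀ n, DGCat.Coch (F.rect (a.space n)) (U n) (V n) q}
    (hθ : IsCompatible θ) (hη : IsCompatible η) :
    IsCompatible fun n => DGCat.Coch.mul h (θ n) (η n) := by
  refine (isCompatible_iff_map_heq hU hW).2 fun {n l} I => ?_
  rw [DGCat.Coch.map_mul]
  exact DGCat.Coch.mul_heq (θ' := (θ n).restrict I) (η' := (η n).restrict I)
    (funext (hU.pull_obj I)) (funext (hV.pull_obj I)) (funext (hW.pull_obj I)) h
    ((isCompatible_iff_map_heq hV hW).1 hθ I)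
    ((isCompatible_iff_map_heq hU hV).1 hη I)

/-- Pull-back and transport are additive, so the sum is the extension of the sum of the diagonal
components. This avoids adding heterogeneous equalities. -/
theorem IsCompatible.add (hU : IsVertexFamily E U) (hV : IsVertexFamily E' V)
    {θ θ' : ∀ n, DGCat.Coch (F.rect (a.space n)) (U n) (V n) m} (hθ : IsCompatible θ)
    (hθ' : IsCompatible θ') : IsCompatible fun n => θ n + θ' n := by
  have h : (fun n => θ n + θ' n) =
      extend hU hV (fun n => diag hU hV θ n + diag hU hV θ' n) := by
    funext n q I
    rw [← congrFun (extend_diag hU hV hθ) n, ← congrFun (extend_diag hU hV hθ') n]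
    simp only [Pi.add_apply, extend, map_add]
    rfl
  rw [h]
  exact isCompatible_extend _ _ _

variable (hU : IsVertexFamily E U) (hV : IsVertexFamily E' V)

/-- A compatible family is the extension of its diagonal components, and the extension of zero is
zero. This reduces equations at all multi-indices to the equations at $0\,1\ldots n$. -/
theorem isCompatible_eq_zero_iff {θ : ∀ n, DGCat.Coch (F.rect (a.space n)) (U n) (V n) m}
    (hθ : IsCompatible θ) : (∀ n, θ n = 0) ↔ ∀ n, diag hU hV θ n = 0 := by
  refine ⟨fun h n => ?_, fun h n => ?_⟩
  · rw [diag, h]; exact map_zero _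
  · have h' : diag hU hV θ = 0 := funext h
    rw [← extend_diag hU hV hθ, h']
    funext q I
    exact (congrArg _ (map_zero _)).trans (map_zero _)

theorem diag_add (θ θ' : ∀ n, DGCat.Coch (F.rect (a.space n)) (U n) (V n) m) (n : ℕ) :
    diag hU hV (fun n => θ n + θ' n) n = diag hU hV θ n + diag hU hV θ' n :=
  map_add _ _ _

/-- The degree is a variable with a proof that it is $0$, because in the applications it appears as
the value of an element of `Fin` or as a difference. -/
theorem diag_eq_zero {θ : ∀ n, DGCat.Coch (F.rect (a.space n)) (U n) (V n) m}
    (h : ∀ n I, θ n 0 I = 0) {n : ℕ} (hn : n = 0) : diag hU hV θ n = 0 := by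
  subst hn
  rw [diag, h, map_zero]

theorem diag_maurerCartan_succ {φ : ∀ n, DGCat.Coch (F.rect (a.space n)) (U n) (U n) 1}
    (hφ : IsCompatible φ) (h0 : ∀ n I, φ n 0 I = 0) (n : ℕ) :
    diag hU hU (fun n => DGCat.Coch.diff (m' := 2) (by omega) (φ n) +
      DGCat.Coch.mul (by omega) (φ n) (φ n)) (n + 1) =
    (F.rect (a.space (n + 1))).castHom rfl rfl (by push_cast; omega)
      (((n + 1 : ℕ) : ℤ).negOnePow •
        (F.rect (a.space (n + 1))).d (by push_cast; omega) (diag hU hU φ (n + 1)) +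
      ∑ j : Fin n, ((j + 1 : ℕ) : ℤ).negOnePow • facePull j (diag hU hU φ n) +
      ∑ j : Fin n, ((1 - (j + 1 : ℕ)) * ((n + 1 : ℕ) - (j + 1 : ℕ)) : ℤ).negOnePow •
        cupTerm (by have := j.2; omega) (by have := j.2; omega)
          (diag hU hU φ (j + 1)) (diag hU hU φ (n - j)) :
      EqvComponent F a (n + 1) E E (1 - n)) := by
  -- Splitting off both ends of the product sum isolates the terms with a factor $\phi$ of
  -- simplicial degree $0$; these vanish, and the remaining $1\le l\le n$ become $l=j+1$. The outer
  -- transport in the statement identifies the degrees $1-n$ and $2-(n+1)$.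
  rw [diag_add, diag_diff_succ hU hU _ hφ, diag_mul hU hU hU _ hφ hφ, Fin.sum_univ_succ,
    Fin.sum_univ_castSucc]
  simp only [map_add, map_sum, DGCat.castHom_negOnePow, castHom_cupTerm]
  refine congrArg₂ (· + ·) (congrArg₂ (· + ·) (congrArg _ ?_) rfl) ?_
  · rw [DGCat.castHom_d _ rfl rfl rfl]; rfl
  · rw [diag_eq_zero hU hU h0 (n := ((0 : Fin (n + 1 + 1)) : ℕ)) rfl, cupTerm_zero_left,
      diag_eq_zero hU hU h0 (n := n + 1 - ((Fin.last n).succ : ℕ)) (by simp), cupTerm_zero_right,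
      smul_zero, smul_zero, zero_add, add_zero]
    refine Finset.sum_congr rfl fun j _ => congrArg _ ?_
    exact cupTerm_congr (f := fun n => 1 - n) (g := fun n => 1 - n) rfl (by simp) _ _
      (diag hU hU φ) (diag hU hU φ)

/-- Every term contains $\phi$ in simplicial degree $0$. The equation is empty there, which is why
condition 1 starts at $n=1$. -/
theorem diag_maurerCartan_zero {φ : ∀ n, DGCat.Coch (F.rect (a.space n)) (U n) (U n) 1}
    (hφ : IsCompatible φ) (h0 : ∀ n I, φ n 0 I = 0) :
    diag hU hU (fun n => DGCat.Coch.diff (m' := 2) (by omega) (φ n) +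
      DGCat.Coch.mul (by omega) (φ n) (φ n)) 0 = 0 := by
  rw [diag_add, diag_diff_zero, diag_mul hU hU hU _ hφ hφ, Finset.sum_eq_zero, add_zero,
    diag_eq_zero hU hU h0 rfl, map_zero]
  intro l _
  rw [diag_eq_zero hU hU h0 (n := l) (by omega), cupTerm_zero_left, smul_zero]

end Families

end DGPseudoFunctor

/-! ### From the totalization to equivariant objects -/

namespace DGPseudoFunctor

variable {k : Type w} [CommRing k] {C : Type u₁} [Category.{v₁} C]
  [CartesianMonoidalCategory C] {X G : C} [GrpObj G]
  {F : DGPseudoFunctor.{w, v, u, v₁, u₁} k C} {a : RightAction X G} {c : DegeneracyConvention}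

theorem EqvObj.ext_of_heq {x y : EqvObj F a c} (hE : x.E = y.E)
    (hφ : ∀ n hn, HEq (x.φ n hn) (y.φ n hn)) : x = y := by
  obtain ⟨E, φ, _, _, _⟩ := x
  obtain ⟨E', φ', _, _, _⟩ := y
  cases hE
  obtain rfl : φ = φ' := funext fun n => funext fun hn => eq_of_heq (hφ n hn)
  rfl

section Totalization

/-- The objects `E^n_i` of an object of the totalization. -/
def totE (x : (DGCat.Tot c (a.cosimplicial F)).Obj) (n : ℕ) :
    Fin (n + 1) → (F.rect (a.space n)).Obj :=
  (DGCat.Tot.component x n).E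

/-- The object `E^0_0` of an object of the totalization. -/
def totBase (x : (DGCat.Tot c (a.cosimplicial F)).Obj) : (F.rect X).Obj := totE x 0 0

/-- The cochains `φ_n` of an object of the totalization. -/
def totφ (x : (DGCat.Tot c (a.cosimplicial F)).Obj) (n : ℕ) :
    DGCat.Coch (F.rect (a.space n)) (totE x n) (totE x n) 1 :=
  (DGCat.Tot.component x n).φ

/-- The cochains `θ_n` of a morphism of the totalization. -/
def totHom {x y : (DGCat.Tot c (a.cosimplicial F)).Obj} {m : ℤ}
    (θ : (DGCat.Tot c (a.cosimplicial F)).Hom x y m) (n : ℕ) :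
    DGCat.Coch (F.rect (a.space n)) (totE x n) (totE y n) m :=
  DGCat.Tot.homComponent θ n

variable (x y : (DGCat.Tot c (a.cosimplicial F)).Obj)

/-- The equalizer condition on objects at `I`; the structure maps of the cosimplicial dg-category
unfold to pull-backs along `structureMap`. -/
theorem map_component_eq_restrict {n m : ℕ} (I : Fin (n + 1) →o Fin (m + 1)) :
    (DGCat.SimplexObj.map (c := c) (A := F.rect (a.space n)) (B := F.rect (a.space m))
      (F.pull (a.structureMap I)) (DGCat.Tot.component x n)) =
      DGCat.SimplexObj.restrict (c := c) (B := F.rect (a.space m)) I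
        (DGCat.Tot.component x m) :=
  congrFun x.2 ⟨n, m, SimplexCategory.Hom.mk I⟩

/-- The condition is used for $[0]\to[n]$, $0\mapsto i$, whose structure map is the vertex map. -/
theorem isVertexFamily_totE : IsVertexFamily (totBase x) (totE x) := fun n i =>
  (congrFun (congrArg (fun z : DGCat.SimplexObj c (F.rect (a.space n)) 0 => z.E)
    (map_component_eq_restrict x (OrderHom.const (Fin 1) i))) 0).symm

/-- Reads the equality of objects of $\Delta_q$ only at the identity multi-index of $[q]$. -/
theorem isCompatible_totφ : IsCompatible (totφ x) := fun _ _ I =>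
  (DGCat.SimplexObj.φ_heq (map_component_eq_restrict x I) OrderHom.id).symm

theorem totφ_zero (n : ℕ) (I : Fin 1 →o Fin (n + 1)) : totφ x n 0 I = 0 :=
  (DGCat.Tot.component x n).φ_zero I

variable {x y}

theorem isCompatible_totHom {m : ℤ} (θ : (DGCat.Tot c (a.cosimplicial F)).Hom x y m) :
    IsCompatible (totHom θ) :=
  (isCompatible_iff_map_heq (isVertexFamily_totE x) (isVertexFamily_totE y)).2 fun {n l} I =>
    (DGCat.pi_heq_iff x.2 y.2).1 ((DGCat.equalizer_mem_iff_heq x y θ.1).1 θ.2)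
      ⟨l, n, SimplexCategory.Hom.mk I⟩

/-- The morphism of the totalization which is given by a compatible family of cochains. -/
def totHomMk {m : ℤ} (θ : ∀ n, DGCat.Coch (F.rect (a.space n)) (totE x n) (totE y n) m)
    (hθ : IsCompatible θ) : (DGCat.Tot c (a.cosimplicial F)).Hom x y m :=
  ⟨θ, (DGCat.equalizer_mem_iff_heq x y θ).2 ((DGCat.pi_heq_iff x.2 y.2).2 fun σ =>
    (isCompatible_iff_map_heq (isVertexFamily_totE x) (isVertexFamily_totE y)).1 hθ
      σ.2.2.toOrderHom)⟩

variable (x y) in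
/-- The morphisms of the totalization are determined by their components `θ_{0 1 … n}`, which
are arbitrary. -/
noncomputable def totHomEquiv (m : ℤ) : (DGCat.Tot c (a.cosimplicial F)).Hom x y m ≃ₗ[k]
    ∀ n : ℕ, EqvComponent F a n (totBase x) (totBase y) (m - n) where
  toFun θ := diag (isVertexFamily_totE x) (isVertexFamily_totE y) (totHom θ)
  map_add' _ _ := funext fun _ => map_add _ _ _
  map_smul' r _ := funext fun n => ((F.rect (a.space n)).castHom _ _ _).map_smul r _
  invFun ζ := totHomMk (extend (isVertexFamily_totE x) (isVertexFamily_totE y) ζ)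
    (isCompatible_extend _ _ ζ)
  left_inv θ := Subtype.ext (extend_diag _ _ (isCompatible_totHom θ))
  right_inv ζ := diag_extend _ _ ζ

/-- The equivariant object of an object of the totalization. -/
noncomputable def eqvObjOfTot (x : (DGCat.Tot c (a.cosimplicial F)).Obj) : EqvObj F a c where
  E := totBase x
  φ n _ := diag (isVertexFamily_totE x) (isVertexFamily_totE x) (totφ x) n
  maurerCartan n := by
    -- Condition 1 in simplicial degree $n+1$ is, up to transport of the degree, the component at
    -- $0\,1\ldots n+1$ of the Maurer-Cartan equation in $\Delta_{n+1}$.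
    refine DGCat.castHom_injective _ rfl rfl (by push_cast; omega : 1 - (n : ℤ) = 2 - (n + 1 : ℕ))
      ((diag_maurerCartan_succ (isVertexFamily_totE x) (isCompatible_totφ x)
        (totφ_zero x) n).symm.trans ?_)
    rw [map_zero]
    refine (congrArg _ ?_).trans (map_zero _)
    exact congrFun (congrFun (DGCat.Tot.component x (n + 1)).maurerCartan _) _
  nondegenerate :=
    ((DGCat.Tot.component x 1).invertible OrderHom.id).castHom (F.rect (a.space 1)) _ _ _
  normalized hc := by
    -- By compatibility $s_i^*\phi^{q+1,-q}$ is the component of $\phi_q$ at the multi-index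
    -- $(0,\ldots,i,i,\ldots,q)$, to which (N) applies.
    have hx : ∀ (q : ℕ) (i : Fin (q + 1)),
        HEq ((F.pull (a.degeneracy i)).map
          (diag (isVertexFamily_totE x) (isVertexFamily_totE x) (totφ x) (q + 1)))
          (totφ x q (q + 1) (Fin.predAboveOrderHom i)) := fun q i => by
      rw [a.degeneracy_eq_structureMap]
      exact pull_map_diag_heq _ _ (isCompatible_totφ x) _
    have hpull : ∀ (q : ℕ) (i : Fin (q + 1)) (j : Fin (q + 2)),
        (F.pull (a.degeneracy i)).obj (totE x (q + 1) j) =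
          totE x q (Fin.predAboveOrderHom i j) := fun q i j => by
      rw [a.degeneracy_eq_structureMap]
      exact (isVertexFamily_totE x).pull_obj _ _
    refine ⟨?_, fun n i => ?_⟩
    · refine eq_of_heq ((F.pullHom_heq _ _ _ _).trans ((hx 0 0).trans ?_))
      refine (heq_of_eq (((DGCat.Tot.component x 0).normalized hc).1
        (Fin.predAboveOrderHom 0) (Subsingleton.elim (α := Fin 1) _ _))).trans ?_
      refine (DGCat.castHom_heq (F.rect X) _ _ _ _).trans
        (HEq.trans ?_ (DGCat.castHom_heq (F.rect X) _ _ _ _).symm)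
      refine DGCat.id_heq (B := F.rect X) ?_
      exact (isVertexFamily_totE x 0 _).trans
        (congrArg (fun f => (F.pull f).obj _) (a.vertexMap_zero _))
    · have h0 : totφ x (n + 1) (n + 2) (Fin.predAboveOrderHom i) = 0 :=
        -- The multi-index has $n+3$ places and only $n+2$ possible values, so it is not injective.
        ((DGCat.Tot.component x (n + 1)).normalized hc).2 (n + 2) _ (by omega) fun hinj => by
          have := Fintype.card_le_of_injective _ hinj
          simp at this
      exact DGCat.eq_zero_of_heq
        ((congrArg _ ((isVertexFamily_totE x).back (n + 2)).symm).trans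
          (hpull (n + 1) i (Fin.last (n + 2))))
        ((congrArg _ ((isVertexFamily_totE x).front (n + 2)).symm).trans (hpull (n + 1) i 0))
        rfl (hx (n + 1) i) h0

end Totalization

end DGPseudoFunctor

/-! ### From equivariant objects to the totalization -/

namespace DGPseudoFunctor

variable {k : Type w} [CommRing k] {C : Type u₁} [Category.{v₁} C]
  [CartesianMonoidalCategory C] {X G : C} [GrpObj G]
  {F : DGPseudoFunctor.{w, v, u, v₁, u₁} k C} {a : RightAction X G} {c : DegeneracyConvention}

namespace EqvObj

variable (e : EqvObj F a c)

/-- The pull-backs of the underlying object along the vertex maps. -/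
def vertexObj (n : ℕ) (i : Fin (n + 1)) : (F.rect (a.space n)).Obj :=
  (F.pull (a.vertexMap i)).obj e.E

theorem isVertexFamily : IsVertexFamily e.E e.vertexObj := fun _ _ => rfl

/-- The components `φ^{n,1-n}`, with the component for `n = 0` equal to `0`. -/
def φ₀ : ∀ n : ℕ, EqvComponent F a n e.E e.E (1 - n)
  | 0 => 0
  | n + 1 => e.φ (n + 1) (by omega)

theorem φ_eq_φ₀ : ∀ {n : ℕ} (hn : 1 ≤ n), e.φ n hn = e.φ₀ n
  | 0, hn => absurd hn (by omega)
  | _ + 1, _ => rfl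

/-- The twisting cochains which are determined by an equivariant object. -/
def coch (n : ℕ) : DGCat.Coch (F.rect (a.space n)) (e.vertexObj n) (e.vertexObj n) 1 :=
  extend e.isVertexFamily e.isVertexFamily e.φ₀ n

theorem coch_heq {n q : ℕ} (I : Fin (q + 1) →o Fin (n + 1)) :
    HEq (e.coch n q I) ((F.pull (a.structureMap I)).map (e.φ₀ q)) :=
  extend_heq _ _ _ _

theorem isCompatible_coch : IsCompatible e.coch :=
  isCompatible_extend e.isVertexFamily e.isVertexFamily _

theorem diag_coch : diag e.isVertexFamily e.isVertexFamily e.coch = e.φ₀ := diag_extend _ _ _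

theorem coch_zero (n : ℕ) (I : Fin 1 →o Fin (n + 1)) : e.coch n 0 I = 0 :=
  (congrArg _ (F.pull (a.structureMap I)).map.map_zero).trans
    ((F.rect (a.space n)).castHom _ _ _).map_zero

/-- The left-hand side is a compatible family in $n$, so only its components at $0\,1\ldots n$
matter: the equation is empty for $n=0$ and is condition 1 for $n\ge1$. -/
theorem coch_maurerCartan (n : ℕ) : DGCat.Coch.diff (m' := 2) (by omega) (e.coch n) +
    DGCat.Coch.mul (by omega) (e.coch n) (e.coch n) = 0 := by
  have hU := e.isVertexFamily
  have hφ := e.isCompatible_coch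
  have hdiff := hφ.diff hU hU (by omega : (1 : ℤ) + 1 = 2)
  have hmul := hφ.mul hU hU hU (by omega : (1 : ℤ) + 1 = 2) hφ
  refine (isCompatible_eq_zero_iff hU hU (hdiff.add hU hU hmul)).2 (fun n => ?_) n
  cases n with
  | zero => exact diag_maurerCartan_zero hU hφ e.coch_zero
  | succ n =>
    refine (diag_maurerCartan_succ hU hφ e.coch_zero n).trans ?_
    have h := e.maurerCartan n
    simp only [φ_eq_φ₀] at h
    rw [diag_coch]
    exact (congrArg _ h).trans (map_zero _)

/-- The multi-index $(i,i)$ factors through $[1]\to[0]$, so the component is a pull-back of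
$s_0^*\phi^{1,0}$, an identity by condition 3; dg-functors preserve identities. -/
theorem coch_one_of_eq (hc : c = .normalized) {n : ℕ} (I : Fin 2 →o Fin (n + 1))
    (h : I 0 = I (Fin.last 1)) :
    e.coch n 1 I = (F.rect (a.space n)).castHom (congrArg (e.vertexObj n) h) rfl (by simp)
      ((F.rect (a.space n)).id (e.vertexObj n (I 0))) := by
  have hI := I.eq_comp_predAbove (i := 0) h
  set J := I.comp (Fin.succAboveOrderEmb (Fin.castSucc 0)).toOrderHom with hJ
  refine eq_of_heq ((e.coch_heq I).trans (HEq.trans ?_ (DGCat.castHom_heq _ _ _ _ _).symm))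
  refine (pull_map_heq_of_eq_comp_predAbove hI _).trans ?_
  have h1 : HEq ((F.pull (a.degeneracy (n := 0) 0)).map (e.φ₀ 1))
      ((F.rect X).id ((F.pull (𝟙 X)).obj e.E)) :=
    (F.pullHom_heq _ a.degeneracy_back a.degeneracy_front _).symm.trans
      ((heq_of_eq (e.normalized hc).1).trans (DGCat.castHom_heq (F.rect X) _ _ _ _))
  have h2 := DGCat.map_heq (F.pull (a.structureMap J))
    (F.pull_pull_obj _ _ _ a.degeneracy_back e.E)
    (F.pull_pull_obj _ _ _ a.degeneracy_front e.E) (by simp) h1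
  refine h2.trans ((heq_of_eq ((F.pull (a.structureMap J)).map_id _)).trans
    (DGCat.id_heq (B := F.rect (a.space n)) ?_))
  refine F.pull_pull_obj _ _ _ ?_ e.E
  refine (Category.comp_id _).trans ((a.structureMap_const J).trans (congrArg a.vertexMap ?_))
  -- The face `J` keeps the second place of `I`, while the claim names the object by the first one.
  exact h.symm

/-- A repetition makes the component a pull-back of some $s_i^*\phi^{q,1-q}$, which is $0$ by
condition 3. -/
theorem coch_eq_zero (hc : c = .normalized) {n q : ℕ} (I : Fin (q + 1) →o Fin (n + 1))
    (hq : 2 ≤ q) (hI : ¬ Function.Injective I) : e.coch n q I = 0 := by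
  obtain ⟨q, rfl⟩ := Nat.exists_eq_add_of_le' hq
  obtain ⟨i, hi⟩ := I.exists_castSucc_eq_succ hI
  have h := pull_map_heq_of_eq_comp_predAbove (F := F) (a := a) (I.eq_comp_predAbove hi)
    (e.φ (q + 2) (by omega))
  rw [(e.normalized hc).2 q i, map_zero] at h
  -- Being heterogeneously equal to a zero morphism gives vanishing only once the sources and
  -- targets are known to agree.
  have h' : ∀ E, _ = _ := fun E => congrArg
    (fun H : F.rect (a.space (q + 2)) ⟶ F.rect (a.space n) => H.obj E)
    (pull_structureMap_eq_of_eq_comp_predAbove (I.eq_comp_predAbove hi))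
  exact (congrArg _ (DGCat.eq_zero_of_heq (h' _) (h' _) rfl h rfl)).trans
    ((F.rect (a.space n)).castHom _ _ _).map_zero

/-- The object of the totalization which is determined by an equivariant object. -/
noncomputable def toTot : (DGCat.Tot c (a.cosimplicial F)).Obj :=
  ⟨fun n => DGCat.SimplexObj.mk (c := c) (B := F.rect (a.space n)) (N := n)
      (E := e.vertexObj n)
      (φ := e.coch n)
      (φ_zero := e.coch_zero n)
      (maurerCartan := e.coch_maurerCartan n)
      -- Condition 2 concerns $\phi^{1,0}$ alone; each $\phi_{ij}$ is its image under a dg-functor,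
      -- and these preserve homotopy invertibility.
      (invertible := fun I => (e.nondegenerate.map (F.pull (a.structureMap I))).castHom _ _ _ _)
      (normalized := fun hc =>
        ⟨fun I h => e.coch_one_of_eq hc I h, fun _ I hq hI => e.coch_eq_zero hc I hq hI⟩),
    funext fun σ => DGCat.SimplexObj.ext_of_heq
      (funext fun i => e.isVertexFamily.pull_obj σ.2.2.toOrderHom i)
      ((isCompatible_iff_map_heq e.isVertexFamily e.isVertexFamily).1 e.isCompatible_coch
        σ.2.2.toOrderHom)⟩

end EqvObj

/-- The objects of the totalization are the equivariant objects. -/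
noncomputable def totObjEquiv : (DGCat.Tot c (a.cosimplicial F)).Obj ≃ EqvObj F a c where
  toFun := eqvObjOfTot
  invFun := EqvObj.toTot
  left_inv x := by
    refine Subtype.ext (funext fun n => ?_)
    have hE : (eqvObjOfTot x).vertexObj n = totE x n :=
      funext fun i => (isVertexFamily_totE x n i).symm
    -- The value $0$ that `φ₀` puts in simplicial degree $0$ is the one prescribed for the cochains
    -- of $\Delta_n$.
    have hφ : (eqvObjOfTot x).φ₀ =
        diag (isVertexFamily_totE x) (isVertexFamily_totE x) (totφ x) := funext fun n => by
      cases n with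
      | zero => exact (diag_eq_zero _ _ (totφ_zero x) rfl).symm
      | succ n => rfl
    refine DGCat.SimplexObj.ext_of_heq hE ((DGCat.Coch.heq_iff hE hE).2 fun q I => ?_)
    refine ((eqvObjOfTot x).coch_heq I).trans ?_
    rw [hφ]
    exact pull_map_diag_heq _ _ (isCompatible_totφ x) I
  right_inv e := by
    refine EqvObj.ext_of_heq ?_ fun n hn => ?_
    -- The round trip replaces $E$ by its pull-back along the identity of $X$, which equals $E$ by
    -- strictness.
    · exact (congrArg (fun f => (F.pull f).obj e.E) (a.vertexMap_zero 0)).trans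
        (F.pull_id_obj e.E)
    · refine (diag_heq (isVertexFamily_totE e.toTot) (isVertexFamily_totE e.toTot) _ n).trans ?_
      exact (extend_id_heq e.isVertexFamily e.isVertexFamily e.φ₀ n).trans
        (heq_of_eq (e.φ_eq_φ₀ hn).symm)

/-! ### Differential, composition and identities -/

section Compatibility

variable {x y z : (DGCat.Tot c (a.cosimplicial F)).Obj}

/-- Taking the component at $0\,1\ldots n$ is linear, so the twisted differential splits into
$D\theta$, $\psi\cdot\theta$ and $\theta\cdot\phi$, each of which is computed by the diagonal
formulas. -/
theorem totHomEquiv_d {m m' : ℤ} (h : m + 1 = m')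
    (θ : (DGCat.Tot c (a.cosimplicial F)).Hom x y m) :
    totHomEquiv x y m' ((DGCat.Tot c (a.cosimplicial F)).d h θ) =
      EqvHom.d (x := eqvObjOfTot x) (y := eqvObjOfTot y) h (totHomEquiv x y m θ) := by
  have hx := isVertexFamily_totE x
  have hy := isVertexFamily_totE y
  have hθ := isCompatible_totHom θ
  funext n
  have key : totHomEquiv x y m' ((DGCat.Tot c (a.cosimplicial F)).d h θ) n =
      diag hx hy (fun n => DGCat.Coch.diff h (totHom θ n)) n +
      diag hx hy (fun n => DGCat.Coch.mul (by omega : 1 + m = m') (totφ y n) (totHom θ n)) n -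
      m.negOnePow •
        diag hx hy (fun n => DGCat.Coch.mul (by omega : m + 1 = m') (totHom θ n) (totφ x n)) n := by
    simp only [diag]
    rw [← DGCat.castHom_negOnePow, ← map_add, ← map_sub]
    rfl
  -- The summand $l=0$ of $\psi\cdot\theta$ and the summand $l=n$ of $\theta\cdot\phi$ vanish, since
  -- $\psi$ and $\phi$ have no component in simplicial degree $0$; this gives the ranges $1\le l\le
  -- n$ and $0\le l<n$.
  rw [key, diag_mul hx hy hy _ (isCompatible_totφ y) hθ, diag_mul hx hx hy _ hθ
    (isCompatible_totφ x), Fin.sum_univ_succ,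
    Fin.sum_univ_castSucc (n := n) (f := fun l => ((m - (l : ℕ)) * (n - (l : ℕ)) : ℤ).negOnePow •
        cupTerm _ _ _ _),
    diag_eq_zero hy hy (totφ_zero y) (n := ((0 : Fin (n + 1)) : ℕ)) rfl, cupTerm_zero_left,
    diag_eq_zero hx hx (totφ_zero x) (n := n - (Fin.last n : ℕ)) (by simp), cupTerm_zero_right,
    smul_zero, smul_zero, zero_add, add_zero]
  refine congrArg₂ (· - ·) (congrArg₂ (· + ·) ?_ rfl) rfl
  cases n with
  | zero =>
    -- In simplicial degree $0$ the sign $(-1)^0$ and the empty face sum have to be inserted.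
    refine (diag_diff_zero hx hy h).trans (((one_smul ℤˣ _).symm.trans ?_).trans (add_zero _).symm)
    exact congrArg (· • _) Int.negOnePow_zero.symm
  | succ n => exact diag_diff_succ hx hy h hθ n

theorem totHomEquiv_comp {p q m : ℤ} (h : p + q = m)
    (θ : (DGCat.Tot c (a.cosimplicial F)).Hom y z p)
    (η : (DGCat.Tot c (a.cosimplicial F)).Hom x y q) :
    totHomEquiv x z m ((DGCat.Tot c (a.cosimplicial F)).comp h θ η) =
      EqvHom.comp (x := eqvObjOfTot x) (y := eqvObjOfTot y) (z := eqvObjOfTot z) h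
        (totHomEquiv y z p θ) (totHomEquiv x y q η) :=
  funext fun n => diag_mul (isVertexFamily_totE x) (isVertexFamily_totE y)
    (isVertexFamily_totE z) h (isCompatible_totHom θ) (isCompatible_totHom η) n

theorem totHomEquiv_id (x : (DGCat.Tot c (a.cosimplicial F)).Obj) :
    totHomEquiv x x 0 ((DGCat.Tot c (a.cosimplicial F)).id x) =
      EqvHom.id (eqvObjOfTot x) := by
  funext n
  cases n with
  | zero =>
    refine eq_of_heq ((diag_heq (isVertexFamily_totE x) (isVertexFamily_totE x) _ 0).trans ?_)
    refine (DGCat.castHom_heq (F.rect X) _ _ _ _).trans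
      (HEq.trans ?_ (DGCat.castHom_heq (F.rect X) _ _ _ _).symm)
    exact DGCat.id_heq (B := F.rect X) ((isVertexFamily_totE x).back 0)
  | succ n => exact ((F.rect (a.space (n + 1))).castHom _ _ _).map_zero

end Compatibility

end DGPseudoFunctor

/-- The components are compared by `HEq` because $E^n_i$ and the pull-back of $E$ along the vertex
map are equal only by the equalizer condition. The convention `c` affects objects only; morphisms
carry no normalization. -/
theorem proposition12 {k : Type w} [CommRing k] {S : AlgebraicGeometry.Scheme.{u₁}} {X G : Over S} [GrpObj G]
    (a : RightAction X G) (F : DGPseudoFunctor.{w, v, u} k (Over S))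
    (c : DegeneracyConvention) :
    ∃ (Φ : (DGCat.Tot c (a.cosimplicial F)).Obj ≃ DGPseudoFunctor.EqvObj F a c)
      (Ψ : ∀ (x y : (DGCat.Tot c (a.cosimplicial F)).Obj) (m : ℤ),
        (DGCat.Tot c (a.cosimplicial F)).Hom x y m ≃ₗ[k]
          DGPseudoFunctor.EqvHom (Φ x) (Φ y) m),
      (∀ x, (Φ x).E = (DGCat.Tot.component x 0).E 0) ∧
      (∀ x (n : ℕ) (hn : 1 ≤ n),
        HEq ((Φ x).φ n hn) ((DGCat.Tot.component x n).φ n OrderHom.id)) ∧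
      (∀ x y m θ (n : ℕ), HEq (Ψ x y m θ n) (DGCat.Tot.homComponent θ n n OrderHom.id)) ∧
      (∀ x y (m m' : ℤ) (h : m + 1 = m') θ,
        Ψ x y m' ((DGCat.Tot c (a.cosimplicial F)).d h θ) =
          DGPseudoFunctor.EqvHom.d h (Ψ x y m θ)) ∧
      (∀ x y z (p q m : ℤ) (h : p + q = m) θ η,
        Ψ x z m ((DGCat.Tot c (a.cosimplicial F)).comp h θ η) =
          DGPseudoFunctor.EqvHom.comp h (Ψ y z p θ) (Ψ x y q η)) ∧
      (∀ x, Ψ x x 0 ((DGCat.Tot c (a.cosimplicial F)).id x) =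
        DGPseudoFunctor.EqvHom.id (Φ x)) :=
  ⟨DGPseudoFunctor.totObjEquiv, DGPseudoFunctor.totHomEquiv, fun _ => rfl,
    fun x n _ => DGPseudoFunctor.diag_heq (DGPseudoFunctor.isVertexFamily_totE x)
      (DGPseudoFunctor.isVertexFamily_totE x) _ n,
    fun x y _ _ n => DGPseudoFunctor.diag_heq (DGPseudoFunctor.isVertexFamily_totE x)
      (DGPseudoFunctor.isVertexFamily_totE y) _ n,
    fun _ _ _ _ h θ => DGPseudoFunctor.totHomEquiv_d h θ,
    fun _ _ _ _ _ _ h θ η => DGPseudoFunctor.totHomEquiv_comp h θ η,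
    fun x => DGPseudoFunctor.totHomEquiv_id x⟩
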